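/- Let $p\ge 1$ and let $(\xi_t)_{t\in\mathbb Z}$ be a strong white noise with variance $1$ (i.i.d., $\mathbb E\xi_0=0$, $\operatorname{Var}(\xi_0)=1$) such that $\operatorname{Var}(\xi_0^2)>0$ and $\mathbb E|\xi_0|^{4(1+\delta)}<\infty$ for some $\delta\in(0,1)$. For $T\ge 1$ let $(X_t)=(X_{t,T})$ follow the ARCH model with time-varying intercept and constant lag coefficients $$X_t=\xi_t\sqrt{a_0(t/T)+\sum_{j=1}^p a_jX_{t-j}^2},\qquad 1\le t\le T,$$ where $(X_t)_{t\le 0}$ is the past of a stationary ARCH process with noise $\xi$ and coefficients $a_0(0),a_1,\dots,a_p$; here $a_0$ is positive and Lipschitz continuous on $[0,1]$, $a_j\ge 0$ and $\sum_{j=1}^p a_j<1$. Let $(X_t(u))_t$ be the stationary ARCH process with noise $\xi$ and coefficients $a_0(u),a_1,\dots,a_p$. Let $K\ge 0$ be a kernel with support $[-1,1]$ that is absolutely continuous on $[-1,1]$, and let $$k_{t,i}(b)=\frac{K\left(\frac{t-i}{Tb}\right)}{\sum_{l=p+1}^TK\left(\frac{t-l}{Tb}\right)},\qquad \hat d_t=\sum_{i=p+1}^T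 k_{t,i}(b)X_i^2,\qquad 1\le t\le T.$$ Let $(\hat a_1,\dots,\hat a_p)$ be a random vector that minimizes, over $(\alpha_1,\dots,\alpha_p)\in\mathbb R^p$, $$\sum_{t=p+1}^T\Big(X_t^2-\hat d_t-\sum_{j=1}^p \alpha_j\big(X_{t-j}^2-\hat d_{t-j}\big)\Big)^2 .$$ Assume that $b=b_T\in[cT^{-h},CT^{-h}]$ for constants $c,C>0$ and some $h$ with $\frac14<h<\frac34-\frac1{2(1+\delta)}$. Then under $H_0:\ a_1=\dots=a_p=0$, as $T\to\infty$, $$T\sum_{j=1}^p\max(\hat a_j,0)^2\ \xrightarrow{\ \mathcal D\ }\ \sigma^2\sum_{j=1}^p\max(Z_j,0)^2,$$ where $Z$ is a standard Gaussian vector in $\mathbb R^p$ and $$\sigma^2=\frac{\int_0^1\operatorname{Var}\big(X_0(u)^2\big)^2du}{\Big(\int_0^1\operatorname{Var}\big(X_0(u)^2\big)du\Big)^2}=\frac{\int_0^1a_0(u)^4du}{\Big(\int_0^1a_0(u)^2du\Big)^2}.$$ -/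

import Mathlib

open MeasureTheory ProbabilityTheory Filter Set
open scoped NNReal ENNReal

/-- A strong white noise with unit variance: an i.i.d. sequence of centred real random variables
with variance `1`. -/
structure IsStrongWhiteNoise {Ω : Type*} [MeasurableSpace Ω] (P : Measure Ω)
    (ξ : ℤ → Ω → ℝ) : Prop where
  measurable : ∀ t, Measurable (ξ t)
  indep : iIndepFun ξ P
  identDistrib : ∀ t, IdentDistrib (ξ t) (ξ 0) P P
  memLp_two : MemLp (ξ 0) 2 P
  mean_eq_zero : ∫ ω, ξ 0 ω ∂P = 0
  variance_eq_one : variance (ξ 0) P = 1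

/-- The ARCH volatility `σ_t = √(c + ∑_{j=1}^p a_j x_{t-j}²)` along a path `x`, for the intercept
`c`.  The lag `j ∈ {1, …, p}` is represented by the element `j - 1` of `Fin p`. -/
noncomputable def archVolatility {p : ℕ} (c : ℝ) (a : Fin p → ℝ) (x : ℤ → ℝ) (t : ℤ) : ℝ :=
  Real.sqrt (c + ∑ j : Fin p, a j * x (t - ((j : ℤ) + 1)) ^ 2)

/-- `Y` is a (strictly) stationary ARCH process with noise `ξ`, intercept `c` and lag
coefficients `a`. -/
structure IsStationaryARCH {Ω : Type*} [MeasurableSpace Ω] (P : Measure Ω) {p : ℕ}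
    (ξ : ℤ → Ω → ℝ) (c : ℝ) (a : Fin p → ℝ) (Y : ℤ → Ω → ℝ) : Prop where
  recursion : ∀ t, ∀ᵐ ω ∂P, Y t ω = ξ t ω * archVolatility c a (fun s => Y s ω) t
  stationary : IdentDistrib (fun ω (t : ℤ) => Y (t + 1) ω) (fun ω (t : ℤ) => Y t ω) P P

/-- The array `X T t` follows the ARCH model with time-varying intercept `a₀` and constant lag
coefficients `a`:  `X_t = ξ_t √(a₀(t/T) + ∑_j a_j X_{t-j}²)` for `1 ≤ t ≤ T`, and
`(X_t)_{t ≤ 0}` is the past of a stationary ARCH process with coefficients `a₀(0), a`. -/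
structure IsTimeVaryingInterceptARCH {Ω : Type*} [MeasurableSpace Ω] (P : Measure Ω) {p : ℕ}
    (ξ : ℤ → Ω → ℝ) (a₀ : ℝ → ℝ) (a : Fin p → ℝ) (X : ℕ → ℤ → Ω → ℝ) : Prop where
  recursion : ∀ (T : ℕ) (t : ℤ), 1 ≤ t → t ≤ (T : ℤ) →
    ∀ᵐ ω ∂P, X T t ω = ξ t ω * archVolatility (a₀ ((t : ℝ) / (T : ℝ))) a (fun s => X T s ω) t
  past : ∃ Y : ℤ → Ω → ℝ, IsStationaryARCH P ξ (a₀ 0) a Y ∧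
    ∀ (T : ℕ) (t : ℤ), t ≤ 0 → ∀ᵐ ω ∂P, X T t ω = Y t ω

/-- The regularity and contraction assumption on the coefficients: `a₀` is positive and Lipschitz
continuous on `[0,1]`, the lag coefficients are nonnegative and their sum is less than `1`. -/
structure ContractionCondition {p : ℕ} (a₀ : ℝ → ℝ) (a : Fin p → ℝ) : Prop where
  pos : ∀ u ∈ Icc (0 : ℝ) 1, 0 < a₀ u
  lipschitz : ∃ L : ℝ≥0, LipschitzOnWith L a₀ (Icc 0 1)
  lag_nonneg : ∀ j, 0 ≤ a j
  sum_lag_lt_one : ∑ j, a j < 1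

/-- The moment assumption of order `q` with exponent `δ ∈ (0,1)`: `E |ξ_0|^{q(1+δ)} < ∞`. -/
structure MomentCondition {Ω : Type*} [MeasurableSpace Ω] (P : Measure Ω)
    (ξ : ℤ → Ω → ℝ) (q : ℕ) (δ : ℝ) : Prop where
  exponent_mem : δ ∈ Ioo (0 : ℝ) 1
  integrable : Integrable (fun ω => |ξ 0 ω| ^ ((q : ℝ) * (1 + δ))) P

/-- A smoothing kernel: a nonnegative function with support `[-1,1]`, absolutely continuous
on `[-1,1]`.  (Only ratios of kernel values are used, so no normalization is imposed.) -/
structure IsSmoothingKernel (K : ℝ → ℝ) : Prop where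
  nonneg : ∀ x, 0 ≤ K x
  absolutelyContinuous : AbsolutelyContinuousOnInterval K (-1) 1
  support : tsupport K = Icc (-1) 1

/-- The kernel weight `k_{t,i}(b) = K((t-i)/(Tb)) / ∑_{l=p+1}^T K((t-l)/(Tb))`. -/
noncomputable def kernelWeight (K : ℝ → ℝ) (p T : ℕ) (b : ℝ) (t i : ℤ) : ℝ :=
  K (((t : ℝ) - (i : ℝ)) / ((T : ℝ) * b)) /
    ∑ l ∈ Finset.Icc ((p : ℤ) + 1) (T : ℤ), K (((t : ℝ) - (l : ℝ)) / ((T : ℝ) * b))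

/-- The kernel mean of the squares, `d̂_t = ∑_{i=p+1}^T k_{t,i}(b) x_i²`. -/
noncomputable def kernelMeanSq (K : ℝ → ℝ) (p T : ℕ) (b : ℝ) (x : ℤ → ℝ) (t : ℤ) : ℝ :=
  ∑ i ∈ Finset.Icc ((p : ℤ) + 1) (T : ℤ), kernelWeight K p T b t i * x i ^ 2

/-- The centred squares `x_t² - d̂_t`. -/
noncomputable def centredSq (K : ℝ → ℝ) (p T : ℕ) (b : ℝ) (x : ℤ → ℝ) (t : ℤ) : ℝ :=
  x t ^ 2 - kernelMeanSq K p T b x t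

/-- The least-squares criterion
`∑_{t=p+1}^T (x_t² - d̂_t - ∑_{j=1}^p α_j (x_{t-j}² - d̂_{t-j}))²`. -/
noncomputable def leastSquaresCriterion (K : ℝ → ℝ) (p T : ℕ) (b : ℝ) (x : ℤ → ℝ)
    (α : Fin p → ℝ) : ℝ :=
  ∑ t ∈ Finset.Icc ((p : ℤ) + 1) (T : ℤ),
    (centredSq K p T b x t
      - ∑ j : Fin p, α j * centredSq K p T b x (t - ((j : ℤ) + 1))) ^ 2

/-- The correction factor `σ² = ∫₀¹ Var(X_0(u)²)² du / (∫₀¹ Var(X_0(u)²) du)²`, where `Xs u` is the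
stationary process attached to the rescaled time `u`. -/
noncomputable def correctionFactor {Ω : Type*} [MeasurableSpace Ω] (P : Measure Ω)
    (Xs : ℝ → ℤ → Ω → ℝ) : ℝ :=
  (∫ u in (0 : ℝ)..1, variance (fun ω => Xs u 0 ω ^ 2) P ^ 2) /
    (∫ u in (0 : ℝ)..1, variance (fun ω => Xs u 0 ω ^ 2) P) ^ 2

/-!
Under the null hypothesis `X_t² = α(t/T) ξ_t²` for `1 ≤ t ≤ T`, where `α` is the intercept.  With
`f(x) = x² - 1` and `η_t = α(t/T) f(ξ_t)`, the centred squares are `η_t + r_t`, and the smoothing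
error `r_t` is the sum of a deterministic bias and of minus the weighted mean `∑_i k_{t,i} η_i`.
The bias is `O(b)`, as `α` is Lipschitz and the weights `k_{t,i}` live on `|t - i| ≤ T b`; the
weights are `O(1/(Tb))`, as the kernel is continuous and bounded below on a subinterval of either
half of its support (`IsSmoothingKernel.exists_isSmoothing`).

The smoothing error is invisible in the sample autocovariances at the scale `T^{1/2}`
(`IsIID.integral_abs_sum_centred_sub_le`).  The products `r_t r_{t-j}` are `O(b² + 1/(Tb))` in
mean.  The sums `∑_t η_t r_{t-j}` are not estimated termwise: their bias part is a linear form in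
the `f(ξ_t)` and their stochastic part is a quadratic form whose coefficients are the weights, so
that orthogonality gives `O(T^{1/2} b)` and `O(1/b + b^{-1/2})`.  All of this is `o(T^{1/2})` when
`b` is of order `T^{-h}` with `1/4 < h < 1/2`, and `δ < 1` makes `h < 1/2`.

By the normal equations, `T^{1/2} â` solves a linear system whose matrix, `T⁻¹` times the Gram
matrix, tends to `γ` times the identity, with `γ = V ∫ α²` and `V = E f(ξ_0)²`, by a weighted law
of large numbers (`IsIID.tendsto_gram`); its right-hand side is asymptotically the vector
`T^{-1/2} ∑_t η_t η_{t-j}`, `1 ≤ j ≤ p`.  Every linear combination of the latter is a sum of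
martingale differences `d_t`.  For bounded `f` the characteristic function is obtained from
`e^{ix} ≈ (1 + ix) e^{-x²/2}`: the product `∏ (1 + i d_t)` has mean one, and the quadratic variation
`∑ d_t²` converges in `L¹`, being a sum of boundedly dependent variables
(`IsIID.norm_integral_cexp_sub_le`, `IsIID.tendsto_quadratic_variation`).  A truncation in `L²`
removes the boundedness, so that two moments of `f(ξ_0)` suffice.  The limit is centred Gaussian
with covariance `V² ∫ α⁴` times the identity, hence `T^{1/2} â` tends in law to
`γ⁻¹ (V² ∫ α⁴)^{1/2} Z` (`IsIID.tendstoInDistribution_leastSquares`), in which `V` cancels, and the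
continuous map `y ↦ ∑ max(y_j, 0)²` gives the claim.
-/

set_option linter.unusedSectionVars false

open scoped Topology

/-! ### Second moments of linear and bilinear forms in an i.i.d. sequence -/

/-- An i.i.d. sequence of real random variables indexed by `ℤ`. -/
structure IsIID {Ω : Type*} [MeasurableSpace Ω] (P : Measure Ω) (ξ : ℤ → Ω → ℝ) : Prop where
  measurable : ∀ t, Measurable (ξ t)
  indep : iIndepFun ξ P
  identDistrib : ∀ t, IdentDistrib (ξ t) (ξ 0) P P

/-- The σ-algebra generated by the variables `ξ i`, `i ∈ S`. -/
abbrev sigmaOn {Ω : Type*} (ξ : ℤ → Ω → ℝ) (S : Set ℤ) : MeasurableSpace Ω :=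
  ⨆ i ∈ S, MeasurableSpace.comap (ξ i) inferInstance

section
variable {Ω : Type*} [mΩ : MeasurableSpace Ω] {P : Measure Ω} [IsProbabilityMeasure P]
  {ξ : ℤ → Ω → ℝ}

lemma sigmaOn_mono {S S' : Set ℤ} (h : S ⊆ S') : sigmaOn ξ S ≤ sigmaOn ξ S' :=
  biSup_mono h

lemma IsIID.sigmaOn_le (hξ : IsIID P ξ) (S : Set ℤ) : sigmaOn ξ S ≤ mΩ :=
  iSup₂_le fun i _ => (hξ.measurable i).comap_le

lemma measurable_sigmaOn {S : Set ℤ} {i : ℤ} (hi : i ∈ S) {f : ℝ → ℝ} (hf : Measurable f) :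
    Measurable[sigmaOn ξ S] (fun ω => f (ξ i ω)) := by
  have h1 : Measurable[MeasurableSpace.comap (ξ i) inferInstance] (fun ω => f (ξ i ω)) :=
    hf.comp (comap_measurable (ξ i))
  exact h1.mono (le_iSup₂_of_le i hi le_rfl) le_rfl

lemma IsIID.measurable_comp (hξ : IsIID P ξ) {f : ℝ → ℝ} (hf : Measurable f) (t : ℤ) :
    Measurable (fun ω => f (ξ t ω)) := hf.comp (hξ.measurable t)

lemma IsIID.indepFun_of_disjoint {β γ : Type*} [MeasurableSpace β] [MeasurableSpace γ]
    (hξ : IsIID P ξ) {S S' : Set ℤ} (hS : Disjoint S S')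
    {X : Ω → β} {Y : Ω → γ} (hX : Measurable[sigmaOn ξ S] X) (hY : Measurable[sigmaOn ξ S'] Y) :
    IndepFun X Y P := by
  have h := indep_iSup_of_disjoint (fun i => (hξ.measurable i).comap_le) hξ.indep hS
  rw [IndepFun_iff_Indep]
  exact indep_of_indep_of_le_left (indep_of_indep_of_le_right h hY.comap_le) hX.comap_le

lemma IsIID.integral_comp (hξ : IsIID P ξ) {f : ℝ → ℝ} (hf : Measurable f) (t : ℤ) :
    ∫ ω, f (ξ t ω) ∂P = ∫ ω, f (ξ 0 ω) ∂P :=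
  ((hξ.identDistrib t).comp hf).integral_eq

lemma IsIID.memLp_comp (hξ : IsIID P ξ) {f : ℝ → ℝ} (hf : Measurable f) {q : ℝ≥0∞}
    (h : MemLp (fun ω => f (ξ 0 ω)) q P) (t : ℤ) : MemLp (fun ω => f (ξ t ω)) q P :=
  ((hξ.identDistrib t).comp hf).memLp_iff.2 h

lemma integral_add_add {X Y W : Ω → ℝ} (hX : Integrable X P) (hY : Integrable Y P)
    (hW : Integrable W P) :
    ∫ ω, X ω + Y ω + W ω ∂P = ∫ ω, X ω ∂P + ∫ ω, Y ω ∂P + ∫ ω, W ω ∂P := by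
  have h := integral_add (hX.add hY) hW
  rw [integral_add' hX hY] at h
  exact h

lemma IndepFun.memLp_two_mul {X Y : Ω → ℝ} (h : IndepFun X Y P) (hX : MemLp X 2 P)
    (hY : MemLp Y 2 P) : MemLp (fun ω => X ω * Y ω) 2 P := by
  refine (memLp_two_iff_integrable_sq (hX.aestronglyMeasurable.mul hY.aestronglyMeasurable)).2 ?_
  have h2 : IndepFun (fun ω => X ω ^ 2) (fun ω => Y ω ^ 2) P :=
    h.comp (φ := fun x : ℝ => x ^ 2) (ψ := fun x : ℝ => x ^ 2) (by fun_prop) (by fun_prop)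
  simp only [Pi.mul_apply, mul_pow]
  exact h2.integrable_mul hX.integrable_sq hY.integrable_sq

lemma IndepFun.integral_mul_sq {X Y : Ω → ℝ} (h : IndepFun X Y P) (hX : MemLp X 2 P)
    (hY : MemLp Y 2 P) :
    ∫ ω, (X ω * Y ω) ^ 2 ∂P = (∫ ω, X ω ^ 2 ∂P) * ∫ ω, Y ω ^ 2 ∂P := by
  have h2 : IndepFun (fun ω => X ω ^ 2) (fun ω => Y ω ^ 2) P :=
    h.comp (φ := fun x : ℝ => x ^ 2) (ψ := fun x : ℝ => x ^ 2) (by fun_prop) (by fun_prop)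
  simp_rw [mul_pow]
  exact h2.integral_fun_mul_eq_mul_integral hX.integrable_sq.aestronglyMeasurable
    hY.integrable_sq.aestronglyMeasurable

/-- Square integrability and the second moment of a sum of martingale differences `x_t H_t`, where
`x_t` is centred and a function of `ξ_t`, and `H_t` is a function of the past of `ξ_t`. -/
lemma IsIID.martingale_sum (hξ : IsIID P ξ) (s : Finset ℤ) (x H : ℤ → Ω → ℝ)
    (hx : ∀ t, Measurable[sigmaOn ξ {t}] (x t)) (hH : ∀ t, Measurable[sigmaOn ξ (Iio t)] (H t))
    (hx2 : ∀ t, MemLp (x t) 2 P) (hH2 : ∀ t, MemLp (H t) 2 P) (hx0 : ∀ t, ∫ ω, x t ω ∂P = 0) :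
    MemLp (fun ω => ∑ t ∈ s, x t ω * H t ω) 2 P ∧
      ∫ ω, (∑ t ∈ s, x t ω * H t ω) ^ 2 ∂P =
        ∑ t ∈ s, (∫ ω, x t ω ^ 2 ∂P) * ∫ ω, H t ω ^ 2 ∂P := by
  have hind : ∀ t, IndepFun (x t) (H t) P := fun t =>
    hξ.indepFun_of_disjoint (by simp) (hx t) (hH t)
  have hmem : ∀ s : Finset ℤ, MemLp (fun ω => ∑ t ∈ s, x t ω * H t ω) 2 P := fun s =>
    memLp_finsetSum s fun t _ => IndepFun.memLp_two_mul (hind t) (hx2 t) (hH2 t)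
  refine ⟨hmem s, ?_⟩
  induction s using Finset.induction_on_max with
  | empty => simp
  | insert a s has ih =>
    have hna : a ∉ s := fun h => lt_irrefl _ (has a h)
    have hSm : Measurable[sigmaOn ξ (Iio a)] (fun ω => ∑ t ∈ s, x t ω * H t ω) := by
      refine Finset.measurable_fun_sum s fun t ht => ?_
      exact ((hx t).mono (sigmaOn_mono (by simpa using has t ht)) le_rfl).mul
        ((hH t).mono (sigmaOn_mono (Iio_subset_Iio (has t ht).le)) le_rfl)
    have hcross : ∫ ω, x a ω * ((∑ t ∈ s, x t ω * H t ω) * H a ω) ∂P = 0 := by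
      have hi : IndepFun (x a) (fun ω => (∑ t ∈ s, x t ω * H t ω) * H a ω) P :=
        hξ.indepFun_of_disjoint (S := {a}) (S' := Iio a) (by simp) (hx a) (hSm.mul (hH a))
      rw [hi.integral_fun_mul_eq_mul_integral (hx2 a).aestronglyMeasurable
        ((hmem s).aestronglyMeasurable.mul (hH2 a).aestronglyMeasurable), hx0, zero_mul]
    have hicross : Integrable (fun ω => x a ω * ((∑ t ∈ s, x t ω * H t ω) * H a ω)) P := by
      have := (hmem s).integrable_mul (IndepFun.memLp_two_mul (hind a) (hx2 a) (hH2 a))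
      refine this.congr (ae_of_all _ fun ω => ?_)
      simp only [Pi.mul_apply]; ring
    have hsq := (IndepFun.memLp_two_mul (hind a) (hx2 a) (hH2 a)).integrable_sq
    rw [Finset.sum_insert hna]
    simp_rw [Finset.sum_insert hna]
    calc ∫ ω, (x a ω * H a ω + ∑ t ∈ s, x t ω * H t ω) ^ 2 ∂P
        = ∫ ω, ((x a ω * H a ω) ^ 2 + 2 * (x a ω * ((∑ t ∈ s, x t ω * H t ω) * H a ω)))
            + (∑ t ∈ s, x t ω * H t ω) ^ 2 ∂P := by
          congr 1; ext ω; ring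
      _ = _ := by
          rw [integral_add_add hsq (hicross.const_mul 2) (hmem s).integrable_sq,
            integral_const_mul, hcross, IndepFun.integral_mul_sq (hind a) (hx2 a) (hH2 a), ih]
          ring

/-- The second moment of a linear form in centred i.i.d. variables. -/
lemma IsIID.linear_form (hξ : IsIID P ξ) {ι : Type*} [DecidableEq ι] (s : Finset ι) (φ : ι → ℤ)
    (hφ : InjOn φ s)
    (c : ι → ℝ) {f : ℝ → ℝ} (hf : Measurable f) (hf2 : MemLp (fun ω => f (ξ 0 ω)) 2 P)
    (hf0 : ∫ ω, f (ξ 0 ω) ∂P = 0) :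
    ∫ ω, (∑ i ∈ s, c i * f (ξ (φ i) ω)) ^ 2 ∂P = (∫ ω, f (ξ 0 ω) ^ 2 ∂P) * ∑ i ∈ s, c i ^ 2 := by
  have hmem : ∀ s : Finset ι, MemLp (fun ω => ∑ i ∈ s, c i * f (ξ (φ i) ω)) 2 P := fun s =>
    memLp_finsetSum s fun i _ => (hξ.memLp_comp hf hf2 (φ i)).const_mul (c i)
  induction s using Finset.induction_on with
  | empty => simp
  | insert a s has ih =>
    have hSm : Measurable[sigmaOn ξ (φ '' s)] (fun ω => ∑ i ∈ s, c i * f (ξ (φ i) ω)) :=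
      Finset.measurable_fun_sum s fun i hi =>
        (measurable_sigmaOn (mem_image_of_mem φ hi) hf).const_mul _
    have hφa : φ a ∉ φ '' s := by
      rintro ⟨i, hi, h⟩
      have := hφ (by simp [Finset.mem_coe.1 hi]) (by simp) h
      exact has (this ▸ hi)
    have hi : IndepFun (fun ω => f (ξ (φ a) ω)) (fun ω => ∑ i ∈ s, c i * f (ξ (φ i) ω)) P :=
      hξ.indepFun_of_disjoint (S := {φ a}) (by simpa using hφa)
        (measurable_sigmaOn (mem_singleton _) hf) hSm
    have hm := hξ.memLp_comp hf hf2 (φ a)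
    have hcross : ∫ ω, f (ξ (φ a) ω) * ∑ i ∈ s, c i * f (ξ (φ i) ω) ∂P = 0 := by
      rw [hi.integral_fun_mul_eq_mul_integral hm.aestronglyMeasurable
        (hmem s).aestronglyMeasurable, hξ.integral_comp hf, hf0, zero_mul]
    have hic : Integrable (fun ω => f (ξ (φ a) ω) * ∑ i ∈ s, c i * f (ξ (φ i) ω)) P :=
      hm.integrable_mul (hmem s)
    have hsqa : ∫ ω, f (ξ (φ a) ω) ^ 2 ∂P = ∫ ω, f (ξ 0 ω) ^ 2 ∂P :=
      hξ.integral_comp (hf.pow_const 2) _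
    simp_rw [Finset.sum_insert has]
    calc ∫ ω, (c a * f (ξ (φ a) ω) + ∑ i ∈ s, c i * f (ξ (φ i) ω)) ^ 2 ∂P
        = ∫ ω, (c a ^ 2 * f (ξ (φ a) ω) ^ 2
            + (2 * c a) * (f (ξ (φ a) ω) * ∑ i ∈ s, c i * f (ξ (φ i) ω)))
            + (∑ i ∈ s, c i * f (ξ (φ i) ω)) ^ 2 ∂P := by
          congr 1; ext ω; ring
      _ = _ := by
          rw [integral_add_add (hm.integrable_sq.const_mul _) (hic.const_mul _)
            (hmem s).integrable_sq, integral_const_mul,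
            integral_const_mul, hcross, hsqa,
            ih (hφ.mono (by simp))]
          ring

/-- The second moment of a strictly lower triangular bilinear form in two centred functions of
i.i.d. variables. -/
lemma IsIID.lower_form (hξ : IsIID P ξ) (I J : Finset ℤ) (A : ℤ → ℤ → ℝ) {f g : ℝ → ℝ}
    (hf : Measurable f) (hf2 : MemLp (fun ω => f (ξ 0 ω)) 2 P) (hf0 : ∫ ω, f (ξ 0 ω) ∂P = 0)
    (hg : Measurable g) (hg2 : MemLp (fun ω => g (ξ 0 ω)) 2 P) (hg0 : ∫ ω, g (ξ 0 ω) ∂P = 0) :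
    MemLp (fun ω => ∑ t ∈ I, f (ξ t ω) * ∑ s ∈ J with s < t, A t s * g (ξ s ω)) 2 P ∧
    ∫ ω, (∑ t ∈ I, f (ξ t ω) * ∑ s ∈ J with s < t, A t s * g (ξ s ω)) ^ 2 ∂P =
      (∫ ω, f (ξ 0 ω) ^ 2 ∂P) * (∫ ω, g (ξ 0 ω) ^ 2 ∂P) *
        ∑ t ∈ I, ∑ s ∈ J with s < t, A t s ^ 2 := by
  obtain ⟨h1, h2⟩ := hξ.martingale_sum I (fun t ω => f (ξ t ω))
    (fun t ω => ∑ s ∈ J with s < t, A t s * g (ξ s ω))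
    (fun t => measurable_sigmaOn (mem_singleton _) hf)
    (fun t => Finset.measurable_fun_sum _ fun s hs =>
      (measurable_sigmaOn (by simpa using (Finset.mem_filter.1 hs).2) hg).const_mul _)
    (fun t => hξ.memLp_comp hf hf2 t)
    (fun t => memLp_finsetSum _ fun s _ => (hξ.memLp_comp hg hg2 s).const_mul _)
    (fun t => by rw [hξ.integral_comp hf, hf0])
  refine ⟨h1, h2.trans ?_⟩
  rw [Finset.mul_sum]
  refine Finset.sum_congr rfl fun t _ => ?_
  rw [hξ.integral_comp (hf.pow_const 2),
    hξ.linear_form _ (fun s => s) (fun _ _ _ _ h => h) _ hg hg2 hg0, mul_assoc]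

/-- The mean of `|X|` is at most the root mean square. -/
lemma integral_abs_le_sqrt {X : Ω → ℝ} (hX : MemLp X 2 P) :
    ∫ ω, |X ω| ∂P ≤ √(∫ ω, X ω ^ 2 ∂P) := by
  refine Real.le_sqrt_of_sq_le ?_
  have h := variance_nonneg (fun ω => |X ω|) P
  rw [variance_eq_sub (show MemLp (fun ω => |X ω|) 2 P from hX.abs)] at h
  simp only [Pi.pow_apply, sq_abs] at h
  linarith

/-- A bound on the first absolute moment of a bilinear form `∑ A_{ts} f(ξ_t) f(ξ_s)`:  the diagonal
contributes its absolute values, the triangular parts their Hilbert–Schmidt norms. -/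
lemma IsIID.integral_abs_quadratic_form_le (hξ : IsIID P ξ) (I J : Finset ℤ) (A : ℤ → ℤ → ℝ)
    {f : ℝ → ℝ} (hf : Measurable f) (hf2 : MemLp (fun ω => f (ξ 0 ω)) 2 P)
    (hf0 : ∫ ω, f (ξ 0 ω) ∂P = 0) :
    ∫ ω, |∑ t ∈ I, ∑ s ∈ J, A t s * (f (ξ t ω) * f (ξ s ω))| ∂P ≤
      (∫ ω, f (ξ 0 ω) ^ 2 ∂P) * (∑ t ∈ I with t ∈ J, |A t t|
        + 2 * √(∑ t ∈ I, ∑ s ∈ J, A t s ^ 2)) := by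
  set V := ∫ ω, f (ξ 0 ω) ^ 2 ∂P with hV
  have hV0 : 0 ≤ V := integral_nonneg fun _ => sq_nonneg _
  set L : Ω → ℝ := fun ω => ∑ t ∈ I, f (ξ t ω) * ∑ s ∈ J with s < t, A t s * f (ξ s ω) with hL
  set U : Ω → ℝ := fun ω => ∑ s ∈ J, f (ξ s ω) * ∑ t ∈ I with t < s, A t s * f (ξ t ω) with hU
  set D : Ω → ℝ := fun ω => ∑ t ∈ I with t ∈ J, A t t * f (ξ t ω) ^ 2 with hD
  obtain ⟨hL1, hL2⟩ := hξ.lower_form I J A hf hf2 hf0 hf hf2 hf0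
  obtain ⟨hU1, hU2⟩ := hξ.lower_form J I (fun s t => A t s) hf hf2 hf0 hf hf2 hf0
  have hdec : ∀ ω, ∑ t ∈ I, ∑ s ∈ J, A t s * (f (ξ t ω) * f (ξ s ω)) = L ω + U ω + D ω := by
    intro ω
    have h1 : L ω = ∑ t ∈ I, ∑ s ∈ J, if s < t then A t s * (f (ξ t ω) * f (ξ s ω)) else 0 := by
      simp only [hL, Finset.mul_sum, Finset.sum_filter]
      refine Finset.sum_congr rfl fun t _ => Finset.sum_congr rfl fun s _ => ?_
      split_ifs <;> ring
    have h2 : U ω = ∑ t ∈ I, ∑ s ∈ J, if t < s then A t s * (f (ξ t ω) * f (ξ s ω)) else 0 := by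
      rw [Finset.sum_comm]
      simp only [hU, Finset.mul_sum, Finset.sum_filter]
      refine Finset.sum_congr rfl fun t _ => Finset.sum_congr rfl fun s _ => ?_
      split_ifs <;> ring
    have h3 : D ω = ∑ t ∈ I, ∑ s ∈ J, if t = s then A t s * (f (ξ t ω) * f (ξ s ω)) else 0 := by
      simp only [hD, Finset.sum_filter, Finset.sum_ite_eq]
      refine Finset.sum_congr rfl fun t _ => ?_
      split_ifs <;> ring
    rw [h1, h2, h3, ← Finset.sum_add_distrib, ← Finset.sum_add_distrib]
    refine Finset.sum_congr rfl fun t _ => ?_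
    rw [← Finset.sum_add_distrib, ← Finset.sum_add_distrib]
    refine Finset.sum_congr rfl fun s _ => ?_
    rcases lt_trichotomy s t with h | h | h
    · simp [h, h.not_gt, h.ne']
    · simp [h]
    · simp [h, h.not_gt, h.ne]
  have hfi : ∀ t, Integrable (fun ω => f (ξ t ω) ^ 2) P := fun t =>
    (hξ.memLp_comp hf hf2 t).integrable_sq
  have hDi : Integrable D P := integrable_finsetSum _ fun t _ => (hfi t).const_mul _
  have hLi : Integrable L P := hL1.integrable (by norm_num)
  have hUi : Integrable U P := hU1.integrable (by norm_num)
  have hDb : ∫ ω, |D ω| ∂P ≤ V * ∑ t ∈ I with t ∈ J, |A t t| := by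
    calc ∫ ω, |D ω| ∂P ≤ ∫ ω, ∑ t ∈ I with t ∈ J, |A t t| * f (ξ t ω) ^ 2 ∂P := by
          refine integral_mono hDi.abs (integrable_finsetSum _ fun t _ => (hfi t).const_mul _)
            fun ω => (Finset.abs_sum_le_sum_abs _ _).trans (le_of_eq ?_)
          simp [abs_mul]
      _ = V * ∑ t ∈ I with t ∈ J, |A t t| := by
          rw [integral_finsetSum _ fun t _ => (hfi t).const_mul _, Finset.mul_sum]
          refine Finset.sum_congr rfl fun t _ => ?_
          rw [integral_const_mul, hξ.integral_comp (hf.pow_const 2), mul_comm]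
  have hsq : ∀ {x S : ℝ}, x ≤ S → √(V * V * x) ≤ V * √S := by
    intro x S h
    rw [Real.sqrt_mul (mul_nonneg hV0 hV0), Real.sqrt_mul_self hV0]
    exact mul_le_mul_of_nonneg_left (Real.sqrt_le_sqrt h) hV0
  have hLb : ∫ ω, |L ω| ∂P ≤ V * √(∑ t ∈ I, ∑ s ∈ J, A t s ^ 2) := by
    refine (integral_abs_le_sqrt hL1).trans ?_
    rw [hL2]
    refine hsq (Finset.sum_le_sum fun t _ => Finset.sum_le_sum_of_subset_of_nonneg
      (Finset.filter_subset _ _) fun _ _ _ => sq_nonneg _)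
  have hUb : ∫ ω, |U ω| ∂P ≤ V * √(∑ t ∈ I, ∑ s ∈ J, A t s ^ 2) := by
    refine (integral_abs_le_sqrt hU1).trans ?_
    rw [hU2]
    refine hsq ?_
    rw [Finset.sum_comm (s := I)]
    exact (Finset.sum_le_sum fun t _ => Finset.sum_le_sum_of_subset_of_nonneg
      (Finset.filter_subset _ _) fun _ _ _ => sq_nonneg _)
  calc ∫ ω, |∑ t ∈ I, ∑ s ∈ J, A t s * (f (ξ t ω) * f (ξ s ω))| ∂P
      ≤ ∫ ω, (|L ω| + |U ω|) + |D ω| ∂P := by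
        simp_rw [hdec]
        exact integral_mono ((hLi.add hUi).add hDi).abs ((hLi.abs.add hUi.abs).add hDi.abs)
          fun ω => (abs_add_le _ _).trans (add_le_add_left (abs_add_le _ _) _)
    _ = ∫ ω, |L ω| ∂P + ∫ ω, |U ω| ∂P + ∫ ω, |D ω| ∂P := by
        exact integral_add_add hLi.abs hUi.abs hDi.abs
    _ ≤ _ := by linarith

/-- The variance of a sum of bounded, `m`-dependent variables. -/
lemma IsIID.integral_sq_sum_le_of_dependent (hξ : IsIID P ξ) (s : Finset ℤ) (m : ℕ)
    (G : ℤ → Ω → ℝ)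
    (hG : ∀ t, Measurable[sigmaOn ξ (Icc (t - m) t)] (G t)) {B : ℝ} (hB : ∀ t ω, |G t ω| ≤ B)
    (hG0 : ∀ t, ∫ ω, G t ω ∂P = 0) :
    ∫ ω, (∑ t ∈ s, G t ω) ^ 2 ∂P ≤ s.card * ((2 * m + 1) * B ^ 2) := by
  have hGm : ∀ t, Measurable (G t) := fun t => (hG t).mono (hξ.sigmaOn_le _) le_rfl
  have hG2 : ∀ t, MemLp (G t) 2 P := fun t =>
    MemLp.of_bound (hGm t).aestronglyMeasurable B (ae_of_all _ fun ω => hB t ω)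
  have hint : ∀ t t', Integrable (fun ω => G t ω * G t' ω) P := fun t t' =>
    (hG2 t).integrable_mul (hG2 t')
  have hle : ∀ t t', ∫ ω, G t ω * G t' ω ∂P ≤
      if t' ∈ Finset.Icc (t - m) (t + m) then B ^ 2 else 0 := by
    intro t t'
    split_ifs with h
    · calc ∫ ω, G t ω * G t' ω ∂P ≤ ∫ _, B ^ 2 ∂P := by
            refine integral_mono (hint t t') (integrable_const _) fun ω => ?_
            calc G t ω * G t' ω ≤ |G t ω| * |G t' ω| := by
                  rw [← abs_mul]; exact le_abs_self _
              _ ≤ B * B := mul_le_mul (hB t ω) (hB t' ω) (abs_nonneg _)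
                  ((abs_nonneg _).trans (hB t ω))
              _ = B ^ 2 := by ring
        _ = B ^ 2 := by simp
    · have hd : Disjoint (Icc (t - m) t) (Icc (t' - m) t') := by
        rw [Set.disjoint_left]
        intro z hz hz'
        simp only [Finset.mem_Icc, Set.mem_Icc] at h hz hz'
        omega
      rw [(hξ.indepFun_of_disjoint hd (hG t) (hG t')).integral_fun_mul_eq_mul_integral
        (hG2 t).aestronglyMeasurable (hG2 t').aestronglyMeasurable, hG0, zero_mul]
  have hsum : ∀ ω, (∑ t ∈ s, G t ω) ^ 2 = ∑ t ∈ s, ∑ t' ∈ s, G t ω * G t' ω := fun ω => by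
    rw [sq, Finset.sum_mul_sum]
  simp_rw [hsum]
  rw [integral_finsetSum _ fun t _ => integrable_finsetSum _ fun t' _ => hint t t']
  calc ∑ t ∈ s, ∫ ω, ∑ t' ∈ s, G t ω * G t' ω ∂P
      ≤ ∑ t ∈ s, (2 * m + 1) * B ^ 2 := by
        refine Finset.sum_le_sum fun t _ => ?_
        rw [integral_finsetSum _ fun t' _ => hint t t']
        calc ∑ t' ∈ s, ∫ ω, G t ω * G t' ω ∂P
            ≤ ∑ t' ∈ s, if t' ∈ Finset.Icc (t - m) (t + m) then B ^ 2 else 0 :=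
              Finset.sum_le_sum fun t' _ => hle t t'
          _ = ∑ t' ∈ s with t' ∈ Finset.Icc (t - m) (t + m), B ^ 2 := by
              rw [Finset.sum_filter]
          _ ≤ ∑ t' ∈ Finset.Icc (t - m) (t + m), B ^ 2 := by
              refine Finset.sum_le_sum_of_subset_of_nonneg (fun z hz => (Finset.mem_filter.1 hz).2)
                fun _ _ _ => sq_nonneg _
          _ = (2 * m + 1) * B ^ 2 := by
              rw [Finset.sum_const, Int.card_Icc, nsmul_eq_mul]
              congr 1
              have : (t + m + 1 - (t - m)).toNat = 2 * m + 1 := by omega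
              rw [this]; push_cast; ring
    _ = _ := by rw [Finset.sum_const, nsmul_eq_mul]

end

/-! ### A central limit theorem for bounded martingale differences -/

/-- Telescoping comparison of products of numbers in the unit disc. -/
lemma norm_prod_sub_prod_le_sum {ι : Type*} [DecidableEq ι] (s : Finset ι) (a b : ι → ℂ)
    (ha : ∀ i ∈ s, ‖a i‖ ≤ 1) (hb : ∀ i ∈ s, ‖b i‖ ≤ 1) :
    ‖∏ i ∈ s, a i - ∏ i ∈ s, b i‖ ≤ ∑ i ∈ s, ‖a i - b i‖ := by
  induction s using Finset.induction_on with
  | empty => simp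
  | insert j s hj ih =>
    rw [Finset.prod_insert hj, Finset.prod_insert hj, Finset.sum_insert hj]
    have hB : ‖∏ i ∈ s, b i‖ ≤ 1 := by
      rw [norm_prod]
      exact Finset.prod_le_one (fun _ _ => norm_nonneg _)
        fun i hi => hb i (Finset.mem_insert_of_mem hi)
    have ih' := ih (fun i hi => ha i (Finset.mem_insert_of_mem hi))
      (fun i hi => hb i (Finset.mem_insert_of_mem hi))
    calc ‖a j * ∏ i ∈ s, a i - b j * ∏ i ∈ s, b i‖
        = ‖a j * (∏ i ∈ s, a i - ∏ i ∈ s, b i) + (a j - b j) * ∏ i ∈ s, b i‖ := by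
          congr 1; ring
      _ ≤ ‖a j‖ * ‖∏ i ∈ s, a i - ∏ i ∈ s, b i‖ + ‖a j - b j‖ * ‖∏ i ∈ s, b i‖ := by
          rw [← norm_mul, ← norm_mul]; exact norm_add_le _ _
      _ ≤ 1 * ‖∏ i ∈ s, a i - ∏ i ∈ s, b i‖ + ‖a j - b j‖ * 1 := by
          gcongr
          exact ha j (Finset.mem_insert_self _ _)
      _ ≤ _ := by linarith

lemma norm_one_add_mul_I_le (x : ℝ) : ‖(1 + x * Complex.I : ℂ)‖ ≤ Real.exp (x ^ 2 / 2) := by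
  have h1 : ‖(1 + x * Complex.I : ℂ)‖ ^ 2 = 1 + x ^ 2 := by
    rw [← Complex.normSq_eq_norm_sq, Complex.normSq_apply]
    simp; ring
  have h2 : (Real.exp (x ^ 2 / 2)) ^ 2 = Real.exp (x ^ 2) := by
    rw [← Real.exp_nat_mul]; congr 1; push_cast; ring
  refine (sq_le_sq₀ (norm_nonneg _) (Real.exp_pos _).le).1 ?_
  rw [h1, h2]
  linarith [Real.add_one_le_exp (x ^ 2)]

/-- `e^{ix}` agrees with `(1 + ix) e^{-x²/2}` to second order. -/
lemma norm_cexp_sub_one_add_mul_exp_le {x : ℝ} (hx : |x| ≤ 1) :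
    ‖Complex.exp (x * Complex.I) - (1 + x * Complex.I) * (Real.exp (-(x ^ 2 / 2)) : ℝ)‖
      ≤ 2 * |x| ^ 3 := by
  have hn : ‖(x * Complex.I : ℂ)‖ = |x| := by simp
  have h1 := Complex.exp_bound (x := x * Complex.I) (by rw [hn]; exact hx) (n := 3) (by norm_num)
  rw [hn] at h1
  have h2 : |Real.exp (-(x ^ 2 / 2)) - 1 - -(x ^ 2 / 2)| ≤ (-(x ^ 2 / 2)) ^ 2 := by
    refine Real.abs_exp_sub_one_sub_id_le ?_
    rw [abs_neg, abs_of_nonneg (by positivity), ← sq_abs]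
    nlinarith [abs_nonneg x]
  set ρ : ℝ := Real.exp (-(x ^ 2 / 2)) - 1 - -(x ^ 2 / 2) with hρ
  have hE : Real.exp (-(x ^ 2 / 2)) = 1 - x ^ 2 / 2 + ρ := by rw [hρ]; ring
  have hI : (x * Complex.I : ℂ) ^ 2 = -(x : ℂ) ^ 2 := by rw [mul_pow, Complex.I_sq]; ring
  have hsum : ∑ m ∈ Finset.range 3, (x * Complex.I : ℂ) ^ m / (m.factorial : ℂ)
      = 1 + x * Complex.I - (x : ℂ) ^ 2 / 2 := by
    simp [Finset.sum_range_succ, hI, Nat.factorial]; ring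
  rw [hsum] at h1
  rw [hE]
  have hdec : Complex.exp (x * Complex.I) - (1 + x * Complex.I) * ((1 - x ^ 2 / 2 + ρ : ℝ) : ℂ)
      = (Complex.exp (x * Complex.I) - (1 + x * Complex.I - (x : ℂ) ^ 2 / 2))
        + ((x : ℂ) ^ 3 / 2 * Complex.I - (1 + x * Complex.I) * ρ) := by
    push_cast; ring
  rw [hdec]
  have h3 : ‖(x : ℂ) ^ 3 / 2 * Complex.I‖ = |x| ^ 3 / 2 := by simp
  have h4 : ‖(1 + x * Complex.I) * (ρ : ℂ)‖ ≤ 2 * (|x| ^ 4 / 4) := by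
    rw [norm_mul]
    have : ‖(1 + x * Complex.I : ℂ)‖ ≤ 2 := by
      refine (norm_add_le _ _).trans ?_
      rw [hn, norm_one]; linarith
    have h5 : ‖(ρ : ℂ)‖ ≤ |x| ^ 4 / 4 := by
      rw [Complex.norm_real, Real.norm_eq_abs]
      refine h2.trans (le_of_eq ?_)
      rw [show |x| ^ 4 = (|x| ^ 2) ^ 2 by ring, sq_abs]; ring
    exact mul_le_mul this h5 (norm_nonneg _) (by norm_num)
  have h6 : |x| ^ 4 ≤ |x| ^ 3 := pow_le_pow_of_le_one (abs_nonneg _) hx (by norm_num)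
  have h7 : 0 ≤ |x| ^ 3 := by positivity
  calc _ ≤ ‖Complex.exp (x * Complex.I) - (1 + x * Complex.I - (x : ℂ) ^ 2 / 2)‖
        + (‖(x : ℂ) ^ 3 / 2 * Complex.I‖ + ‖(1 + x * Complex.I) * (ρ : ℂ)‖) :=
        (norm_add_le _ _).trans (add_le_add_right (norm_sub_le _ _) _)
    _ ≤ 2 * |x| ^ 3 := by
        rw [h3]
        norm_num [Nat.factorial] at h1
        linarith

/-- Comparison of the Fourier exponential of a sum of small terms with the product `∏ (1 + i d_t)`
damped by the Gaussian factor of the sum of squares. -/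
lemma norm_cexp_sum_sub_prod_le (s : Finset ℤ) (d : ℤ → ℝ) (hd : ∀ t ∈ s, |d t| ≤ 1) :
    ‖Complex.exp ((∑ t ∈ s, d t : ℝ) * Complex.I)
      - (∏ t ∈ s, (1 + d t * Complex.I)) * (Real.exp (-((∑ t ∈ s, d t ^ 2) / 2)) : ℝ)‖
      ≤ ∑ t ∈ s, 2 * |d t| ^ 3 := by
  have h1 : Complex.exp ((∑ t ∈ s, d t : ℝ) * Complex.I)
      = ∏ t ∈ s, Complex.exp (d t * Complex.I) := by
    rw [← Complex.exp_sum, Complex.ofReal_sum, Finset.sum_mul]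
  have h2 : ((Real.exp (-((∑ t ∈ s, d t ^ 2) / 2)) : ℝ) : ℂ)
      = ∏ t ∈ s, ((Real.exp (-(d t ^ 2 / 2)) : ℝ) : ℂ) := by
    rw [← Complex.ofReal_prod, ← Real.exp_sum, Finset.sum_neg_distrib, Finset.sum_div]
  rw [h1, h2, ← Finset.prod_mul_distrib]
  refine (norm_prod_sub_prod_le_sum s _ _ (fun t _ => ?_) (fun t _ => ?_)).trans
    (Finset.sum_le_sum fun t ht => norm_cexp_sub_one_add_mul_exp_le (hd t ht))
  · exact (Complex.norm_exp_ofReal_mul_I _).le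
  · rw [norm_mul, Complex.norm_real, Real.norm_of_nonneg (Real.exp_pos _).le, Real.exp_neg]
    exact mul_inv_le_one_of_le₀ (norm_one_add_mul_I_le _) (Real.exp_pos _).le

lemma abs_exp_neg_half_sub_le {x y : ℝ} (hx : 0 ≤ x) (hy : 0 ≤ y) :
    |Real.exp (-(x / 2)) - Real.exp (-(y / 2))| ≤ |x - y| / 2 := by
  wlog h : x ≤ y generalizing x y
  · rw [abs_sub_comm, abs_sub_comm x y]
    exact this hy hx (le_of_not_ge h)
  have h1 : Real.exp (-(y / 2)) ≤ Real.exp (-(x / 2)) := Real.exp_le_exp.2 (by linarith)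
  rw [abs_of_nonneg (by linarith), abs_sub_comm, abs_of_nonneg (by linarith)]
  have h2 : Real.exp (-(y / 2)) = Real.exp (-(x / 2)) * Real.exp (-((y - x) / 2)) := by
    rw [← Real.exp_add]; congr 1; ring
  have h3 := Real.add_one_le_exp (-((y - x) / 2))
  have h4 : Real.exp (-(x / 2)) ≤ 1 := Real.exp_le_one_iff.2 (by linarith)
  have h5 := Real.exp_pos (-(x / 2))
  rw [h2]
  nlinarith

section
variable {Ω : Type*} [mΩ : MeasurableSpace Ω] {P : Measure Ω} [IsProbabilityMeasure P]
  {ξ : ℤ → Ω → ℝ}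

lemma norm_prod_one_add_mul_I_le (s : Finset ℤ) (d : ℤ → ℝ) {c : ℝ} (hd : ∀ t, |d t| ≤ c) :
    ‖∏ t ∈ s, (1 + d t * Complex.I : ℂ)‖ ≤ Real.exp (s.card * (c ^ 2 / 2)) := by
  rw [norm_prod, Real.exp_nat_mul]
  refine (Finset.prod_le_prod (g := fun _ => Real.exp (c ^ 2 / 2)) (fun _ _ => norm_nonneg _)
    fun t _ => ?_).trans_eq (by rw [Finset.prod_const])
  refine (norm_one_add_mul_I_le _).trans (Real.exp_le_exp.2 ?_)
  have := sq_le_sq' ((abs_le.1 (hd t)).1) ((abs_le.1 (hd t)).2)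
  linarith

/-- For bounded martingale differences `d_t = x_t H_t`, the product `∏ (1 + i d_t)` is a
martingale, hence has mean one. -/
lemma IsIID.integral_prod_one_add_mul_I (hξ : IsIID P ξ) (s : Finset ℤ) (x H : ℤ → Ω → ℝ)
    (hx : ∀ t, Measurable[sigmaOn ξ {t}] (x t)) (hH : ∀ t, Measurable[sigmaOn ξ (Iio t)] (H t))
    (hx0 : ∀ t, ∫ ω, x t ω ∂P = 0) {c : ℝ} (hc : ∀ t ω, |x t ω * H t ω| ≤ c) :
    ∫ ω, ∏ t ∈ s, (1 + ((x t ω * H t ω : ℝ) : ℂ) * Complex.I) ∂P = 1 := by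
  have hxm : ∀ t, Measurable (x t) := fun t => (hx t).mono (hξ.sigmaOn_le _) le_rfl
  have hHm : ∀ t, Measurable (H t) := fun t => (hH t).mono (hξ.sigmaOn_le _) le_rfl
  have hTm : ∀ s : Finset ℤ,
      Measurable (fun ω => ∏ t ∈ s, (1 + ((x t ω * H t ω : ℝ) : ℂ) * Complex.I)) := fun s => by
    fun_prop
  have hTi : ∀ s : Finset ℤ,
      Integrable (fun ω => ∏ t ∈ s, (1 + ((x t ω * H t ω : ℝ) : ℂ) * Complex.I)) P := fun s =>
    Integrable.of_bound (hTm s).aestronglyMeasurable _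
      (ae_of_all _ fun ω => norm_prod_one_add_mul_I_le s _ fun t => hc t ω)
  induction s using Finset.induction_on_max with
  | empty => simp
  | insert a s has ih =>
    have hna : a ∉ s := fun h => lt_irrefl _ (has a h)
    set T : Ω → ℂ := fun ω => ∏ t ∈ s, (1 + ((x t ω * H t ω : ℝ) : ℂ) * Complex.I) with hT
    have hTs : Measurable[sigmaOn ξ (Iio a)] T := by
      refine Finset.measurable_fun_prod s fun t ht => ?_
      have h1 : Measurable[sigmaOn ξ (Iio a)] fun ω => x t ω * H t ω :=
        ((hx t).mono (sigmaOn_mono (by simpa using has t ht)) le_rfl).mul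
          ((hH t).mono (sigmaOn_mono (Iio_subset_Iio (has t ht).le)) le_rfl)
      exact ((Complex.measurable_ofReal.comp h1).mul_const _).const_add _
    have hHs : Measurable[sigmaOn ξ (Iio a)] fun ω => (H a ω : ℂ) * Complex.I * T ω :=
      ((Complex.measurable_ofReal.comp (hH a)).mul_const _).mul hTs
    have hi : IndepFun (fun ω => (x a ω : ℂ)) (fun ω => (H a ω : ℂ) * Complex.I * T ω) P :=
      hξ.indepFun_of_disjoint (S := {a}) (S' := Iio a) (by simp)
        (Complex.measurable_ofReal.comp (hx a)) hHs
    have hcross : ∫ ω, (x a ω : ℂ) * ((H a ω : ℂ) * Complex.I * T ω) ∂P = 0 := by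
      rw [hi.integral_fun_mul_eq_mul_integral
        (Complex.measurable_ofReal.comp (hxm a)).aestronglyMeasurable
        (hHs.mono (hξ.sigmaOn_le _) le_rfl).aestronglyMeasurable, integral_complex_ofReal, hx0]
      simp
    have hins : ∀ ω, ∏ t ∈ insert a s, (1 + ((x t ω * H t ω : ℝ) : ℂ) * Complex.I)
        = T ω + (x a ω : ℂ) * ((H a ω : ℂ) * Complex.I * T ω) := fun ω => by
      rw [Finset.prod_insert hna, hT]; push_cast; ring
    have hci : Integrable (fun ω => (x a ω : ℂ) * ((H a ω : ℂ) * Complex.I * T ω)) P := by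
      refine ((hTi (insert a s)).sub (hTi s)).congr (ae_of_all _ fun ω => ?_)
      simp only [Pi.sub_apply, hins]; ring
    simp_rw [hins]
    rw [integral_add (hTi s) hci, hcross, ih, add_zero]

/-- A quantitative central limit theorem for bounded martingale differences: the distance of the
characteristic function at `1` to that of a centred Gaussian variable of variance `v`. -/
theorem IsIID.norm_integral_cexp_sub_le (hξ : IsIID P ξ) (s : Finset ℤ) (x H : ℤ → Ω → ℝ)
    (hx : ∀ t, Measurable[sigmaOn ξ {t}] (x t)) (hH : ∀ t, Measurable[sigmaOn ξ (Iio t)] (H t))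
    (hx0 : ∀ t, ∫ ω, x t ω ∂P = 0) {c : ℝ} (hc1 : c ≤ 1) (hc : ∀ t ω, |x t ω * H t ω| ≤ c)
    {v : ℝ} (hv : 0 ≤ v) :
    ‖∫ ω, Complex.exp ((∑ t ∈ s, x t ω * H t ω : ℝ) * Complex.I) ∂P - (Real.exp (-(v / 2)) : ℝ)‖
      ≤ s.card * (2 * c ^ 3) + Real.exp (s.card * (c ^ 2 / 2)) *
          ((∫ ω, |∑ t ∈ s, (x t ω * H t ω) ^ 2 - v| ∂P) / 2) := by
  have hxm : ∀ t, Measurable (x t) := fun t => (hx t).mono (hξ.sigmaOn_le _) le_rfl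
  have hHm : ∀ t, Measurable (H t) := fun t => (hH t).mono (hξ.sigmaOn_le _) le_rfl
  set T : Ω → ℂ := fun ω => ∏ t ∈ s, (1 + ((x t ω * H t ω : ℝ) : ℂ) * Complex.I) with hT
  set E : Ω → ℂ := fun ω => Complex.exp ((∑ t ∈ s, x t ω * H t ω : ℝ) * Complex.I) with hE
  set Q : Ω → ℝ := fun ω => ∑ t ∈ s, (x t ω * H t ω) ^ 2 with hQ
  set R := Real.exp (s.card * (c ^ 2 / 2)) with hR
  have hTm : Measurable T := by fun_prop
  have hEm : Measurable E := by fun_prop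
  have hQm : Measurable Q := by fun_prop
  have hTb : ∀ ω, ‖T ω‖ ≤ R := fun ω => norm_prod_one_add_mul_I_le s _ fun t => hc t ω
  have hTi : Integrable T P := Integrable.of_bound hTm.aestronglyMeasurable R (ae_of_all _ hTb)
  have hEi : Integrable E P := Integrable.of_bound hEm.aestronglyMeasurable 1
    (ae_of_all _ fun ω => (Complex.norm_exp_ofReal_mul_I _).le)
  have hQi : Integrable (fun ω => |Q ω - v|) P := by
    refine (Integrable.sub ?_ (integrable_const v)).abs
    refine Integrable.of_bound hQm.aestronglyMeasurable (s.card * c ^ 2) (ae_of_all _ fun ω => ?_)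
    rw [Real.norm_of_nonneg (Finset.sum_nonneg fun _ _ => sq_nonneg _), ← nsmul_eq_mul]
    refine Finset.sum_le_card_nsmul _ _ _ fun t _ => ?_
    exact sq_le_sq' ((abs_le.1 (hc t ω)).1) ((abs_le.1 (hc t ω)).2)
  have hT1 : ∫ ω, T ω ∂P = 1 := hξ.integral_prod_one_add_mul_I s x H hx hH hx0 hc
  have hpt : ∀ ω, ‖E ω - T ω * (Real.exp (-(v / 2)) : ℝ)‖
      ≤ s.card * (2 * c ^ 3) + R * (|Q ω - v| / 2) := by
    intro ω
    have h1 := norm_cexp_sum_sub_prod_le s (fun t => x t ω * H t ω)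
      fun t _ => (hc t ω).trans hc1
    have h2 : ∑ t ∈ s, 2 * |x t ω * H t ω| ^ 3 ≤ s.card * (2 * c ^ 3) := by
      rw [← nsmul_eq_mul]
      refine Finset.sum_le_card_nsmul _ _ _ fun t _ => ?_
      have := pow_le_pow_left₀ (abs_nonneg _) (hc t ω) 3
      linarith
    have h3 : ‖T ω * (Real.exp (-(Q ω / 2)) : ℝ) - T ω * (Real.exp (-(v / 2)) : ℝ)‖
        ≤ R * (|Q ω - v| / 2) := by
      rw [← mul_sub, norm_mul, ← Complex.ofReal_sub, Complex.norm_real, Real.norm_eq_abs]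
      exact mul_le_mul (hTb ω) (abs_exp_neg_half_sub_le
        (Finset.sum_nonneg fun _ _ => sq_nonneg _) hv) (abs_nonneg _) (Real.exp_pos _).le
    calc _ = ‖(E ω - T ω * (Real.exp (-(Q ω / 2)) : ℝ))
          + (T ω * (Real.exp (-(Q ω / 2)) : ℝ) - T ω * (Real.exp (-(v / 2)) : ℝ))‖ := by
          congr 1; ring
      _ ≤ _ := (norm_add_le _ _).trans (add_le_add (h1.trans h2) h3)
  have hdiff : ∫ ω, E ω ∂P - (Real.exp (-(v / 2)) : ℝ)
      = ∫ ω, E ω - T ω * (Real.exp (-(v / 2)) : ℝ) ∂P := by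
    rw [integral_sub hEi (hTi.mul_const _), integral_mul_const, hT1, one_mul]
  rw [hdiff]
  calc _ ≤ ∫ ω, ‖E ω - T ω * (Real.exp (-(v / 2)) : ℝ)‖ ∂P := norm_integral_le_integral_norm _
    _ ≤ ∫ ω, s.card * (2 * c ^ 3) + R * (|Q ω - v| / 2) ∂P :=
        integral_mono (hEi.sub (hTi.mul_const _)).norm
          ((integrable_const _).add ((hQi.div_const 2).const_mul R)) hpt
    _ = _ := by
        rw [integral_add (integrable_const _) ((hQi.div_const 2).const_mul R),
          integral_const_mul R, integral_div, integral_const]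
        simp [hQ]

end

/-! ### Riemann sums, truncation, and a weighted law of large numbers -/

lemma sum_Icc_one_eq_sum_range (T : ℕ) (g : ℤ → ℝ) :
    ∑ t ∈ Finset.Icc (1 : ℤ) T, g t = ∑ i ∈ Finset.range T, g (i + 1) := by
  symm
  refine Finset.sum_bij (fun i _ => (i : ℤ) + 1) ?_ ?_ ?_ (fun _ _ => rfl)
  · intro i hi; simp only [Finset.mem_range, Finset.mem_Icc] at hi ⊢; omega
  · intro i _ j _ h; simpa using h
  · intro t ht
    simp only [Finset.mem_Icc] at ht
    exact ⟨(t - 1).toNat, by simp only [Finset.mem_range]; omega, by omega⟩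

lemma abs_riemann_sum_sub_integral_le {φ : ℝ → ℝ} {L : ℝ}
    (hφ : ∀ x y, |φ x - φ y| ≤ L * |x - y|) (hcont : Continuous φ) {T : ℕ} (hT : 0 < T) :
    |(T : ℝ)⁻¹ * ∑ t ∈ Finset.Icc (1 : ℤ) T, φ (t / T) - ∫ x in (0 : ℝ)..1, φ x| ≤ L / T := by
  have hT' : (0 : ℝ) < T := by exact_mod_cast hT
  have hint : ∑ i ∈ Finset.range T, ∫ x in ((i : ℕ) / T : ℝ)..((i + 1 : ℕ) / T : ℝ), φ x
      = ∫ x in (0 : ℝ)..1, φ x := by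
    have := intervalIntegral.sum_integral_adjacent_intervals (f := φ) (μ := volume)
      (a := fun i : ℕ => (i / T : ℝ)) (n := T) fun i _ => hcont.intervalIntegrable _ _
    rw [this]; simp [hT'.ne']
  rw [sum_Icc_one_eq_sum_range, ← hint, Finset.mul_sum, ← Finset.sum_sub_distrib]
  have hterm : ∀ i ∈ Finset.range T, |(T : ℝ)⁻¹ * φ (((i : ℤ) + 1 : ℤ) / T)
      - ∫ x in ((i : ℕ) / T : ℝ)..((i + 1 : ℕ) / T : ℝ), φ x| ≤ L / T * (1 / T) := by
    intro i _
    have hlen : ((i + 1 : ℕ) / T : ℝ) - (i : ℕ) / T = 1 / T := by push_cast; ring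
    have hc : (T : ℝ)⁻¹ * φ (((i : ℤ) + 1 : ℤ) / T)
        = ∫ _ in ((i : ℕ) / T : ℝ)..((i + 1 : ℕ) / T : ℝ), φ (((i : ℤ) + 1 : ℤ) / T) := by
      rw [intervalIntegral.integral_const, hlen, smul_eq_mul, one_div]
    rw [hc, ← intervalIntegral.integral_sub (by simp) (hcont.intervalIntegrable _ _),
      ← Real.norm_eq_abs]
    have hL : 0 ≤ L := by
      have := (abs_nonneg _).trans (hφ 0 1); simpa using this
    have h := intervalIntegral.norm_integral_le_of_norm_le_const (a := ((i : ℕ) / T : ℝ))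
      (b := ((i + 1 : ℕ) / T : ℝ)) (C := L / T)
      (f := fun x => φ (((i : ℤ) + 1 : ℤ) / T) - φ x) (fun x hx => ?_)
    · rw [hlen, abs_of_pos (by positivity)] at h; exact h
    · have hle : ((i : ℕ) / T : ℝ) ≤ (i + 1 : ℕ) / T := by
        rw [← sub_nonneg, hlen]; positivity
      rw [uIoc_of_le hle] at hx
      rw [Real.norm_eq_abs]
      refine (hφ _ _).trans ?_
      rw [div_eq_mul_one_div L]
      refine mul_le_mul_of_nonneg_left ?_ hL
      have h1 := hx.1
      have h2 := hx.2
      push_cast at h2 hlen ⊢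
      rw [abs_of_nonneg (by linarith)]
      linarith
  refine (Finset.abs_sum_le_sum_abs _ _).trans ((Finset.sum_le_sum hterm).trans (le_of_eq ?_))
  rw [Finset.sum_const, Finset.card_range, nsmul_eq_mul]
  field_simp

/-- Riemann sums for a bounded Lipschitz function, with perturbed nodes and finitely many terms
left out. -/
lemma tendsto_riemann_sum {φ : ℝ → ℝ} {L B C : ℝ} (hφ : ∀ x y, |φ x - φ y| ≤ L * |x - y|)
    (hB : ∀ x, |φ x| ≤ B) (m : ℕ) (ψ : ℕ → ℤ → ℝ)
    (hψ : ∀ (T : ℕ) (t : ℤ), |ψ T t - φ (t / T)| ≤ C / T) :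
    Tendsto (fun T : ℕ => (T : ℝ)⁻¹ * ∑ t ∈ Finset.Icc ((m : ℤ) + 1) T, ψ T t) atTop
      (𝓝 (∫ x in (0 : ℝ)..1, φ x)) := by
  have hcont : Continuous φ := by
    refine (LipschitzWith.of_dist_le_mul (K := L.toNNReal) fun x y => ?_).continuous
    rw [Real.dist_eq, Real.dist_eq]
    exact (hφ x y).trans (mul_le_mul_of_nonneg_right (Real.le_coe_toNNReal L) (abs_nonneg _))
  rw [tendsto_iff_dist_tendsto_zero]
  have hlim : Tendsto (fun T : ℕ => (C + m * B + L) / (T : ℝ)) atTop (𝓝 0) :=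
    tendsto_const_div_atTop_nhds_zero_nat _
  refine squeeze_zero' (Eventually.of_forall fun _ => dist_nonneg) ?_ hlim
  filter_upwards [eventually_ge_atTop (m + 1)] with T hT
  have hT0 : 0 < T := by omega
  have hT' : (0 : ℝ) < T := by exact_mod_cast hT0
  have h1 := abs_riemann_sum_sub_integral_le hφ hcont hT0
  have hsplit : ∑ t ∈ Finset.Icc (1 : ℤ) T, φ (t / T) = ∑ t ∈ Finset.Icc (1 : ℤ) m, φ (t / T)
      + ∑ t ∈ Finset.Icc ((m : ℤ) + 1) T, φ (t / T) := by
    rw [← Finset.sum_union]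
    · congr 1; ext z; simp only [Finset.mem_Icc, Finset.mem_union]; omega
    · rw [Finset.disjoint_left]; intro z; simp only [Finset.mem_Icc]; omega
  have h2 : |∑ t ∈ Finset.Icc (1 : ℤ) m, φ (t / T)| ≤ m * B := by
    refine (Finset.abs_sum_le_sum_abs _ _).trans ((Finset.sum_le_card_nsmul _ _ B
      fun t _ => hB _).trans (le_of_eq ?_))
    simp
  have hC : 0 ≤ C / T := (abs_nonneg _).trans (hψ T 0)
  have h3 : |∑ t ∈ Finset.Icc ((m : ℤ) + 1) T, (ψ T t - φ (t / T))| ≤ T * (C / T) := by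
    refine (Finset.abs_sum_le_sum_abs _ _).trans ((Finset.sum_le_card_nsmul _ _ (C / T)
      fun t _ => hψ T t).trans ?_)
    rw [nsmul_eq_mul]
    refine mul_le_mul_of_nonneg_right ?_ hC
    rw [Int.card_Icc]
    exact_mod_cast (by omega : ((T : ℤ) + 1 - (m + 1)).toNat ≤ T)
  rw [Finset.sum_sub_distrib] at h3
  rw [Real.dist_eq]
  have hdec : (T : ℝ)⁻¹ * ∑ t ∈ Finset.Icc ((m : ℤ) + 1) T, ψ T t - ∫ x in (0 : ℝ)..1, φ x
      = (T : ℝ)⁻¹ * (∑ t ∈ Finset.Icc ((m : ℤ) + 1) T, ψ T t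
          - ∑ t ∈ Finset.Icc ((m : ℤ) + 1) T, φ (t / T))
        - (T : ℝ)⁻¹ * ∑ t ∈ Finset.Icc (1 : ℤ) m, φ (t / T)
        + ((T : ℝ)⁻¹ * ∑ t ∈ Finset.Icc (1 : ℤ) T, φ (t / T) - ∫ x in (0 : ℝ)..1, φ x) := by
    rw [hsplit]; ring
  rw [hdec]
  refine (abs_add_le _ _).trans ((add_le_add ((abs_sub _ _).trans (add_le_add
    ((abs_mul _ _).trans_le (mul_le_mul_of_nonneg_left h3 (abs_nonneg _)))
    ((abs_mul _ _).trans_le (mul_le_mul_of_nonneg_left h2 (abs_nonneg _))))) h1).trans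
    (le_of_eq ?_))
  rw [abs_of_pos (inv_pos.2 hT')]
  field_simp

/-- Interchange of limits: a sequence which is approximated, uniformly, by convergent sequences
converges to the limit of their limits. -/
lemma tendsto_of_uniform_approx {E : Type*} [PseudoMetricSpace E] {F : ℕ → E} {G : ℕ → ℕ → E}
    {l : ℕ → E} {a : E} {e : ℕ → ℝ} (hG : ∀ M, Tendsto (G M) atTop (𝓝 (l M)))
    (hFG : ∀ M T, dist (F T) (G M T) ≤ e M) (he : Tendsto e atTop (𝓝 0))
    (hl : Tendsto l atTop (𝓝 a)) : Tendsto F atTop (𝓝 a) := by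
  rw [Metric.tendsto_atTop']
  intro ε hε
  obtain ⟨M, hM1, hM2⟩ := ((he.eventually_lt_const (show (0 : ℝ) < ε / 3 by positivity)).and
    (Metric.tendsto_nhds.1 hl (ε / 3) (by positivity))).exists
  obtain ⟨N, hN⟩ := Metric.tendsto_atTop'.1 (hG M) (ε / 3) (by positivity)
  refine ⟨N, fun T hT => ?_⟩
  have h1 := hFG M T
  have h2 := hN T hT
  have h3 := dist_triangle4 (F T) (G M T) (l M) a
  linarith

/-- The truncation of `f` at level `M`: values larger than `M` in modulus are replaced by `0`. -/
noncomputable def truncateAt (f : ℝ → ℝ) (M : ℕ) (x : ℝ) : ℝ := if |f x| ≤ M then f x else 0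

lemma measurable_truncateAt {f : ℝ → ℝ} (hf : Measurable f) (M : ℕ) :
    Measurable (truncateAt f M) :=
  Measurable.ite (measurableSet_le (by fun_prop) measurable_const) hf measurable_const

lemma abs_truncateAt_le (f : ℝ → ℝ) (M : ℕ) (x : ℝ) : |truncateAt f M x| ≤ M := by
  unfold truncateAt; split_ifs with h <;> simp [h]

lemma abs_truncateAt_le_abs (f : ℝ → ℝ) (M : ℕ) (x : ℝ) : |truncateAt f M x| ≤ |f x| := by
  unfold truncateAt; split_ifs <;> simp

lemma abs_sub_truncateAt_le_abs (f : ℝ → ℝ) (M : ℕ) (x : ℝ) :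
    |f x - truncateAt f M x| ≤ |f x| := by
  unfold truncateAt; split_ifs <;> simp

lemma eventually_truncateAt_eq (f : ℝ → ℝ) (x : ℝ) : ∀ᶠ M in atTop, truncateAt f M x = f x := by
  filter_upwards [eventually_ge_atTop ⌈|f x|⌉₊] with M hM
  unfold truncateAt
  rw [if_pos ((Nat.le_ceil _).trans (by exact_mod_cast hM))]

section
variable {Ω : Type*} [mΩ : MeasurableSpace Ω] {P : Measure Ω} [IsProbabilityMeasure P]
  {ξ : ℤ → Ω → ℝ}

/-- Dominated convergence for functions `Φ` of the pair formed by `f` and its truncation. -/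
lemma tendsto_integral_truncateAt {f : ℝ → ℝ} (hf : Measurable f) {X : Ω → ℝ} (hX : Measurable X)
    {Φ : ℝ × ℝ → ℝ} (hΦ : Measurable Φ) {bound : Ω → ℝ} (hbound : Integrable bound P)
    (hle : ∀ M ω, |Φ (f (X ω), truncateAt f M (X ω))| ≤ bound ω) :
    Tendsto (fun M => ∫ ω, Φ (f (X ω), truncateAt f M (X ω)) ∂P) atTop
      (𝓝 (∫ ω, Φ (f (X ω), f (X ω)) ∂P)) := by
  refine tendsto_integral_of_dominated_convergence bound (fun M => ?_) hbound
    (fun M => ae_of_all _ fun ω => hle M ω) (ae_of_all _ fun ω => ?_)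
  · exact (hΦ.comp ((hf.comp hX).prodMk
      ((measurable_truncateAt hf M).comp hX))).aestronglyMeasurable
  · refine tendsto_const_nhds.congr' ?_
    filter_upwards [eventually_truncateAt_eq f (X ω)] with M hM
    rw [hM]

/-- The variance bound behind the weak law of large numbers, for bounded variables. -/
lemma IsIID.integral_abs_weighted_mean_le (hξ : IsIID P ξ) {F : ℝ → ℝ} (hF : Measurable F)
    {M : ℝ} (hM : ∀ x, |F x| ≤ M) {I : Finset ℤ} {T : ℕ} (hT : 0 < T) (hI : I.card ≤ T)
    {c : ℤ → ℝ} {B : ℝ} (hc : ∀ t, |c t| ≤ B) :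
    ∫ ω, |(T : ℝ)⁻¹ * ∑ t ∈ I, c t * (F (ξ t ω) - ∫ ω, F (ξ 0 ω) ∂P)| ∂P
      ≤ √((B * (2 * M)) ^ 2 * (T : ℝ)⁻¹) := by
  have hB : 0 ≤ B := (abs_nonneg _).trans (hc 0)
  set μ := ∫ ω, F (ξ 0 ω) ∂P with hμ
  have hμM : |μ| ≤ M := by
    have := norm_integral_le_of_norm_le_const (μ := P) (f := fun ω => F (ξ 0 ω))
      (ae_of_all P fun ω => hM (ξ 0 ω))
    simpa using this
  have hFi : ∀ t, Integrable (fun ω => F (ξ t ω)) P := fun t =>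
    Integrable.of_bound (hF.comp (hξ.measurable t)).aestronglyMeasurable M
      (ae_of_all _ fun ω => hM _)
  set G : ℤ → Ω → ℝ := fun t ω => c t * (F (ξ t ω) - μ) with hG
  have hGb : ∀ t ω, |G t ω| ≤ B * (2 * M) := fun t ω => by
    rw [hG, abs_mul]
    refine mul_le_mul (hc t) ((abs_sub _ _).trans ?_) (abs_nonneg _) hB
    linarith [hM (ξ t ω)]
  have hGm : ∀ t, Measurable (G t) := fun t =>
    ((hF.comp (hξ.measurable t)).sub_const _).const_mul _
  have hG2 : ∀ t, MemLp (G t) 2 P := fun t =>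
    MemLp.of_bound (hGm t).aestronglyMeasurable _ (ae_of_all _ fun ω => hGb t ω)
  have h1 := hξ.integral_sq_sum_le_of_dependent I 0 G
    (fun t => ((measurable_sigmaOn (by simp) hF).sub_const _).const_mul _) hGb
    (fun t => by
      rw [hG, integral_const_mul, integral_sub (hFi t) (integrable_const _),
        hξ.integral_comp hF]
      simp [hμ])
  have hmem : MemLp (fun ω => ∑ t ∈ I, G t ω) 2 P := memLp_finsetSum _ fun t _ => hG2 t
  refine (integral_abs_le_sqrt (hmem.const_mul (T : ℝ)⁻¹)).trans (Real.sqrt_le_sqrt ?_)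
  simp_rw [mul_pow (T : ℝ)⁻¹]
  rw [integral_const_mul]
  have hT' : (0 : ℝ) < T := by exact_mod_cast hT
  have hcard : (I.card : ℝ) ≤ T := by exact_mod_cast hI
  calc _ ≤ (T : ℝ)⁻¹ ^ 2 * (I.card * ((2 * (0 : ℕ) + 1) * (B * (2 * M)) ^ 2)) := by
        gcongr
    _ ≤ (T : ℝ)⁻¹ ^ 2 * (T * ((2 * (0 : ℕ) + 1) * (B * (2 * M)) ^ 2)) := by gcongr
    _ = _ := by push_cast; field_simp; ring

/-- A weighted weak law of large numbers in `L¹`. -/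
lemma IsIID.tendsto_integral_abs_weighted_mean (hξ : IsIID P ξ) {F : ℝ → ℝ} (hF : Measurable F)
    (hFi : Integrable (fun ω => F (ξ 0 ω)) P) (I : ℕ → Finset ℤ) (hI : ∀ T, (I T).card ≤ T)
    (c : ℕ → ℤ → ℝ) {B : ℝ} (hc : ∀ T t, |c T t| ≤ B) :
    Tendsto (fun T : ℕ => ∫ ω, |(T : ℝ)⁻¹ * ∑ t ∈ I T, c T t *
      (F (ξ t ω) - ∫ ω, F (ξ 0 ω) ∂P)| ∂P) atTop (𝓝 0) := by
  have hB : 0 ≤ B := (abs_nonneg _).trans (hc 0 0)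
  have hFt : ∀ t, Integrable (fun ω => F (ξ t ω)) P := fun t =>
    memLp_one_iff_integrable.1 (hξ.memLp_comp hF (memLp_one_iff_integrable.2 hFi) t)
  set Y : ℕ → ℤ → Ω → ℝ := fun M t ω =>
    truncateAt F M (ξ t ω) - ∫ ω, truncateAt F M (ξ 0 ω) ∂P with hY
  set r : ℕ → ℝ → ℝ := fun M x => F x - truncateAt F M x with hr
  have hrm : ∀ M, Measurable (r M) := fun M => hF.sub (measurable_truncateAt hF M)
  have hti : ∀ M t, Integrable (fun ω => truncateAt F M (ξ t ω)) P := fun M t =>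
    Integrable.of_bound ((measurable_truncateAt hF M).comp (hξ.measurable t)).aestronglyMeasurable M
      (ae_of_all _ fun ω => abs_truncateAt_le F M _)
  have hri : ∀ M t, Integrable (fun ω => r M (ξ t ω)) P := fun M t => (hFt t).sub (hti M t)
  have hmain : ∀ M, Tendsto (fun T : ℕ => ∫ ω, |(T : ℝ)⁻¹ * ∑ t ∈ I T, c T t * Y M t ω| ∂P)
      atTop (𝓝 0) := by
    intro M
    refine squeeze_zero' (Eventually.of_forall fun T => integral_nonneg fun _ => abs_nonneg _)
      ((eventually_gt_atTop 0).mono fun T hT => hξ.integral_abs_weighted_mean_le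
        (measurable_truncateAt hF M) (abs_truncateAt_le F M) hT (hI T) (hc T)) ?_
    have : Tendsto (fun T : ℕ => √((B * (2 * M)) ^ 2 * (T : ℝ)⁻¹)) atTop
        (𝓝 √((B * (2 * M)) ^ 2 * 0)) :=
      (Real.continuous_sqrt.tendsto _).comp (tendsto_inv_atTop_nhds_zero_nat.const_mul _)
    simpa using this
  refine tendsto_of_uniform_approx (l := fun _ => 0) (e := fun M => B * (2 * ∫ ω, |r M (ξ 0 ω)| ∂P))
    hmain (fun M T => ?_) ?_ tendsto_const_nhds
  · have hZi : ∀ t, Integrable (fun ω => F (ξ t ω) - ∫ ω, F (ξ 0 ω) ∂P) P := fun t =>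
      (hFt t).sub (integrable_const _)
    have hYi : ∀ t, Integrable (Y M t) P := fun t => (hti M t).sub (integrable_const _)
    have hi1 : Integrable (fun ω => (T : ℝ)⁻¹ * ∑ t ∈ I T, c T t *
        (F (ξ t ω) - ∫ ω, F (ξ 0 ω) ∂P)) P :=
      (integrable_finsetSum _ fun t _ => (hZi t).const_mul _).const_mul _
    have hi2 : Integrable (fun ω => (T : ℝ)⁻¹ * ∑ t ∈ I T, c T t * Y M t ω) P :=
      (integrable_finsetSum _ fun t _ => (hYi t).const_mul _).const_mul _
    have hdi : ∀ t, Integrable (fun ω => |r M (ξ t ω)| + ∫ ω, |r M (ξ 0 ω)| ∂P) P := fun t =>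
      (hri M t).abs.add (integrable_const _)
    have hpt : ∀ ω, |(|(T : ℝ)⁻¹ * ∑ t ∈ I T, c T t * (F (ξ t ω) - ∫ ω, F (ξ 0 ω) ∂P)|
        - |(T : ℝ)⁻¹ * ∑ t ∈ I T, c T t * Y M t ω|)| ≤ (T : ℝ)⁻¹ * ∑ t ∈ I T, B *
          (|r M (ξ t ω)| + ∫ ω, |r M (ξ 0 ω)| ∂P) := by
      intro ω
      refine (abs_abs_sub_abs_le_abs_sub _ _).trans ?_
      rw [← mul_sub, abs_mul, abs_of_nonneg (by positivity : (0 : ℝ) ≤ (T : ℝ)⁻¹),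
        ← Finset.sum_sub_distrib]
      refine mul_le_mul_of_nonneg_left ((Finset.abs_sum_le_sum_abs _ _).trans
        (Finset.sum_le_sum fun t _ => ?_)) (by positivity)
      rw [← mul_sub, abs_mul]
      refine mul_le_mul (hc T t) ?_ (abs_nonneg _) hB
      have heq : F (ξ t ω) - ∫ ω, F (ξ 0 ω) ∂P - Y M t ω
          = r M (ξ t ω) - ∫ ω, r M (ξ 0 ω) ∂P := by
        simp only [hY, hr]
        rw [integral_sub hFi (hti M 0)]; ring
      rw [heq]
      exact (abs_sub _ _).trans (add_le_add le_rfl abs_integral_le_integral_abs)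
    rw [Real.dist_eq, ← integral_sub hi1.abs hi2.abs]
    refine abs_integral_le_integral_abs.trans ?_
    refine (integral_mono (hi1.abs.sub hi2.abs).abs ((integrable_finsetSum _ fun t _ =>
      (hdi t).const_mul B).const_mul _) hpt).trans ?_
    rw [integral_const_mul, integral_finsetSum _ fun t _ => (hdi t).const_mul B]
    have hE : ∀ t ∈ I T, ∫ ω, B * (|r M (ξ t ω)| + ∫ ω, |r M (ξ 0 ω)| ∂P) ∂P
        = B * (2 * ∫ ω, |r M (ξ 0 ω)| ∂P) := by
      intro t _
      rw [integral_const_mul, integral_add (hri M t).abs (integrable_const _),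
        hξ.integral_comp (f := fun x => |r M x|) (hrm M).abs]
      simp; left; ring
    rw [Finset.sum_congr rfl hE, Finset.sum_const, nsmul_eq_mul, ← mul_assoc]
    have hnn : 0 ≤ ∫ ω, |r M (ξ 0 ω)| ∂P := integral_nonneg fun _ => abs_nonneg _
    have h1 : (T : ℝ)⁻¹ * ((I T).card : ℝ) ≤ 1 := by
      rw [inv_mul_eq_div]
      exact div_le_one_of_le₀ (by exact_mod_cast hI T) (by positivity)
    calc _ ≤ 1 * (B * (2 * ∫ ω, |r M (ξ 0 ω)| ∂P)) := by gcongr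
      _ = _ := one_mul _
  · have h := tendsto_integral_truncateAt hF (hξ.measurable 0) (Φ := fun z => |z.1 - z.2|)
      (by fun_prop) hFi.abs fun M ω => by
        rw [abs_abs]; exact abs_sub_truncateAt_le_abs F M _
    have := (h.const_mul 2).const_mul B
    simpa using this

end

/-! ### The quadratic variation of the sample cross-covariances -/

/-- The predictable factor `α(t/T) ∑_j u_j α((t-j)/T) g(ξ_{t-j})`, `j = 1, …, p`. -/
noncomputable def lagForm {Ω : Type*} {p : ℕ} (α : ℝ → ℝ) (u : Fin p → ℝ) (g : ℝ → ℝ)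
    (ξ : ℤ → Ω → ℝ) (T : ℕ) (t : ℤ) (ω : Ω) : ℝ :=
  α (t / T) * ∑ j : Fin p, (u j * α ((t - ((j : ℤ) + 1) : ℤ) / T)) * g (ξ (t - ((j : ℤ) + 1)) ω)

/-- The normalized weighted sample cross-covariance
`T^{-1/2} ∑_t α(t/T) f(ξ_t) ∑_j u_j α((t-j)/T) g(ξ_{t-j})`. -/
noncomputable def crossForm {Ω : Type*} {p : ℕ} (α : ℝ → ℝ) (u : Fin p → ℝ) (f g : ℝ → ℝ)
    (ξ : ℤ → Ω → ℝ) (T : ℕ) (ω : Ω) : ℝ :=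
  ∑ t ∈ Finset.Icc ((p : ℤ) + 1) T, f (ξ t ω) * ((√(T : ℝ))⁻¹ * lagForm α u g ξ T t ω)

lemma card_Icc_succ_le (p T : ℕ) : (Finset.Icc ((p : ℤ) + 1) T).card ≤ T := by
  rw [Int.card_Icc]; omega

lemma abs_pow_four_sub_le {a b W : ℝ} (ha : |a| ≤ W) (hb : |b| ≤ W) :
    |a ^ 4 - b ^ 4| ≤ 4 * W ^ 3 * |a - b| := by
  have hW : 0 ≤ W := (abs_nonneg _).trans ha
  refine (abs_pow_sub_pow_le a b 4).trans ?_
  have h : max |a| |b| ^ (4 - 1) ≤ W ^ 3 :=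
    pow_le_pow_left₀ (le_max_of_le_left (abs_nonneg _)) (max_le ha hb) 3
  calc |a - b| * (4 : ℕ) * max |a| |b| ^ (4 - 1) ≤ |a - b| * (4 : ℕ) * W ^ 3 := by gcongr
    _ = _ := by push_cast; ring

lemma abs_sq_sub_sq_le {a b W : ℝ} (ha : |a| ≤ W) (hb : |b| ≤ W) :
    |a ^ 2 - b ^ 2| ≤ 2 * W * |a - b| := by
  rw [show a ^ 2 - b ^ 2 = (a + b) * (a - b) by ring, abs_mul]
  refine mul_le_mul_of_nonneg_right ((abs_add_le _ _).trans (by linarith)) (abs_nonneg _)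

section
variable {Ω : Type*} [mΩ : MeasurableSpace Ω] {P : Measure Ω} [IsProbabilityMeasure P]
  {ξ : ℤ → Ω → ℝ} {p : ℕ} {α : ℝ → ℝ} {W L : ℝ}

lemma measurable_lagForm_sigmaOn (u : Fin p → ℝ) {g : ℝ → ℝ} (hg : Measurable g) (T : ℕ)
    (t : ℤ) : Measurable[sigmaOn ξ (Ico (t - p) t)] (lagForm α u g ξ T t) := by
  refine Measurable.const_mul (Finset.measurable_fun_sum _ fun j _ => ?_) _
  refine (measurable_sigmaOn ?_ hg).const_mul _
  have := j.2
  simp only [mem_Ico]; omega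

/-- `lagForm` at time `t` is a function of the noise before `t`. -/
lemma measurable_lagForm_past (u : Fin p → ℝ) {g : ℝ → ℝ} (hg : Measurable g) (T : ℕ)
    (t : ℤ) : Measurable[sigmaOn ξ (Iio t)] (lagForm α u g ξ T t) :=
  (measurable_lagForm_sigmaOn u hg T t).mono (sigmaOn_mono fun _ h => h.2) le_rfl

lemma IsIID.measurable_lagForm (hξ : IsIID P ξ) (u : Fin p → ℝ) {g : ℝ → ℝ} (hg : Measurable g)
    (T : ℕ) (t : ℤ) : Measurable (lagForm α u g ξ T t) :=
  (measurable_lagForm_past u hg T t).mono (hξ.sigmaOn_le _) le_rfl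

lemma IsIID.memLp_lagForm (hξ : IsIID P ξ) (u : Fin p → ℝ) {g : ℝ → ℝ} (hg : Measurable g)
    (hg2 : MemLp (fun ω => g (ξ 0 ω)) 2 P) (T : ℕ) (t : ℤ) :
    MemLp (lagForm α u g ξ T t) 2 P := by
  have h : MemLp (fun ω => ∑ j : Fin p,
      (u j * α ((t - ((j : ℤ) + 1) : ℤ) / T)) * g (ξ (t - ((j : ℤ) + 1)) ω)) 2 P :=
    memLp_finsetSum _ fun j _ => (hξ.memLp_comp hg hg2 _).const_mul _
  exact h.const_mul _

lemma IsIID.integral_lagForm_sq (hξ : IsIID P ξ) (u : Fin p → ℝ) {g : ℝ → ℝ} (hg : Measurable g)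
    (hg2 : MemLp (fun ω => g (ξ 0 ω)) 2 P) (hg0 : ∫ ω, g (ξ 0 ω) ∂P = 0) (T : ℕ) (t : ℤ) :
    ∫ ω, lagForm α u g ξ T t ω ^ 2 ∂P = (∫ ω, g (ξ 0 ω) ^ 2 ∂P) *
      (α (t / T) ^ 2 * ∑ j : Fin p, u j ^ 2 * α ((t - ((j : ℤ) + 1) : ℤ) / T) ^ 2) := by
  simp only [lagForm, mul_pow]
  rw [integral_const_mul, hξ.linear_form Finset.univ (fun j : Fin p => t - ((j : ℤ) + 1)) _ _
    hg hg2 hg0]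
  · simp only [mul_pow]; ring
  · intro i _ j _ h
    simp only [sub_right_inj, add_left_inj, Nat.cast_inj] at h
    exact Fin.ext h

lemma sum_sq_mul_sq_le (hW : ∀ x, |α x| ≤ W) (u : Fin p → ℝ) (T : ℕ) (t : ℤ) :
    α (t / T) ^ 2 * ∑ j : Fin p, u j ^ 2 * α ((t - ((j : ℤ) + 1) : ℤ) / T) ^ 2
      ≤ W ^ 4 * ∑ j, u j ^ 2 := by
  have hsq : ∀ x, α x ^ 2 ≤ W ^ 2 := fun x =>
    sq_le_sq' (abs_le.1 (hW x)).1 (abs_le.1 (hW x)).2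
  calc _ ≤ W ^ 2 * ∑ j : Fin p, u j ^ 2 * W ^ 2 := by
        refine mul_le_mul (hsq _) (Finset.sum_le_sum fun j _ => mul_le_mul_of_nonneg_left (hsq _)
          (sq_nonneg _)) (Finset.sum_nonneg fun j _ => by positivity) (sq_nonneg W)
    _ = _ := by rw [← Finset.sum_mul]; ring

/-- `crossForm` is square integrable, with second moment bounded uniformly in `T`. -/
lemma IsIID.crossForm_second_moment (hξ : IsIID P ξ) (hW : ∀ x, |α x| ≤ W) (u : Fin p → ℝ)
    {f g : ℝ → ℝ}
    (hf : Measurable f) (hf2 : MemLp (fun ω => f (ξ 0 ω)) 2 P) (hf0 : ∫ ω, f (ξ 0 ω) ∂P = 0)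
    (hg : Measurable g) (hg2 : MemLp (fun ω => g (ξ 0 ω)) 2 P) (hg0 : ∫ ω, g (ξ 0 ω) ∂P = 0)
    (T : ℕ) :
    MemLp (crossForm α u f g ξ T) 2 P ∧ ∫ ω, crossForm α u f g ξ T ω ^ 2 ∂P ≤
      (∫ ω, f (ξ 0 ω) ^ 2 ∂P) * (∫ ω, g (ξ 0 ω) ^ 2 ∂P) * (W ^ 4 * ∑ j, u j ^ 2) := by
  obtain ⟨h1, h2⟩ := hξ.martingale_sum (Finset.Icc ((p : ℤ) + 1) T) (fun t ω => f (ξ t ω))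
    (fun t ω => (√(T : ℝ))⁻¹ * lagForm α u g ξ T t ω)
    (fun t => measurable_sigmaOn (mem_singleton _) hf)
    (fun t => (measurable_lagForm_past u hg T t).const_mul _)
    (fun t => hξ.memLp_comp hf hf2 t) (fun t => (hξ.memLp_lagForm u hg hg2 T t).const_mul _)
    (fun t => by rw [hξ.integral_comp hf, hf0])
  refine ⟨h1, ?_⟩
  unfold crossForm
  rw [h2]
  set Vf := ∫ ω, f (ξ 0 ω) ^ 2 ∂P
  set Vg := ∫ ω, g (ξ 0 ω) ^ 2 ∂P
  have hVf : 0 ≤ Vf := integral_nonneg fun _ => sq_nonneg _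
  have hVg : 0 ≤ Vg := integral_nonneg fun _ => sq_nonneg _
  have hS : 0 ≤ W ^ 4 * ∑ j, u j ^ 2 :=
    mul_nonneg (by positivity) (Finset.sum_nonneg fun _ _ => sq_nonneg _)
  have hterm : ∀ t ∈ Finset.Icc ((p : ℤ) + 1) T, (∫ ω, f (ξ t ω) ^ 2 ∂P) *
      ∫ ω, ((√(T : ℝ))⁻¹ * lagForm α u g ξ T t ω) ^ 2 ∂P
      ≤ (T : ℝ)⁻¹ * (Vf * Vg * (W ^ 4 * ∑ j, u j ^ 2)) := by
    intro t _
    have he : ∫ ω, f (ξ t ω) ^ 2 ∂P = Vf := hξ.integral_comp (hf.pow_const 2) t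
    simp_rw [mul_pow]
    rw [he, integral_const_mul, hξ.integral_lagForm_sq u hg hg2 hg0, inv_pow,
      Real.sq_sqrt (Nat.cast_nonneg T)]
    have := sum_sq_mul_sq_le hW u T t
    calc _ ≤ Vf * ((T : ℝ)⁻¹ * (Vg * (W ^ 4 * ∑ j, u j ^ 2))) := by gcongr
      _ = _ := by ring
  refine (Finset.sum_le_card_nsmul _ _ _ hterm).trans ?_
  rw [nsmul_eq_mul, ← mul_assoc]
  have h1 : ((Finset.Icc ((p : ℤ) + 1) T).card : ℝ) * (T : ℝ)⁻¹ ≤ 1 :=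
    div_le_one_of_le₀ (by exact_mod_cast card_Icc_succ_le p T) (by positivity)
  exact (mul_le_mul_of_nonneg_right h1 (by positivity)).trans_eq (one_mul _)

lemma crossForm_sub (u : Fin p → ℝ) (f g : ℝ → ℝ) (T : ℕ) (ω : Ω) :
    crossForm α u f f ξ T ω - crossForm α u g g ξ T ω
      = crossForm α u (fun x => f x - g x) f ξ T ω
        + crossForm α u g (fun x => f x - g x) ξ T ω := by
  have hlag : ∀ t, lagForm α u (fun x => f x - g x) ξ T t ω
      = lagForm α u f ξ T t ω - lagForm α u g ξ T t ω := fun t => by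
    simp only [lagForm, mul_sub, Finset.sum_sub_distrib]
  unfold crossForm
  rw [← Finset.sum_sub_distrib, ← Finset.sum_add_distrib]
  refine Finset.sum_congr rfl fun t _ => ?_
  rw [hlag]; ring

lemma abs_mul_lagForm_le (hW : ∀ x, |α x| ≤ W) (u : Fin p → ℝ) {f : ℝ → ℝ} {M : ℝ}
    (hM : ∀ x, |f x| ≤ M) (T : ℕ) (t : ℤ) (ω : Ω) :
    |f (ξ t ω) * lagForm α u f ξ T t ω| ≤ M * (W * ∑ j, |u j| * W * M) := by
  have hW0 : 0 ≤ W := (abs_nonneg _).trans (hW 0)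
  have h1 : |lagForm α u f ξ T t ω| ≤ W * ∑ j, |u j| * W * M := by
    unfold lagForm
    rw [abs_mul]
    refine mul_le_mul (hW _) ((Finset.abs_sum_le_sum_abs _ _).trans
      (Finset.sum_le_sum fun j _ => ?_)) (abs_nonneg _) hW0
    rw [abs_mul, abs_mul]
    have h2 := hW ((t - ((j : ℤ) + 1) : ℤ) / T)
    have h3 := hM (ξ (t - ((j : ℤ) + 1)) ω)
    gcongr
  rw [abs_mul]
  exact mul_le_mul (hM _) h1 (abs_nonneg _) ((abs_nonneg _).trans (hM 0))

/-- The quadratic variation of `crossForm` converges in `L¹`, for bounded `f`.  Its conditional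
expectations are not needed: the squared increments are `p`-dependent, so that their sum
concentrates around its mean. -/
lemma IsIID.tendsto_quadratic_variation (hξ : IsIID P ξ) (hW : ∀ x, |α x| ≤ W)
    (hL : ∀ x y, |α x - α y| ≤ L * |x - y|) (u : Fin p → ℝ) {f : ℝ → ℝ} (hf : Measurable f)
    {M : ℝ} (hM : ∀ x, |f x| ≤ M) (hf0 : ∫ ω, f (ξ 0 ω) ∂P = 0) :
    Tendsto (fun T : ℕ => ∫ ω, |∑ t ∈ Finset.Icc ((p : ℤ) + 1) T,
        (f (ξ t ω) * ((√(T : ℝ))⁻¹ * lagForm α u f ξ T t ω)) ^ 2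
        - (∫ ω, f (ξ 0 ω) ^ 2 ∂P) ^ 2 * ((∑ j, u j ^ 2) * ∫ x in (0 : ℝ)..1, α x ^ 4)| ∂P)
      atTop (𝓝 0) := by
  have hW0 : 0 ≤ W := (abs_nonneg _).trans (hW 0)
  have hM0 : 0 ≤ M := (abs_nonneg _).trans (hM 0)
  have hL0 : 0 ≤ L := by simpa using (abs_nonneg _).trans (hL 0 1)
  set V := ∫ ω, f (ξ 0 ω) ^ 2 ∂P with hV
  set U := ∑ j, u j ^ 2 with hU
  have hU0 : 0 ≤ U := Finset.sum_nonneg fun _ _ => sq_nonneg _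
  have hf2 : MemLp (fun ω => f (ξ 0 ω)) 2 P :=
    MemLp.of_bound (hf.comp (hξ.measurable 0)).aestronglyMeasurable M (ae_of_all _ fun ω => hM _)
  set ψ : ℕ → ℤ → ℝ := fun T t =>
    α (t / T) ^ 2 * ∑ j : Fin p, u j ^ 2 * α ((t - ((j : ℤ) + 1) : ℤ) / T) ^ 2 with hψ
  -- the mean of the quadratic variation is a Riemann sum
  have hR : Tendsto (fun T : ℕ => (T : ℝ)⁻¹ * ∑ t ∈ Finset.Icc ((p : ℤ) + 1) T, ψ T t) atTop
      (𝓝 (∫ x in (0 : ℝ)..1, U * α x ^ 4)) := by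
    refine tendsto_riemann_sum (L := U * (4 * W ^ 3 * L)) (B := U * W ^ 4)
      (C := W ^ 2 * (U * (2 * W * (L * p)))) (fun x y => ?_) (fun x => ?_) p ψ (fun T t => ?_)
    · rw [← mul_sub, abs_mul, abs_of_nonneg hU0, mul_assoc]
      refine mul_le_mul_of_nonneg_left ((abs_pow_four_sub_le (hW x) (hW y)).trans ?_) hU0
      rw [mul_assoc (4 * W ^ 3)]
      exact mul_le_mul_of_nonneg_left (hL x y) (by positivity)
    · rw [abs_mul, abs_of_nonneg hU0, abs_pow]
      exact mul_le_mul_of_nonneg_left (pow_le_pow_left₀ (abs_nonneg _) (hW x) 4) hU0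
    · have hdec : ψ T t - U * α (t / T) ^ 4 = α (t / T) ^ 2 * ∑ j : Fin p,
          u j ^ 2 * (α ((t - ((j : ℤ) + 1) : ℤ) / T) ^ 2 - α (t / T) ^ 2) := by
        simp only [hψ, mul_sub, Finset.sum_sub_distrib, ← Finset.sum_mul, ← hU]
        ring
      have hj : ∀ j : Fin p, |α ((t - ((j : ℤ) + 1) : ℤ) / T) ^ 2 - α (t / T) ^ 2|
          ≤ 2 * W * (L * p) / T := by
        intro j
        refine (abs_sq_sub_sq_le (hW _) (hW _)).trans ?_
        rw [mul_div_assoc, mul_div_assoc]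
        refine mul_le_mul_of_nonneg_left ((hL _ _).trans
          (mul_le_mul_of_nonneg_left ?_ hL0)) (by positivity)
        rw [← sub_div, abs_div, Nat.abs_cast]
        refine div_le_div_of_nonneg_right ?_ (Nat.cast_nonneg T)
        have hjp : ((j : ℕ) : ℝ) + 1 ≤ p := by exact_mod_cast j.2
        push_cast
        rw [abs_le]
        constructor <;> linarith [(Nat.cast_nonneg (j : ℕ) : (0 : ℝ) ≤ (j : ℕ))]
      rw [hdec, abs_mul, abs_of_nonneg (sq_nonneg _), mul_div_assoc]
      refine mul_le_mul (sq_le_sq' (abs_le.1 (hW _)).1 (abs_le.1 (hW _)).2) ?_ (abs_nonneg _)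
        (by positivity)
      rw [hU, mul_div_assoc, Finset.sum_mul]
      refine (Finset.abs_sum_le_sum_abs _ _).trans (Finset.sum_le_sum fun j _ => ?_)
      rw [abs_mul, abs_of_nonneg (sq_nonneg _)]
      exact mul_le_mul_of_nonneg_left (hj j) (sq_nonneg _)
  rw [intervalIntegral.integral_const_mul] at hR
  -- the fluctuations are bounded by `p`-dependence
  set G : ℕ → ℤ → Ω → ℝ := fun T t ω => (f (ξ t ω) * lagForm α u f ξ T t ω) ^ 2 - V * (V * ψ T t)
    with hG
  set B₁ : ℝ := M * (W * ∑ j, |u j| * W * M) with hB₁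
  have hlagb : ∀ T t ω, |f (ξ t ω) * lagForm α u f ξ T t ω| ≤ B₁ := abs_mul_lagForm_le hW u hM
  have hm1 : ∀ T t, Measurable (fun ω => f (ξ t ω) * lagForm α u f ξ T t ω) := fun T t =>
    (hξ.measurable_comp hf t).mul (hξ.measurable_lagForm u hf T t)
  have hmi : ∀ T t, Integrable (fun ω => (f (ξ t ω) * lagForm α u f ξ T t ω) ^ 2) P := by
    intro T t
    refine Integrable.of_bound ((hm1 T t).pow_const 2).aestronglyMeasurable (B₁ ^ 2)
      (ae_of_all _ fun ω => ?_)
    rw [norm_pow]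
    exact pow_le_pow_left₀ (norm_nonneg _) (hlagb T t ω) 2
  have hmean : ∀ T t, ∫ ω, (f (ξ t ω) * lagForm α u f ξ T t ω) ^ 2 ∂P = V * (V * ψ T t) := by
    intro T t
    have hi : IndepFun (fun ω => f (ξ t ω)) (lagForm α u f ξ T t) P :=
      hξ.indepFun_of_disjoint (S := {t}) (by simp) (measurable_sigmaOn (mem_singleton _) hf)
        (measurable_lagForm_past u hf T t)
    rw [IndepFun.integral_mul_sq hi (hξ.memLp_comp hf hf2 t) (hξ.memLp_lagForm u hf hf2 T t),
      hξ.integral_lagForm_sq u hf hf2 hf0, hξ.integral_comp (hf.pow_const 2)]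
  have hVψ : ∀ T t, |V * (V * ψ T t)| ≤ B₁ ^ 2 := by
    intro T t
    rw [← hmean]
    have := norm_integral_le_of_norm_le_const (μ := P)
      (f := fun ω => (f (ξ t ω) * lagForm α u f ξ T t ω) ^ 2) (C := B₁ ^ 2)
      (ae_of_all P fun ω => by
        rw [norm_pow]; exact pow_le_pow_left₀ (norm_nonneg _) (hlagb T t ω) 2)
    simpa using this
  have hGm : ∀ T t, Measurable[sigmaOn ξ (Icc (t - p) t)] (G T t) := by
    intro T t
    have h1 : Measurable[sigmaOn ξ (Icc (t - p) t)] fun ω =>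
        f (ξ t ω) * lagForm α u f ξ T t ω :=
      (measurable_sigmaOn (by simp) hf).mul
        ((measurable_lagForm_sigmaOn u hf T t).mono (sigmaOn_mono Ico_subset_Icc_self) le_rfl)
    exact (h1.pow_const 2).sub_const _
  have hGb : ∀ T t ω, |G T t ω| ≤ 2 * B₁ ^ 2 := by
    intro T t ω
    refine (abs_sub _ _).trans ?_
    have h1 := pow_le_pow_left₀ (abs_nonneg _) (hlagb T t ω) 2
    have h2 := hVψ T t
    rw [abs_pow]
    linarith
  have hG0 : ∀ T t, ∫ ω, G T t ω ∂P = 0 := fun T t => by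
    rw [hG, integral_sub (hmi T t) (integrable_const _), hmean]; simp
  have hGi : ∀ T t, MemLp (G T t) 2 P := fun T t =>
    MemLp.of_bound ((hGm T t).mono (hξ.sigmaOn_le _) le_rfl).aestronglyMeasurable _
      (ae_of_all _ fun ω => hGb T t ω)
  have hfluct : ∀ T : ℕ, 0 < T →
      ∫ ω, |(T : ℝ)⁻¹ * ∑ t ∈ Finset.Icc ((p : ℤ) + 1) T, G T t ω| ∂P
        ≤ √((2 * p + 1) * (2 * B₁ ^ 2) ^ 2 * (T : ℝ)⁻¹) := by
    intro T hT
    have hT' : (0 : ℝ) < T := by exact_mod_cast hT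
    have h1 := hξ.integral_sq_sum_le_of_dependent (Finset.Icc ((p : ℤ) + 1) T) p (G T) (hGm T)
      (hGb T) (hG0 T)
    have hmem : MemLp (fun ω => ∑ t ∈ Finset.Icc ((p : ℤ) + 1) T, G T t ω) 2 P :=
      memLp_finsetSum _ fun t _ => hGi T t
    refine (integral_abs_le_sqrt (hmem.const_mul (T : ℝ)⁻¹)).trans (Real.sqrt_le_sqrt ?_)
    simp_rw [mul_pow (T : ℝ)⁻¹]
    rw [integral_const_mul]
    have hcard : ((Finset.Icc ((p : ℤ) + 1) T).card : ℝ) ≤ T := by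
      exact_mod_cast card_Icc_succ_le p T
    calc _ ≤ (T : ℝ)⁻¹ ^ 2 * ((Finset.Icc ((p : ℤ) + 1) T).card
          * ((2 * p + 1) * (2 * B₁ ^ 2) ^ 2)) := by gcongr
      _ ≤ (T : ℝ)⁻¹ ^ 2 * (T * ((2 * p + 1) * (2 * B₁ ^ 2) ^ 2)) := by gcongr
      _ = _ := by field_simp
  have hlim1 : Tendsto (fun T : ℕ => √((2 * p + 1) * (2 * B₁ ^ 2) ^ 2 * (T : ℝ)⁻¹)) atTop
      (𝓝 0) := by
    have : Tendsto (fun T : ℕ => √((2 * p + 1) * (2 * B₁ ^ 2) ^ 2 * (T : ℝ)⁻¹)) atTop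
        (𝓝 √((2 * p + 1) * (2 * B₁ ^ 2) ^ 2 * 0)) :=
      (Real.continuous_sqrt.tendsto _).comp (tendsto_inv_atTop_nhds_zero_nat.const_mul _)
    simpa using this
  have hlim2 : Tendsto (fun T : ℕ => V ^ 2 * |(T : ℝ)⁻¹ * ∑ t ∈ Finset.Icc ((p : ℤ) + 1) T, ψ T t
      - U * ∫ x in (0 : ℝ)..1, α x ^ 4|) atTop (𝓝 0) := by
    have := ((tendsto_iff_dist_tendsto_zero.1 hR).const_mul (V ^ 2))
    simpa [Real.dist_eq] using this
  have hlim := hlim1.add hlim2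
  rw [add_zero] at hlim
  refine squeeze_zero' (Eventually.of_forall fun T => integral_nonneg fun _ => abs_nonneg _)
    ((eventually_gt_atTop 0).mono fun T hT => ?_) hlim
  set D : ℝ := (T : ℝ)⁻¹ * ∑ t ∈ Finset.Icc ((p : ℤ) + 1) T, ψ T t
      - U * ∫ x in (0 : ℝ)..1, α x ^ 4 with hD
  have hdec : ∀ ω, ∑ t ∈ Finset.Icc ((p : ℤ) + 1) T,
        (f (ξ t ω) * ((√(T : ℝ))⁻¹ * lagForm α u f ξ T t ω)) ^ 2
        - V ^ 2 * (U * ∫ x in (0 : ℝ)..1, α x ^ 4)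
      = (T : ℝ)⁻¹ * ∑ t ∈ Finset.Icc ((p : ℤ) + 1) T, G T t ω + V ^ 2 * D := by
    intro ω
    have h1 : ∀ t, (f (ξ t ω) * ((√(T : ℝ))⁻¹ * lagForm α u f ξ T t ω)) ^ 2
        = (T : ℝ)⁻¹ * (f (ξ t ω) * lagForm α u f ξ T t ω) ^ 2 := fun t => by
      rw [show f (ξ t ω) * ((√(T : ℝ))⁻¹ * lagForm α u f ξ T t ω)
        = (√(T : ℝ))⁻¹ * (f (ξ t ω) * lagForm α u f ξ T t ω) by ring, mul_pow, inv_pow,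
        Real.sq_sqrt (Nat.cast_nonneg T)]
    simp_rw [h1]
    rw [← Finset.mul_sum]
    simp only [hG, hD, Finset.sum_sub_distrib, ← Finset.mul_sum]
    ring
  simp_rw [hdec]
  have hGsum : Integrable (fun ω => (T : ℝ)⁻¹ * ∑ t ∈ Finset.Icc ((p : ℤ) + 1) T, G T t ω) P :=
    (integrable_finsetSum _ fun t _ => (hGi T t).integrable (by norm_num)).const_mul _
  calc _ ≤ ∫ ω, |(T : ℝ)⁻¹ * ∑ t ∈ Finset.Icc ((p : ℤ) + 1) T, G T t ω| + V ^ 2 * |D| ∂P := by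
        refine integral_mono (hGsum.add (integrable_const _)).abs
          (hGsum.abs.add (integrable_const _)) fun ω => (abs_add_le _ _).trans (le_of_eq ?_)
        rw [abs_mul (V ^ 2), abs_of_nonneg (sq_nonneg V)]
    _ ≤ _ := by
        rw [integral_add hGsum.abs (integrable_const _)]
        simpa using hfluct T hT

end

/-! ### Convergence of the characteristic function -/

section
variable {Ω : Type*} [mΩ : MeasurableSpace Ω] {P : Measure Ω} [IsProbabilityMeasure P]
  {ξ : ℤ → Ω → ℝ} {p : ℕ} {α : ℝ → ℝ} {W L : ℝ}

/-- The central limit theorem for `crossForm`, for a bounded function `f` of the noise. -/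
lemma IsIID.tendsto_integral_cexp_crossForm_of_bounded (hξ : IsIID P ξ) (hW : ∀ x, |α x| ≤ W)
    (hL : ∀ x y, |α x - α y| ≤ L * |x - y|) (u : Fin p → ℝ) {f : ℝ → ℝ} (hf : Measurable f)
    {M : ℝ} (hM : ∀ x, |f x| ≤ M) (hf0 : ∫ ω, f (ξ 0 ω) ∂P = 0) :
    Tendsto (fun T : ℕ => ∫ ω, Complex.exp ((crossForm α u f f ξ T ω : ℝ) * Complex.I) ∂P) atTop
      (𝓝 ((Real.exp (-((∫ ω, f (ξ 0 ω) ^ 2 ∂P) ^ 2 *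
        ((∑ j, u j ^ 2) * ∫ x in (0 : ℝ)..1, α x ^ 4) / 2)) : ℝ) : ℂ)) := by
  have hW0 : 0 ≤ W := (abs_nonneg _).trans (hW 0)
  have hM0 : 0 ≤ M := (abs_nonneg _).trans (hM 0)
  set v := (∫ ω, f (ξ 0 ω) ^ 2 ∂P) ^ 2 * ((∑ j, u j ^ 2) * ∫ x in (0 : ℝ)..1, α x ^ 4) with hv
  have hv0 : 0 ≤ v := mul_nonneg (sq_nonneg _) (mul_nonneg
    (Finset.sum_nonneg fun _ _ => sq_nonneg _)
    (intervalIntegral.integral_nonneg zero_le_one fun x _ => by positivity))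
  set B : ℝ := M * (W * ∑ j, |u j| * W * M) with hB
  have hB0 : 0 ≤ B := mul_nonneg hM0 (mul_nonneg hW0 (Finset.sum_nonneg fun j _ => by positivity))
  have hlagb : ∀ (T : ℕ) t ω, |f (ξ t ω) * ((√(T : ℝ))⁻¹ * lagForm α u f ξ T t ω)|
      ≤ B * (√(T : ℝ))⁻¹ := by
    intro T t ω
    rw [show f (ξ t ω) * ((√(T : ℝ))⁻¹ * lagForm α u f ξ T t ω)
        = f (ξ t ω) * lagForm α u f ξ T t ω * (√(T : ℝ))⁻¹ by ring, abs_mul,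
      abs_of_nonneg (by positivity : 0 ≤ (√(T : ℝ))⁻¹)]
    exact mul_le_mul_of_nonneg_right (abs_mul_lagForm_le hW u hM T t ω) (by positivity)
  have hsqrt : Tendsto (fun T : ℕ => (√(T : ℝ))⁻¹) atTop (𝓝 0) :=
    tendsto_inv_atTop_zero.comp (Real.tendsto_sqrt_atTop.comp tendsto_natCast_atTop_atTop)
  have hc : Tendsto (fun T : ℕ => B * (√(T : ℝ))⁻¹) atTop (𝓝 0) := by
    simpa using hsqrt.const_mul B
  have hq := hξ.tendsto_quadratic_variation hW hL u hf hM hf0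
  rw [← hv] at hq
  have hlim : Tendsto (fun T : ℕ => 2 * B ^ 3 * (√(T : ℝ))⁻¹ + Real.exp (B ^ 2 / 2) *
      ((∫ ω, |∑ t ∈ Finset.Icc ((p : ℤ) + 1) T,
        (f (ξ t ω) * ((√(T : ℝ))⁻¹ * lagForm α u f ξ T t ω)) ^ 2 - v| ∂P) / 2)) atTop (𝓝 0) := by
    have := (hsqrt.const_mul (2 * B ^ 3)).add ((hq.div_const 2).const_mul (Real.exp (B ^ 2 / 2)))
    simpa using this
  rw [tendsto_iff_norm_sub_tendsto_zero]
  refine squeeze_zero' (Eventually.of_forall fun _ => norm_nonneg _) ?_ hlim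
  filter_upwards [eventually_gt_atTop 0, hc.eventually_le_const (show (0 : ℝ) < 1 by norm_num)]
    with T hT hc1
  have hT' : (0 : ℝ) < T := by exact_mod_cast hT
  have hmain := hξ.norm_integral_cexp_sub_le (Finset.Icc ((p : ℤ) + 1) T) (fun t ω => f (ξ t ω))
    (fun t ω => (√(T : ℝ))⁻¹ * lagForm α u f ξ T t ω)
    (fun t => measurable_sigmaOn (mem_singleton _) hf)
    (fun t => (measurable_lagForm_past u hf T t).const_mul _)
    (fun t => by rw [hξ.integral_comp hf, hf0]) hc1 (hlagb T) hv0
  refine hmain.trans ?_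
  have hcard : ((Finset.Icc ((p : ℤ) + 1) T).card : ℝ) ≤ T := by
    exact_mod_cast card_Icc_succ_le p T
  have hs2 : (√(T : ℝ))⁻¹ ^ 2 = (T : ℝ)⁻¹ := by
    rw [inv_pow, Real.sq_sqrt (Nat.cast_nonneg T)]
  refine add_le_add ?_ ?_
  · calc _ ≤ (T : ℝ) * (2 * (B * (√(T : ℝ))⁻¹) ^ 3) := by gcongr
      _ = 2 * B ^ 3 * (√(T : ℝ))⁻¹ * (T * (√(T : ℝ))⁻¹ ^ 2) := by ring
      _ = _ := by rw [hs2, mul_inv_cancel₀ hT'.ne', mul_one]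
  · have hnn : 0 ≤ (∫ ω, |∑ t ∈ Finset.Icc ((p : ℤ) + 1) T,
        (f (ξ t ω) * ((√(T : ℝ))⁻¹ * lagForm α u f ξ T t ω)) ^ 2 - v| ∂P) / 2 :=
      div_nonneg (integral_nonneg fun _ => abs_nonneg _) zero_le_two
    refine mul_le_mul_of_nonneg_right (Real.exp_le_exp.2 ?_) hnn
    calc _ ≤ (T : ℝ) * ((B * (√(T : ℝ))⁻¹) ^ 2 / 2) := by gcongr
      _ = B ^ 2 / 2 * (T * (√(T : ℝ))⁻¹ ^ 2) := by ring
      _ = _ := by rw [hs2, mul_inv_cancel₀ hT'.ne', mul_one]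

/-- The characteristic function at `1` is `1`-Lipschitz with respect to the `L¹` distance. -/
lemma norm_integral_cexp_sub_integral_cexp_le {X Y : Ω → ℝ} (hX : Integrable X P)
    (hY : Integrable Y P) :
    ‖∫ ω, Complex.exp ((X ω : ℝ) * Complex.I) ∂P - ∫ ω, Complex.exp ((Y ω : ℝ) * Complex.I) ∂P‖
      ≤ ∫ ω, |X ω - Y ω| ∂P := by
  have hi : ∀ {X : Ω → ℝ}, Integrable X P →
      Integrable (fun ω => Complex.exp ((X ω : ℝ) * Complex.I)) P := by
    intro X hX
    refine Integrable.of_bound (Complex.continuous_exp.comp_aestronglyMeasurable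
      ((Complex.continuous_ofReal.comp_aestronglyMeasurable hX.1).mul_const _)) 1
      (ae_of_all _ fun ω => (Complex.norm_exp_ofReal_mul_I _).le)
  rw [← integral_sub (hi hX) (hi hY)]
  refine (norm_integral_le_integral_norm _).trans
    (integral_mono ((hi hX).sub (hi hY)).norm (hX.sub hY).abs fun ω => ?_)
  have h : Complex.exp ((X ω : ℝ) * Complex.I) - Complex.exp ((Y ω : ℝ) * Complex.I)
      = Complex.exp ((Y ω : ℝ) * Complex.I)
        * (Complex.exp (Complex.I * ((X ω - Y ω : ℝ) : ℂ)) - 1) := by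
    rw [mul_sub, ← Complex.exp_add, mul_one]; congr 2; push_cast; ring
  simp only
  rw [h, norm_mul, Complex.norm_exp_ofReal_mul_I, one_mul]
  exact Real.norm_exp_I_mul_ofReal_sub_one_le

/-- The central limit theorem for `crossForm`: convergence of the characteristic function, for
every centred square integrable function `f` of the noise. -/
theorem IsIID.tendsto_integral_cexp_crossForm (hξ : IsIID P ξ) (hW : ∀ x, |α x| ≤ W)
    (hL : ∀ x y, |α x - α y| ≤ L * |x - y|) (u : Fin p → ℝ) {f : ℝ → ℝ} (hf : Measurable f)
    (hf2 : MemLp (fun ω => f (ξ 0 ω)) 2 P) (hf0 : ∫ ω, f (ξ 0 ω) ∂P = 0) :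
    Tendsto (fun T : ℕ => ∫ ω, Complex.exp ((crossForm α u f f ξ T ω : ℝ) * Complex.I) ∂P) atTop
      (𝓝 ((Real.exp (-((∫ ω, f (ξ 0 ω) ^ 2 ∂P) ^ 2 *
        ((∑ j, u j ^ 2) * ∫ x in (0 : ℝ)..1, α x ^ 4) / 2)) : ℝ) : ℂ)) := by
  have hfi : Integrable (fun ω => f (ξ 0 ω)) P := hf2.integrable (by norm_num)
  have htm := fun M => measurable_truncateAt hf M
  have hti : ∀ M, MemLp (fun ω => truncateAt f M (ξ 0 ω)) 2 P := fun M =>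
    MemLp.of_bound ((htm M).comp (hξ.measurable 0)).aestronglyMeasurable M
      (ae_of_all _ fun ω => abs_truncateAt_le f M _)
  set μ : ℕ → ℝ := fun M => ∫ ω, truncateAt f M (ξ 0 ω) ∂P with hμ
  -- the centred truncation
  set g : ℕ → ℝ → ℝ := fun M x => truncateAt f M x - μ M with hg
  have hgm : ∀ M, Measurable (g M) := fun M => (htm M).sub_const _
  have hg2 : ∀ M, MemLp (fun ω => g M (ξ 0 ω)) 2 P := fun M => (hti M).sub (memLp_const _)
  have hg0 : ∀ M, ∫ ω, g M (ξ 0 ω) ∂P = 0 := fun M => by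
    rw [hg, integral_sub ((hti M).integrable (by norm_num)) (integrable_const _)]
    simp [hμ]
  have hgb : ∀ M x, |g M x| ≤ M + |μ M| := fun M x =>
    (abs_sub _ _).trans (by linarith [abs_truncateAt_le f M x])
  set r : ℕ → ℝ → ℝ := fun M x => f x - g M x with hr
  have hrm : ∀ M, Measurable (r M) := fun M => hf.sub (hgm M)
  have hr2 : ∀ M, MemLp (fun ω => r M (ξ 0 ω)) 2 P := fun M => hf2.sub (hg2 M)
  have hr0 : ∀ M, ∫ ω, r M (ξ 0 ω) ∂P = 0 := fun M => by
    rw [hr, integral_sub hfi ((hg2 M).integrable (by norm_num)), hg0, hf0, sub_zero]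
  -- the truncations converge in mean square
  have hμ0 : Tendsto μ atTop (𝓝 0) := by
    have := tendsto_integral_truncateAt hf (hξ.measurable 0) (Φ := fun z => z.2) (by fun_prop)
      hfi.abs fun M ω => abs_truncateAt_le_abs f M _
    rwa [hf0] at this
  have hV : Tendsto (fun M => ∫ ω, g M (ξ 0 ω) ^ 2 ∂P) atTop (𝓝 (∫ ω, f (ξ 0 ω) ^ 2 ∂P)) := by
    have h1 := tendsto_integral_truncateAt hf (hξ.measurable 0) (Φ := fun z => z.2 ^ 2)
      (by fun_prop) hf2.integrable_sq fun M ω => by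
        rw [abs_of_nonneg (sq_nonneg _)]; exact sq_le_sq.2 (abs_truncateAt_le_abs f M _)
    have h2 : ∀ M, ∫ ω, g M (ξ 0 ω) ^ 2 ∂P = ∫ ω, truncateAt f M (ξ 0 ω) ^ 2 ∂P - μ M ^ 2 := by
      intro M
      have := (variance_eq_sub (hti M)).symm.trans
        (variance_eq_integral (hti M).aestronglyMeasurable.aemeasurable)
      simpa [hg, hμ] using this.symm
    simp_rw [h2]
    simpa using h1.sub (hμ0.pow 2)
  have hrV : Tendsto (fun M => ∫ ω, r M (ξ 0 ω) ^ 2 ∂P) atTop (𝓝 0) := by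
    have h1 := tendsto_integral_truncateAt hf (hξ.measurable 0) (Φ := fun z => (z.1 - z.2) ^ 2)
      (by fun_prop) hf2.integrable_sq fun M ω => by
        rw [abs_of_nonneg (sq_nonneg _)]; exact sq_le_sq.2 (abs_sub_truncateAt_le_abs f M _)
    have h2 : ∀ M, ∫ ω, r M (ξ 0 ω) ^ 2 ∂P
        = ∫ ω, (f (ξ 0 ω) - truncateAt f M (ξ 0 ω)) ^ 2 ∂P - μ M ^ 2 := by
      intro M
      have hd : MemLp (fun ω => f (ξ 0 ω) - truncateAt f M (ξ 0 ω)) 2 P := hf2.sub (hti M)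
      have hdm : ∫ ω, f (ξ 0 ω) - truncateAt f M (ξ 0 ω) ∂P = - μ M := by
        rw [integral_sub hfi ((hti M).integrable (by norm_num)), hf0, zero_sub]
      have := (variance_eq_sub hd).symm.trans
        (variance_eq_integral hd.aestronglyMeasurable.aemeasurable)
      simp only [Pi.pow_apply, hdm, neg_sq, sub_neg_eq_add] at this
      rw [this]
      congr 1; ext ω; simp only [hr, hg]; ring
    simp_rw [h2]
    simpa using h1.sub (hμ0.pow 2)
  set U := ∑ j, u j ^ 2 with hU
  refine tendsto_of_uniform_approx
    (e := fun M => √((∫ ω, r M (ξ 0 ω) ^ 2 ∂P) * (∫ ω, f (ξ 0 ω) ^ 2 ∂P) * (W ^ 4 * U))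
      + √((∫ ω, g M (ξ 0 ω) ^ 2 ∂P) * (∫ ω, r M (ξ 0 ω) ^ 2 ∂P) * (W ^ 4 * U)))
    (fun M => hξ.tendsto_integral_cexp_crossForm_of_bounded hW hL u (hgm M) (hgb M) (hg0 M))
    (fun M T => ?_) ?_ ?_
  · have hS1 := hξ.crossForm_second_moment hW u hf hf2 hf0 hf hf2 hf0 T
    have hS2 := hξ.crossForm_second_moment hW u (hgm M) (hg2 M) (hg0 M) (hgm M) (hg2 M) (hg0 M) T
    have hS3 := hξ.crossForm_second_moment hW u (hrm M) (hr2 M) (hr0 M) hf hf2 hf0 T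
    have hS4 := hξ.crossForm_second_moment hW u (hgm M) (hg2 M) (hg0 M) (hrm M) (hr2 M) (hr0 M) T
    have hi3 : Integrable (crossForm α u (r M) f ξ T) P := hS3.1.integrable (by norm_num)
    have hi4 : Integrable (crossForm α u (g M) (r M) ξ T) P := hS4.1.integrable (by norm_num)
    rw [dist_eq_norm]
    refine (norm_integral_cexp_sub_integral_cexp_le (hS1.1.integrable (by norm_num))
      (hS2.1.integrable (by norm_num))).trans ?_
    simp_rw [crossForm_sub]
    calc _ ≤ ∫ ω, |crossForm α u (r M) f ξ T ω| + |crossForm α u (g M) (r M) ξ T ω| ∂P :=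
          integral_mono (hi3.add hi4).abs (hi3.abs.add hi4.abs) fun ω => abs_add_le _ _
      _ = ∫ ω, |crossForm α u (r M) f ξ T ω| ∂P + ∫ ω, |crossForm α u (g M) (r M) ξ T ω| ∂P :=
          integral_add hi3.abs hi4.abs
      _ ≤ _ := add_le_add
          ((integral_abs_le_sqrt hS3.1).trans (Real.sqrt_le_sqrt hS3.2))
          ((integral_abs_le_sqrt hS4.1).trans (Real.sqrt_le_sqrt hS4.2))
  · have h1 := (Real.continuous_sqrt.tendsto _).comp
      ((hrV.mul_const (∫ ω, f (ξ 0 ω) ^ 2 ∂P)).mul_const (W ^ 4 * U))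
    have h2 := (Real.continuous_sqrt.tendsto _).comp ((hV.mul hrV).mul_const (W ^ 4 * U))
    have := h1.add h2
    simpa [Function.comp_def] using this
  · have h := ((hV.pow 2).mul_const (U * ∫ x in (0 : ℝ)..1, α x ^ 4)).div_const 2
    exact (Complex.continuous_ofReal.tendsto _).comp ((Real.continuous_exp.tendsto _).comp h.neg)

end

/-! ### The effect of smoothing -/

/-- The error `(w_t - ∑_i k_{t,i} w_i) - ∑_i k_{t,i} w_i f(ξ_i)` made when the centred variable
`w_t f(ξ_t)` is replaced by the variable `w_t (1 + f(ξ_t))` minus its smoothed version. -/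
noncomputable def smoothingError {Ω : Type*} (w : ℤ → ℝ) (f : ℝ → ℝ) (ξ : ℤ → Ω → ℝ)
    (k : ℤ → ℤ → ℝ) (J : Finset ℤ) (t : ℤ) (ω : Ω) : ℝ :=
  (w t - ∑ i ∈ J, k t i * w i) - ∑ i ∈ J, (k t i * w i) * f (ξ i ω)

/-- The smoothing weights `k_{t,i}`, `t ∈ S`, `i ∈ J`, are probability weights bounded by `κ`, and
smoothing `w` by them has a bias of at most `β`. -/
structure IsSmoothing (w : ℤ → ℝ) (k : ℤ → ℤ → ℝ) (S J : Finset ℤ) (κ β : ℝ) : Prop where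
  nonneg : ∀ t ∈ S, ∀ i ∈ J, 0 ≤ k t i
  le : ∀ t ∈ S, ∀ i ∈ J, k t i ≤ κ
  sum_eq_one : ∀ t ∈ S, ∑ i ∈ J, k t i = 1
  bias : ∀ t ∈ S, |w t - ∑ i ∈ J, k t i * w i| ≤ β

lemma IsSmoothing.sum_sq_le {w : ℤ → ℝ} {k : ℤ → ℤ → ℝ} {S J : Finset ℤ} {κ β : ℝ}
    (hk : IsSmoothing w k S J κ β) {t : ℤ} (ht : t ∈ S) : ∑ i ∈ J, k t i ^ 2 ≤ κ := by
  calc ∑ i ∈ J, k t i ^ 2 ≤ ∑ i ∈ J, κ * k t i := Finset.sum_le_sum fun i hi => by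
        rw [sq]; exact mul_le_mul_of_nonneg_right (hk.le t ht i hi) (hk.nonneg t ht i hi)
    _ = κ := by rw [← Finset.mul_sum, hk.sum_eq_one t ht, mul_one]

section
variable {Ω : Type*} [mΩ : MeasurableSpace Ω] {P : Measure Ω} [IsProbabilityMeasure P]
  {ξ : ℤ → Ω → ℝ} {w : ℤ → ℝ} {W κ β : ℝ} {k : ℤ → ℤ → ℝ} {S J : Finset ℤ} {f : ℝ → ℝ}

lemma IsIID.memLp_smoothingError (hξ : IsIID P ξ) (hf : Measurable f)
    (hf2 : MemLp (fun ω => f (ξ 0 ω)) 2 P) (t : ℤ) :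
    MemLp (smoothingError w f ξ k J t) 2 P := by
  have h : MemLp (fun ω => ∑ i ∈ J, (k t i * w i) * f (ξ i ω)) 2 P :=
    memLp_finsetSum _ fun i _ => (hξ.memLp_comp hf hf2 i).const_mul _
  exact (memLp_const (w t - ∑ i ∈ J, k t i * w i)).sub h

lemma IsIID.integral_smoothingError_sq_le (hξ : IsIID P ξ) (hf : Measurable f)
    (hf2 : MemLp (fun ω => f (ξ 0 ω)) 2 P) (hf0 : ∫ ω, f (ξ 0 ω) ∂P = 0)
    (hw : ∀ t, |w t| ≤ W) (hk : IsSmoothing w k S J κ β) {t : ℤ} (ht : t ∈ S) :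
    ∫ ω, smoothingError w f ξ k J t ω ^ 2 ∂P
      ≤ 2 * β ^ 2 + 2 * ((∫ ω, f (ξ 0 ω) ^ 2 ∂P) * (W ^ 2 * κ)) := by
  have h : MemLp (fun ω => ∑ i ∈ J, (k t i * w i) * f (ξ i ω)) 2 P :=
    memLp_finsetSum _ fun i _ => (hξ.memLp_comp hf hf2 i).const_mul _
  have hlin := hξ.linear_form J (fun i => i) (fun _ _ _ _ h => h) (fun i => k t i * w i) hf hf2 hf0
  have hV : 0 ≤ ∫ ω, f (ξ 0 ω) ^ 2 ∂P := integral_nonneg fun _ => sq_nonneg _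
  have hA : ∑ i ∈ J, (k t i * w i) ^ 2 ≤ W ^ 2 * κ := by
    calc _ ≤ ∑ i ∈ J, W ^ 2 * k t i ^ 2 := Finset.sum_le_sum fun i _ => by
          rw [mul_pow, mul_comm]
          exact mul_le_mul_of_nonneg_right
            (sq_le_sq' (abs_le.1 (hw i)).1 (abs_le.1 (hw i)).2) (sq_nonneg _)
      _ ≤ _ := by
          rw [← Finset.mul_sum]
          exact mul_le_mul_of_nonneg_left (hk.sum_sq_le ht) (sq_nonneg _)
  have hb := sq_le_sq' (abs_le.1 (hk.bias t ht)).1 (abs_le.1 (hk.bias t ht)).2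
  calc _ ≤ ∫ ω, 2 * β ^ 2 + 2 * (∑ i ∈ J, (k t i * w i) * f (ξ i ω)) ^ 2 ∂P := by
        refine integral_mono (hξ.memLp_smoothingError hf hf2 t).integrable_sq
          ((integrable_const _).add (h.integrable_sq.const_mul _)) fun ω => ?_
        simp only [smoothingError]
        nlinarith [sq_nonneg ((w t - ∑ i ∈ J, k t i * w i)
          + ∑ i ∈ J, (k t i * w i) * f (ξ i ω))]
    _ = 2 * β ^ 2 + 2 * ∫ ω, (∑ i ∈ J, (k t i * w i) * f (ξ i ω)) ^ 2 ∂P := by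
        rw [integral_add (integrable_const _) (h.integrable_sq.const_mul _)]
        simp [integral_const_mul]
    _ ≤ _ := by
        rw [hlin]
        gcongr

/-- The correlation of the noise with the smoothing error is a linear form, of the size of the bias,
plus a quadratic form whose coefficients are the smoothing weights. -/
lemma IsIID.integral_abs_sum_mul_smoothingError_le (hξ : IsIID P ξ) (hf : Measurable f)
    (hf2 : MemLp (fun ω => f (ξ 0 ω)) 2 P) (hf0 : ∫ ω, f (ξ 0 ω) ∂P = 0)
    (hw : ∀ t, |w t| ≤ W) (hκ : 0 ≤ κ) (hβ : 0 ≤ β) (hk : IsSmoothing w k S J κ β)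
    (I : Finset ℤ) {T : ℕ} (hI : I.card ≤ T) (a b : ℤ) (hb : ∀ t ∈ I, t + b ∈ S) :
    ∫ ω, |∑ t ∈ I, (w (t + a) * f (ξ (t + a) ω)) * smoothingError w f ξ k J (t + b) ω| ∂P
      ≤ √(∫ ω, f (ξ 0 ω) ^ 2 ∂P) * (W * β * √T)
        + (∫ ω, f (ξ 0 ω) ^ 2 ∂P) * (W ^ 2 * (T * κ + 2 * √(T * κ))) := by
  set V := ∫ ω, f (ξ 0 ω) ^ 2 ∂P with hV
  have hV0 : 0 ≤ V := integral_nonneg fun _ => sq_nonneg _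
  have hW0 : 0 ≤ W := (abs_nonneg _).trans (hw 0)
  have hcard : (I.card : ℝ) ≤ T := by exact_mod_cast hI
  set bias : ℤ → ℝ := fun t => w t - ∑ i ∈ J, k t i * w i with hbias
  set A : ℤ → ℤ → ℝ := fun s i => w s * (k (s + (b - a)) i * w i) with hA
  have hinj : InjOn (fun t : ℤ => t + a) (I : Set ℤ) := fun _ _ _ _ h => by simpa using h
  set I' := I.map (addRightEmbedding a) with hI'
  have hcard' : (I'.card : ℝ) ≤ T := by rw [hI', Finset.card_map]; exact hcard
  have hmem' : ∀ s ∈ I', s + (b - a) ∈ S := by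
    intro s hs
    simp only [hI', Finset.mem_map, addRightEmbedding_apply] at hs
    obtain ⟨t, ht, rfl⟩ := hs
    have := hb t ht
    rwa [show t + a + (b - a) = t + b by ring]
  have hdec : ∀ ω, ∑ t ∈ I, (w (t + a) * f (ξ (t + a) ω)) * smoothingError w f ξ k J (t + b) ω
      = ∑ t ∈ I, (w (t + a) * bias (t + b)) * f (ξ (t + a) ω)
        - ∑ s ∈ I', ∑ i ∈ J, A s i * (f (ξ s ω) * f (ξ i ω)) := by
    intro ω
    rw [hI', Finset.sum_map, ← Finset.sum_sub_distrib]
    refine Finset.sum_congr rfl fun t _ => ?_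
    simp only [smoothingError, hbias, hA, addRightEmbedding_apply]
    rw [show t + a + (b - a) = t + b by ring, mul_sub, Finset.mul_sum (s := J)]
    congr 1
    · ring
    · exact Finset.sum_congr rfl fun i _ => by ring
  have hW2 : ∀ s i, |w s| * |w i| ≤ W ^ 2 := fun s i => by
    rw [sq]; exact mul_le_mul (hw s) (hw i) (abs_nonneg _) hW0
  have hlm : MemLp (fun ω => ∑ t ∈ I, (w (t + a) * bias (t + b)) * f (ξ (t + a) ω)) 2 P :=
    memLp_finsetSum _ fun t _ => (hξ.memLp_comp hf hf2 _).const_mul _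
  have hff : ∀ s i, Integrable (fun ω => f (ξ s ω) * f (ξ i ω)) P := fun s i =>
    (hξ.memLp_comp hf hf2 s).integrable_mul (hξ.memLp_comp hf hf2 i)
  have hli : Integrable (fun ω => ∑ t ∈ I, (w (t + a) * bias (t + b)) * f (ξ (t + a) ω)) P :=
    hlm.integrable (by norm_num)
  have hqi : Integrable (fun ω => ∑ s ∈ I', ∑ i ∈ J, A s i * (f (ξ s ω) * f (ξ i ω))) P :=
    integrable_finsetSum _ fun s _ => integrable_finsetSum _ fun i _ => (hff s i).const_mul _
  have hlin : ∫ ω, |∑ t ∈ I, (w (t + a) * bias (t + b)) * f (ξ (t + a) ω)| ∂P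
      ≤ √V * (W * β * √T) := by
    refine (integral_abs_le_sqrt hlm).trans ?_
    rw [hξ.linear_form I (fun t => t + a) hinj (fun t => w (t + a) * bias (t + b)) hf hf2 hf0,
      Real.sqrt_mul hV0]
    refine mul_le_mul_of_nonneg_left ?_ (Real.sqrt_nonneg _)
    have h1 : ∑ t ∈ I, (w (t + a) * bias (t + b)) ^ 2 ≤ (W * β) ^ 2 * T := by
      refine (Finset.sum_le_card_nsmul _ _ ((W * β) ^ 2) fun t ht => ?_).trans ?_
      · rw [← sq_abs, abs_mul]
        exact pow_le_pow_left₀ (by positivity)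
          (mul_le_mul (hw _) (hk.bias _ (hb t ht)) (abs_nonneg _) hW0) 2
      · rw [nsmul_eq_mul, mul_comm]
        exact mul_le_mul_of_nonneg_left hcard (sq_nonneg _)
    refine (Real.sqrt_le_sqrt h1).trans (le_of_eq ?_)
    rw [Real.sqrt_mul (sq_nonneg _), Real.sqrt_sq (by positivity)]
  have hquad : ∫ ω, |∑ s ∈ I', ∑ i ∈ J, A s i * (f (ξ s ω) * f (ξ i ω))| ∂P
      ≤ V * (W ^ 2 * (T * κ + 2 * √(T * κ))) := by
    refine (hξ.integral_abs_quadratic_form_le I' J A hf hf2 hf0).trans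
      (mul_le_mul_of_nonneg_left ?_ hV0)
    have h1 : ∑ t ∈ I' with t ∈ J, |A t t| ≤ T * (W ^ 2 * κ) := by
      refine (Finset.sum_le_card_nsmul _ _ (W ^ 2 * κ) fun t ht => ?_).trans ?_
      · obtain ⟨ht1, ht2⟩ := Finset.mem_filter.1 ht
        rw [hA, abs_mul, abs_mul, abs_of_nonneg (hk.nonneg _ (hmem' t ht1) t ht2)]
        calc |w t| * (k (t + (b - a)) t * |w t|) = (|w t| * |w t|) * k (t + (b - a)) t := by ring
          _ ≤ W ^ 2 * κ := mul_le_mul (hW2 t t) (hk.le _ (hmem' t ht1) t ht2)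
              (hk.nonneg _ (hmem' t ht1) t ht2) (sq_nonneg _)
      · rw [nsmul_eq_mul]
        refine mul_le_mul_of_nonneg_right (le_trans ?_ hcard') (by positivity)
        exact_mod_cast Finset.card_filter_le _ _
    have h2 : ∑ t ∈ I', ∑ s ∈ J, A t s ^ 2 ≤ (W ^ 2) ^ 2 * (T * κ) := by
      refine (Finset.sum_le_card_nsmul _ _ ((W ^ 2) ^ 2 * κ) fun t ht => ?_).trans ?_
      · calc ∑ s ∈ J, A t s ^ 2 ≤ ∑ s ∈ J, (W ^ 2) ^ 2 * k (t + (b - a)) s ^ 2 := by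
              refine Finset.sum_le_sum fun s _ => ?_
              rw [hA, show (w t * (k (t + (b - a)) s * w s)) ^ 2
                = (|w t| * |w s|) ^ 2 * k (t + (b - a)) s ^ 2 by
                  rw [mul_pow |w t|, sq_abs, sq_abs]; ring]
              exact mul_le_mul_of_nonneg_right
                (pow_le_pow_left₀ (by positivity) (hW2 t s) 2) (sq_nonneg _)
          _ ≤ _ := by
              rw [← Finset.mul_sum]
              exact mul_le_mul_of_nonneg_left (hk.sum_sq_le (hmem' t ht)) (by positivity)
      · rw [nsmul_eq_mul]
        calc _ ≤ (T : ℝ) * ((W ^ 2) ^ 2 * κ) := by gcongr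
          _ = _ := by ring
    have h3 : √(∑ t ∈ I', ∑ s ∈ J, A t s ^ 2) ≤ W ^ 2 * √(T * κ) := by
      refine (Real.sqrt_le_sqrt h2).trans (le_of_eq ?_)
      rw [Real.sqrt_mul (sq_nonneg _), Real.sqrt_sq (by positivity)]
    linarith
  simp_rw [hdec]
  calc _ ≤ ∫ ω, |∑ t ∈ I, (w (t + a) * bias (t + b)) * f (ξ (t + a) ω)|
        + |∑ s ∈ I', ∑ i ∈ J, A s i * (f (ξ s ω) * f (ξ i ω))| ∂P :=
        integral_mono (hli.sub hqi).abs (hli.abs.add hqi.abs) fun ω => abs_sub _ _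
    _ ≤ _ := by
        rw [integral_add hli.abs hqi.abs]
        exact add_le_add hlin hquad

/-- Smoothing has a negligible effect on the sample autocovariances: a bound on the mean absolute
error, explicit in the sample size, in the bandwidth through `κ`, and in the bias `β`. -/
lemma IsIID.integral_abs_sum_centred_sub_le (hξ : IsIID P ξ) (hf : Measurable f)
    (hf2 : MemLp (fun ω => f (ξ 0 ω)) 2 P) (hf0 : ∫ ω, f (ξ 0 ω) ∂P = 0)
    (hw : ∀ t, |w t| ≤ W) (hκ : 0 ≤ κ) (hβ : 0 ≤ β) (hk : IsSmoothing w k S J κ β)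
    (I : Finset ℤ) {T : ℕ} (hI : I.card ≤ T) (a b : ℤ) (ha : ∀ t ∈ I, t + a ∈ S)
    (hb : ∀ t ∈ I, t + b ∈ S) :
    ∫ ω, |∑ t ∈ I, ((w (t + a) * f (ξ (t + a) ω) + smoothingError w f ξ k J (t + a) ω)
        * (w (t + b) * f (ξ (t + b) ω) + smoothingError w f ξ k J (t + b) ω)
        - (w (t + a) * f (ξ (t + a) ω)) * (w (t + b) * f (ξ (t + b) ω)))| ∂P
      ≤ 2 * (√(∫ ω, f (ξ 0 ω) ^ 2 ∂P) * (W * β * √T)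
        + (∫ ω, f (ξ 0 ω) ^ 2 ∂P) * (W ^ 2 * (T * κ + 2 * √(T * κ))))
        + T * (2 * β ^ 2 + 2 * ((∫ ω, f (ξ 0 ω) ^ 2 ∂P) * (W ^ 2 * κ))) := by
  set r : ℤ → Ω → ℝ := fun t ω => smoothingError w f ξ k J t ω with hr
  have hr2 : ∀ t, MemLp (r t) 2 P := fun t => hξ.memLp_smoothingError hf hf2 t
  have hη2 : ∀ t, MemLp (fun ω => w t * f (ξ t ω)) 2 P := fun t =>
    (hξ.memLp_comp hf hf2 t).const_mul _
  have h1 := hξ.integral_abs_sum_mul_smoothingError_le hf hf2 hf0 hw hκ hβ hk I hI a b hb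
  have h2 := hξ.integral_abs_sum_mul_smoothingError_le hf hf2 hf0 hw hκ hβ hk I hI b a ha
  set e := 2 * β ^ 2 + 2 * ((∫ ω, f (ξ 0 ω) ^ 2 ∂P) * (W ^ 2 * κ)) with he
  have hV0 : 0 ≤ ∫ ω, f (ξ 0 ω) ^ 2 ∂P := integral_nonneg fun _ => sq_nonneg _
  have he0 : 0 ≤ e := by positivity
  have hi1 : Integrable (fun ω => ∑ t ∈ I, (w (t + a) * f (ξ (t + a) ω)) * r (t + b) ω) P :=
    integrable_finsetSum _ fun t _ => (hη2 _).integrable_mul (hr2 _)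
  have hi2 : Integrable (fun ω => ∑ t ∈ I, (w (t + b) * f (ξ (t + b) ω)) * r (t + a) ω) P :=
    integrable_finsetSum _ fun t _ => (hη2 _).integrable_mul (hr2 _)
  have hi3' : ∀ t, Integrable (fun ω => r (t + a) ω * r (t + b) ω) P := fun t =>
    (hr2 _).integrable_mul (hr2 _)
  have hi3 : Integrable (fun ω => ∑ t ∈ I, r (t + a) ω * r (t + b) ω) P :=
    integrable_finsetSum _ fun t _ => hi3' t
  have hsq : ∀ t, Integrable (fun ω => r (t + a) ω ^ 2 / 2 + r (t + b) ω ^ 2 / 2) P := fun t =>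
    ((hr2 _).integrable_sq.div_const 2).add ((hr2 _).integrable_sq.div_const 2)
  have h3 : ∫ ω, |∑ t ∈ I, r (t + a) ω * r (t + b) ω| ∂P ≤ T * e := by
    calc _ ≤ ∫ ω, ∑ t ∈ I, (r (t + a) ω ^ 2 / 2 + r (t + b) ω ^ 2 / 2) ∂P := by
          refine integral_mono hi3.abs (integrable_finsetSum _ fun t _ => hsq t)
            fun ω => (Finset.abs_sum_le_sum_abs _ _).trans (Finset.sum_le_sum fun t _ => ?_)
          rw [abs_le]
          constructor <;> nlinarith [sq_nonneg (r (t + a) ω + r (t + b) ω),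
            sq_nonneg (r (t + a) ω - r (t + b) ω)]
      _ = ∑ t ∈ I, ((∫ ω, r (t + a) ω ^ 2 ∂P) / 2 + (∫ ω, r (t + b) ω ^ 2 ∂P) / 2) := by
          rw [integral_finsetSum _ fun t _ => hsq t]
          refine Finset.sum_congr rfl fun t _ => ?_
          rw [integral_add ((hr2 _).integrable_sq.div_const 2)
            ((hr2 _).integrable_sq.div_const 2), integral_div, integral_div]
      _ ≤ ∑ t ∈ I, e := by
          refine Finset.sum_le_sum fun t ht => ?_
          have h4 := hξ.integral_smoothingError_sq_le hf hf2 hf0 hw hk (ha t ht)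
          have h5 := hξ.integral_smoothingError_sq_le hf hf2 hf0 hw hk (hb t ht)
          simp only [hr]
          linarith
      _ ≤ T * e := by
          rw [Finset.sum_const, nsmul_eq_mul]
          exact mul_le_mul_of_nonneg_right (by exact_mod_cast hI) he0
  have hdec : ∀ ω, ∑ t ∈ I, ((w (t + a) * f (ξ (t + a) ω) + r (t + a) ω)
        * (w (t + b) * f (ξ (t + b) ω) + r (t + b) ω)
        - (w (t + a) * f (ξ (t + a) ω)) * (w (t + b) * f (ξ (t + b) ω)))
      = ∑ t ∈ I, (w (t + a) * f (ξ (t + a) ω)) * r (t + b) ω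
        + ∑ t ∈ I, (w (t + b) * f (ξ (t + b) ω)) * r (t + a) ω
        + ∑ t ∈ I, r (t + a) ω * r (t + b) ω := by
    intro ω
    rw [← Finset.sum_add_distrib, ← Finset.sum_add_distrib]
    exact Finset.sum_congr rfl fun t _ => by ring
  simp only [hr] at hdec
  simp_rw [hdec]
  calc _ ≤ ∫ ω, |∑ t ∈ I, (w (t + a) * f (ξ (t + a) ω)) * r (t + b) ω|
        + |∑ t ∈ I, (w (t + b) * f (ξ (t + b) ω)) * r (t + a) ω|
        + |∑ t ∈ I, r (t + a) ω * r (t + b) ω| ∂P :=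
        integral_mono ((hi1.add hi2).add hi3).abs ((hi1.abs.add hi2.abs).add hi3.abs)
          fun ω => (abs_add_le _ _).trans (add_le_add_left (abs_add_le _ _) _)
    _ ≤ _ := by
        rw [integral_add_add hi1.abs hi2.abs hi3.abs]
        linarith

/-- Lagged products of centred i.i.d. variables average out. -/
lemma IsIID.integral_abs_sum_lagged_product_le (hξ : IsIID P ξ) (hf : Measurable f)
    (hf2 : MemLp (fun ω => f (ξ 0 ω)) 2 P) (hf0 : ∫ ω, f (ξ 0 ω) ∂P = 0)
    (hw : ∀ t, |w t| ≤ W) (I : Finset ℤ) {T : ℕ} (hI : I.card ≤ T) {a b : ℤ} (hab : a ≠ b) :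
    ∫ ω, |∑ t ∈ I, (w (t + a) * f (ξ (t + a) ω)) * (w (t + b) * f (ξ (t + b) ω))| ∂P
      ≤ (∫ ω, f (ξ 0 ω) ^ 2 ∂P) * (2 * (W ^ 2 * √T)) := by
  have hW0 : 0 ≤ W := (abs_nonneg _).trans (hw 0)
  set A : ℤ → ℤ → ℝ := fun s i => if i = s + (b - a) then w s * w i else 0 with hA
  have hI' : ∀ s ∈ I.map (addRightEmbedding a), s + (b - a) ∈ I.map (addRightEmbedding b) := by
    intro s hs
    simp only [Finset.mem_map, addRightEmbedding_apply] at hs ⊢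
    obtain ⟨t, ht, rfl⟩ := hs
    exact ⟨t, ht, by ring⟩
  have heq : ∀ ω, ∑ t ∈ I, (w (t + a) * f (ξ (t + a) ω)) * (w (t + b) * f (ξ (t + b) ω))
      = ∑ s ∈ I.map (addRightEmbedding a), ∑ i ∈ I.map (addRightEmbedding b),
        A s i * (f (ξ s ω) * f (ξ i ω)) := by
    intro ω
    have h1 : ∀ s ∈ I.map (addRightEmbedding a), ∑ i ∈ I.map (addRightEmbedding b),
        A s i * (f (ξ s ω) * f (ξ i ω))
        = w s * w (s + (b - a)) * (f (ξ s ω) * f (ξ (s + (b - a)) ω)) := by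
      intro s hs
      simp only [hA, ite_mul, zero_mul]
      rw [Finset.sum_ite_eq', if_pos (hI' s hs)]
    rw [Finset.sum_congr rfl h1, Finset.sum_map]
    refine Finset.sum_congr rfl fun t _ => ?_
    simp only [addRightEmbedding_apply]
    rw [show t + a + (b - a) = t + b by ring]; ring
  simp_rw [heq]
  refine (hξ.integral_abs_quadratic_form_le _ _ A hf hf2 hf0).trans
    (mul_le_mul_of_nonneg_left ?_ (integral_nonneg fun _ => sq_nonneg _))
  have h1 : ∀ t, |A t t| = 0 := fun t => by
    have : t ≠ t + (b - a) := fun h => hab (by omega)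
    simp [hA, this]
  have h2 : ∑ t ∈ I.map (addRightEmbedding a), ∑ s ∈ I.map (addRightEmbedding b), A t s ^ 2
      ≤ (W ^ 2) ^ 2 * T := by
    refine (Finset.sum_le_card_nsmul _ _ ((W ^ 2) ^ 2) fun t ht => ?_).trans ?_
    · simp only [hA, ite_pow]
      rw [zero_pow two_ne_zero, Finset.sum_ite_eq', if_pos (hI' t ht), ← sq_abs, abs_mul]
      refine pow_le_pow_left₀ (by positivity) ?_ 2
      rw [sq]
      exact mul_le_mul (hw _) (hw _) (abs_nonneg _) hW0
    · rw [Finset.card_map, nsmul_eq_mul, mul_comm]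
      exact mul_le_mul_of_nonneg_left (by exact_mod_cast hI) (by positivity)
  have h3 := Real.sqrt_le_sqrt h2
  rw [Real.sqrt_mul (sq_nonneg _), Real.sqrt_sq (by positivity)] at h3
  simp only [h1, Finset.sum_const_zero, zero_add]
  linarith

end

/-! ### Kernel weights, normal equations and perturbed linear systems -/

lemma IsSmoothingKernel.eq_zero_of_one_lt_abs {K : ℝ → ℝ} (hK : IsSmoothingKernel K) {x : ℝ}
    (hx : 1 < |x|) : K x = 0 := by
  refine image_eq_zero_of_notMem_tsupport fun h => ?_
  rw [hK.support] at h
  exact absurd (abs_le.2 h) (not_le.2 hx)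

lemma IsSmoothingKernel.continuousOn {K : ℝ → ℝ} (hK : IsSmoothingKernel K) :
    ContinuousOn K (Icc (-1) 1) := by
  have := hK.absolutelyContinuous.continuousOn
  rwa [uIcc_of_le (by norm_num)] at this

lemma IsSmoothingKernel.exists_bound {K : ℝ → ℝ} (hK : IsSmoothingKernel K) :
    ∃ M, 0 < M ∧ ∀ x, K x ≤ M := by
  obtain ⟨M, hM⟩ := isCompact_Icc.exists_bound_of_continuousOn hK.continuousOn
  refine ⟨max M 1, lt_max_of_lt_right one_pos, fun x => ?_⟩
  by_cases hx : x ∈ Icc (-1 : ℝ) 1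
  · exact (le_abs_self _).trans ((hM x hx).trans (le_max_left _ _))
  · rw [hK.eq_zero_of_one_lt_abs (by rw [← not_le, abs_le]; exact hx)]
    exact le_max_of_le_right zero_le_one

/-- In every subinterval of its support the kernel is bounded below on a nondegenerate interval. -/
lemma IsSmoothingKernel.exists_lower_bound {K : ℝ → ℝ} (hK : IsSmoothingKernel K) {l r : ℝ}
    (hlr : l < r) (hl : -1 ≤ l) (hr : r ≤ 1) :
    ∃ s₁ s₂ κ : ℝ, l < s₁ ∧ s₁ < s₂ ∧ s₂ < r ∧ 0 < κ ∧ ∀ x ∈ Icc s₁ s₂, κ ≤ K x := by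
  have hmid : (l + r) / 2 ∈ closure (Function.support K) := by
    change (l + r) / 2 ∈ tsupport K
    rw [hK.support]; constructor <;> linarith
  obtain ⟨x, hx, hxs⟩ := mem_closure_iff.1 hmid (Ioo l r) isOpen_Ioo ⟨by linarith, by linarith⟩
  have hpos : 0 < K x := lt_of_le_of_ne (hK.nonneg x) (Ne.symm hxs)
  have hcont : ContinuousAt K x := hK.continuousOn.continuousAt
    (Icc_mem_nhds (by linarith [hx.1]) (by linarith [hx.2]))
  have hev : ∀ᶠ y in 𝓝 x, K x / 2 < K y := hcont.eventually_const_lt (by linarith)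
  obtain ⟨ε, hε, hball⟩ := Metric.eventually_nhds_iff.1 hev
  refine ⟨x - min (ε / 2) ((x - l) / 2), x + min (ε / 2) ((r - x) / 2), K x / 2, ?_, ?_, ?_,
    by linarith, fun y hy => (hball ?_).le⟩
  · have := min_le_right (ε / 2) ((x - l) / 2); linarith [hx.1]
  · have h1 : 0 < min (ε / 2) ((x - l) / 2) := lt_min (by linarith) (by linarith [hx.1])
    have h2 : 0 < min (ε / 2) ((r - x) / 2) := lt_min (by linarith) (by linarith [hx.2])
    linarith
  · have := min_le_right (ε / 2) ((r - x) / 2); linarith [hx.2]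
  · rw [Real.dist_eq, abs_lt]
    have h1 := min_le_left (ε / 2) ((x - l) / 2)
    have h2 := min_le_left (ε / 2) ((r - x) / 2)
    constructor <;> linarith [hy.1, hy.2]

/-- If the kernel is at least `κ` on `[s₁, s₂]`, the points of the grid in the corresponding window
give a lower bound for the normalizing sum. -/
lemma le_sum_kernel {K : ℝ → ℝ} (hK : ∀ x, 0 ≤ K x) {s₁ s₂ κ N : ℝ} (hκ : 0 ≤ κ) (hN : 0 < N)
    (hlow : ∀ x ∈ Icc s₁ s₂, κ ≤ K x) {p T : ℕ} {t : ℤ} (h1 : (p : ℝ) + 1 ≤ t - s₂ * N)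
    (h2 : t - s₁ * N ≤ T) :
    κ * ((s₂ - s₁) * N - 1) ≤ ∑ l ∈ Finset.Icc ((p : ℤ) + 1) T, K (((t : ℝ) - l) / N) := by
  set A := (t : ℝ) - s₂ * N with hA
  set B := (t : ℝ) - s₁ * N with hB
  have hsub : Finset.Icc ⌈A⌉ ⌊B⌋ ⊆ Finset.Icc ((p : ℤ) + 1) T := by
    intro l hl
    simp only [Finset.mem_Icc, Int.ceil_le, Int.le_floor] at hl ⊢
    constructor
    · have : ((p : ℝ) + 1) ≤ l := h1.trans hl.1
      exact_mod_cast this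
    · have : (l : ℝ) ≤ T := hl.2.trans h2
      exact_mod_cast this
  have hcard : (s₂ - s₁) * N - 1 ≤ ((Finset.Icc ⌈A⌉ ⌊B⌋).card : ℝ) := by
    rw [Int.card_Icc]
    have h3 : ((⌊B⌋ + 1 - ⌈A⌉ : ℤ) : ℝ) ≤ ((⌊B⌋ + 1 - ⌈A⌉).toNat : ℝ) := by
      exact_mod_cast Int.self_le_toNat _
    have h4 := Int.lt_floor_add_one B
    have h5 := Int.ceil_lt_add_one A
    push_cast at h3
    have h6 : (s₂ - s₁) * N = B - A := by rw [hA, hB]; ring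
    linarith
  calc κ * ((s₂ - s₁) * N - 1) ≤ κ * ((Finset.Icc ⌈A⌉ ⌊B⌋).card : ℝ) :=
        mul_le_mul_of_nonneg_left hcard hκ
    _ = ∑ l ∈ Finset.Icc ⌈A⌉ ⌊B⌋, κ := by rw [Finset.sum_const, nsmul_eq_mul, mul_comm]
    _ ≤ ∑ l ∈ Finset.Icc ⌈A⌉ ⌊B⌋, K (((t : ℝ) - l) / N) := by
        refine Finset.sum_le_sum fun l hl => hlow _ ?_
        simp only [Finset.mem_Icc, Int.ceil_le, Int.le_floor] at hl
        rw [mem_Icc, le_div_iff₀ hN, div_le_iff₀ hN]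
        constructor <;> linarith [hl.1, hl.2]
    _ ≤ _ := Finset.sum_le_sum_of_subset_of_nonneg hsub fun _ _ _ => hK _

/-- The normalizing sums of the kernel weights are of the order of the number `T b` of observations
in a window, uniformly up to the boundary. -/
lemma IsSmoothingKernel.exists_le_sum {K : ℝ → ℝ} (hK : IsSmoothingKernel K) (p : ℕ) {b : ℕ → ℝ}
    (hb0 : Tendsto b atTop (𝓝 0)) (hTb : Tendsto (fun T : ℕ => T * b T) atTop atTop) :
    ∃ κ > 0, ∀ᶠ T : ℕ in atTop, ∀ t ∈ Finset.Icc (1 : ℤ) T,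
      κ * (T * b T) ≤ ∑ l ∈ Finset.Icc ((p : ℤ) + 1) T, K (((t : ℝ) - l) / (T * b T)) := by
  obtain ⟨s₁, s₂, κ, h1, h2, h3, hκ, hlow⟩ :=
    hK.exists_lower_bound (l := 0) (r := 1) zero_lt_one (by norm_num) le_rfl
  obtain ⟨s₁', s₂', κ', h1', h2', h3', hκ', hlow'⟩ :=
    hK.exists_lower_bound (l := -1) (r := 0) (by norm_num) le_rfl (by norm_num)
  refine ⟨min (κ * (s₂ - s₁) / 2) (κ' * (s₂' - s₁') / 2),
    lt_min (by have := sub_pos.2 h2; positivity) (by have := sub_pos.2 h2'; positivity), ?_⟩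
  filter_upwards [hb0.eventually_le_const (show (0 : ℝ) < 1 / 4 by norm_num),
    hTb.eventually_ge_atTop (2 / (s₂ - s₁)), hTb.eventually_ge_atTop (2 / (s₂' - s₁')),
    hTb.eventually_ge_atTop ((p + 1) / (-s₂')), eventually_ge_atTop (4 * (p + 1))]
    with T hb hN hN' hNp hTp t ht
  simp only [Finset.mem_Icc] at ht
  have hT : (4 : ℝ) * (p + 1) ≤ T := by exact_mod_cast hTp
  have hp : (0 : ℝ) ≤ p := Nat.cast_nonneg p
  set N := T * b T with hNdef
  have hs := sub_pos.2 h2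
  have hs' := sub_pos.2 h2'
  have hN0 : 0 < N := lt_of_lt_of_le (by positivity) hN
  have hNT : N ≤ T / 4 := by rw [hNdef]; nlinarith
  rw [div_le_iff₀ hs] at hN
  rw [div_le_iff₀ hs'] at hN'
  rw [div_le_iff₀ (by linarith)] at hNp
  have ht1 : (1 : ℝ) ≤ t := by exact_mod_cast ht.1
  have ht2 : (t : ℝ) ≤ T := by exact_mod_cast ht.2
  -- the half of the window on the side away from the closer boundary lies inside the sample
  rcases le_total ((T : ℝ) / 2) t with hhalf | hhalf
  · refine le_trans ?_ (le_sum_kernel hK.nonneg hκ.le hN0 hlow (by nlinarith) (by nlinarith))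
    refine (mul_le_mul_of_nonneg_right (min_le_left _ _) hN0.le).trans ?_
    rw [show κ * (s₂ - s₁) / 2 * N = κ * ((s₂ - s₁) * N / 2) by ring]
    exact mul_le_mul_of_nonneg_left (by linarith) hκ.le
  · refine le_trans ?_ (le_sum_kernel hK.nonneg hκ'.le hN0 hlow' (by nlinarith) (by nlinarith))
    refine (mul_le_mul_of_nonneg_right (min_le_right _ _) hN0.le).trans ?_
    rw [show κ' * (s₂' - s₁') / 2 * N = κ' * ((s₂' - s₁') * N / 2) by ring]
    exact mul_le_mul_of_nonneg_left (by linarith) hκ'.le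

/-- The kernel weights are smoothing weights with `κ = O(1/(Tb))` and bias `O(b)`. -/
lemma IsSmoothingKernel.exists_isSmoothing {K : ℝ → ℝ} (hK : IsSmoothingKernel K) (p : ℕ)
    {α : ℝ → ℝ} {L : ℝ} (hL : ∀ x y, |α x - α y| ≤ L * |x - y|) {b : ℕ → ℝ}
    (hb0 : Tendsto b atTop (𝓝 0)) (hTb : Tendsto (fun T : ℕ => T * b T) atTop atTop) :
    ∃ κ > 0, ∀ᶠ T : ℕ in atTop, IsSmoothing (fun t : ℤ => α (t / T)) (kernelWeight K p T (b T))
      (Finset.Icc 1 T) (Finset.Icc ((p : ℤ) + 1) T) (κ / (T * b T)) (L * b T) := by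
  obtain ⟨M, hM0, hM⟩ := hK.exists_bound
  obtain ⟨κ, hκ, hev⟩ := hK.exists_le_sum p hb0 hTb
  have hL0 : 0 ≤ L := by simpa using (abs_nonneg _).trans (hL 0 1)
  refine ⟨M / κ, by positivity, ?_⟩
  filter_upwards [hev, hTb.eventually_gt_atTop 0, eventually_gt_atTop 0] with T hT hN hT0
  have hT0' : (0 : ℝ) < T := by exact_mod_cast hT0
  set N := T * b T with hNdef
  have hpos : ∀ t ∈ Finset.Icc (1 : ℤ) T,
      0 < ∑ l ∈ Finset.Icc ((p : ℤ) + 1) T, K (((t : ℝ) - l) / N) := fun t ht =>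
    lt_of_lt_of_le (by positivity) (hT t ht)
  have hnn : ∀ t ∈ Finset.Icc (1 : ℤ) T, ∀ i, 0 ≤ kernelWeight K p T (b T) t i := fun t ht i =>
    div_nonneg (hK.nonneg _) (hpos t ht).le
  have hsum : ∀ t ∈ Finset.Icc (1 : ℤ) T,
      ∑ i ∈ Finset.Icc ((p : ℤ) + 1) T, kernelWeight K p T (b T) t i = 1 := fun t ht => by
    simp only [kernelWeight]
    rw [← Finset.sum_div]
    exact div_self (hpos t ht).ne'
  refine ⟨fun t ht i _ => hnn t ht i, fun t ht i _ => ?_, hsum, fun t ht => ?_⟩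
  · calc kernelWeight K p T (b T) t i ≤ M / (κ * N) :=
          div_le_div₀ hM0.le (hM _) (by positivity) (hT t ht)
      _ = M / κ / N := by rw [div_div]
  · have h1 : α (t / T) - ∑ i ∈ Finset.Icc ((p : ℤ) + 1) T,
        kernelWeight K p T (b T) t i * α (i / T)
        = ∑ i ∈ Finset.Icc ((p : ℤ) + 1) T,
          kernelWeight K p T (b T) t i * (α (t / T) - α (i / T)) := by
      simp only [mul_sub, Finset.sum_sub_distrib, ← Finset.sum_mul, hsum t ht, one_mul]
    rw [h1]
    calc _ ≤ ∑ i ∈ Finset.Icc ((p : ℤ) + 1) T, kernelWeight K p T (b T) t i * (L * b T) := by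
          refine (Finset.abs_sum_le_sum_abs _ _).trans (Finset.sum_le_sum fun i _ => ?_)
          rw [abs_mul, abs_of_nonneg (hnn t ht i)]
          by_cases hfar : 1 < |((t : ℝ) - i) / N|
          · have h0 : kernelWeight K p T (b T) t i = 0 := by
              unfold kernelWeight
              rw [← hNdef, hK.eq_zero_of_one_lt_abs hfar, zero_div]
            rw [h0, zero_mul, zero_mul]
          · refine mul_le_mul_of_nonneg_left ((hL _ _).trans
              (mul_le_mul_of_nonneg_left ?_ hL0)) (hnn t ht i)
            rw [not_lt, abs_div, abs_of_pos hN, div_le_one hN] at hfar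
            rw [← sub_div, abs_div, abs_of_pos hT0', div_le_iff₀ hT0', mul_comm]
            exact hfar
      _ = L * b T := by rw [← Finset.sum_mul, hsum t ht, one_mul]

/-- The normal equations of a least-squares problem. -/
lemma normal_equations_of_isMinOn {ι : Type*} {p : ℕ} (s : Finset ι) (y : ι → ℝ)
    (x : ι → Fin p → ℝ) {α : Fin p → ℝ}
    (hmin : IsMinOn (fun α : Fin p → ℝ => ∑ t ∈ s, (y t - ∑ j, α j * x t j) ^ 2) univ α)
    (j : Fin p) : ∑ k, (∑ t ∈ s, x t j * x t k) * α k = ∑ t ∈ s, y t * x t j := by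
  set R : ι → ℝ := fun t => y t - ∑ j, α j * x t j with hR
  set A := ∑ t ∈ s, R t * x t j with hA
  set B := ∑ t ∈ s, x t j ^ 2 with hB
  have hB0 : 0 ≤ B := Finset.sum_nonneg fun _ _ => sq_nonneg _
  have key : ∀ c : ℝ, 0 ≤ c ^ 2 * B - 2 * c * A := by
    intro c
    have h := isMinOn_iff.1 hmin (α + (Pi.single j c : Fin p → ℝ)) (mem_univ _)
    have h2 : ∀ t, y t - ∑ i, (α + (Pi.single j c : Fin p → ℝ)) i * x t i = R t - c * x t j := by
      intro t
      simp only [Pi.add_apply, add_mul, Finset.sum_add_distrib, hR]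
      simp [Pi.single_apply, ite_mul]
      ring
    simp only [h2] at h
    have h3 : ∑ t ∈ s, (R t - c * x t j) ^ 2 = ∑ t ∈ s, R t ^ 2 + (c ^ 2 * B - 2 * c * A) := by
      rw [hA, hB, Finset.mul_sum, Finset.mul_sum, ← Finset.sum_sub_distrib,
        ← Finset.sum_add_distrib]
      exact Finset.sum_congr rfl fun t _ => by ring
    rw [h3] at h
    linarith
  have hA0 : A = 0 := by
    -- the minimizer `A / B` of the quadratic, shifted to avoid the division by zero
    have h := key (A / (B + 1))
    have hB1 : 0 < B + 1 := by linarith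
    have h1 : (A / (B + 1)) ^ 2 * B - 2 * (A / (B + 1)) * A
        = -(A ^ 2 * (B + 2) / (B + 1) ^ 2) := by
      field_simp; ring
    rw [h1] at h
    have h2 : A ^ 2 * (B + 2) / (B + 1) ^ 2 ≤ 0 := by linarith
    by_contra hne
    have : 0 < A ^ 2 * (B + 2) / (B + 1) ^ 2 := by positivity
    linarith
  have hexp : A = ∑ t ∈ s, y t * x t j - ∑ k, (∑ t ∈ s, x t j * x t k) * α k := by
    simp only [hA, hR, sub_mul, Finset.sum_sub_distrib, Finset.sum_mul]
    congr 1
    rw [Finset.sum_comm]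
    exact Finset.sum_congr rfl fun _ _ => Finset.sum_congr rfl fun _ _ => by ring
  linarith

/-- The solution `y` of a linear system with matrix `G` close to `γ` times the identity and
right-hand side `A` close to `S` is close to `γ⁻¹ S`.  No invertibility of `G` is assumed: the
smallness of the perturbation provides the a priori bound on `y`. -/
lemma sum_abs_sub_le_of_perturbed_system {ι : Type*} [Fintype ι] {γ : ℝ} (hγ : 0 < γ)
    (G : ι → ι → ℝ) [DecidableEq ι] (y A S : ι → ℝ) (hsys : ∀ j, ∑ k, G j k * y k = A j)
    (hsmall : ∑ j, ∑ k, |G j k - if j = k then γ else 0| ≤ γ / 2) :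
    ∑ j, |y j - γ⁻¹ * S j| ≤ 2 / γ * ∑ j, |A j - S j|
      + 2 / γ ^ 2 * (∑ j, ∑ k, |G j k - if j = k then γ else 0|) * ∑ j, |S j| := by
  set E : ι → ι → ℝ := fun j k => G j k - if j = k then γ else 0 with hE
  set e := ∑ j, ∑ k, |E j k| with he
  have he0 : 0 ≤ e := Finset.sum_nonneg fun _ _ => Finset.sum_nonneg fun _ _ => abs_nonneg _
  have hsys' : ∀ j, γ * y j - A j = -∑ k, E j k * y k := by
    intro j
    rw [← hsys j]
    simp only [hE, sub_mul, Finset.sum_sub_distrib, ite_mul, zero_mul, Finset.sum_ite_eq,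
      Finset.mem_univ, if_true]
    ring
  set n := ∑ j, |y j| with hn
  have hyn : ∀ k, |y k| ≤ n := fun k =>
    Finset.single_le_sum (f := fun k => |y k|) (fun _ _ => abs_nonneg _) (Finset.mem_univ k)
  have h1 : ∑ j, |γ * y j - A j| ≤ e * n := by
    rw [he, Finset.sum_mul]
    refine Finset.sum_le_sum fun j _ => ?_
    rw [hsys', abs_neg, Finset.sum_mul]
    refine (Finset.abs_sum_le_sum_abs _ _).trans (Finset.sum_le_sum fun k _ => ?_)
    rw [abs_mul]
    exact mul_le_mul_of_nonneg_left (hyn k) (abs_nonneg _)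
  set d := ∑ j, |A j - S j| with hd
  set σ := ∑ j, |S j| with hσ
  have h2 : γ * n ≤ e * n + d + σ := by
    have h4 : γ * n ≤ ∑ j, (|γ * y j - A j| + |A j - S j| + |S j|) := by
      rw [hn, Finset.mul_sum]
      refine Finset.sum_le_sum fun j _ => ?_
      calc γ * |y j| = |(γ * y j - A j) + (A j - S j) + S j| := by
            rw [show (γ * y j - A j) + (A j - S j) + S j = γ * y j by ring, abs_mul,
              abs_of_pos hγ]
        _ ≤ _ := (abs_add_le _ _).trans (add_le_add_left (abs_add_le _ _) _)
    rw [Finset.sum_add_distrib, Finset.sum_add_distrib] at h4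
    linarith
  have hn0 : 0 ≤ n := Finset.sum_nonneg fun _ _ => abs_nonneg _
  have hd0 : 0 ≤ d := Finset.sum_nonneg fun _ _ => abs_nonneg _
  have hσ0 : 0 ≤ σ := Finset.sum_nonneg fun _ _ => abs_nonneg _
  have h3 : n ≤ 2 / γ * (d + σ) := by
    rw [div_mul_eq_mul_div, le_div_iff₀ hγ]
    nlinarith
  have h5 : γ * ∑ j, |y j - γ⁻¹ * S j| ≤ e * n + d := by
    have h4 : γ * ∑ j, |y j - γ⁻¹ * S j| ≤ ∑ j, (|γ * y j - A j| + |A j - S j|) := by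
      rw [Finset.mul_sum]
      refine Finset.sum_le_sum fun j _ => ?_
      calc γ * |y j - γ⁻¹ * S j| = |(γ * y j - A j) + (A j - S j)| := by
            rw [← abs_of_pos hγ, ← abs_mul, abs_of_pos hγ, mul_sub, mul_inv_cancel_left₀ hγ.ne']
            congr 1; ring
        _ ≤ _ := abs_add_le _ _
    rw [Finset.sum_add_distrib] at h4
    linarith
  have h6 : e * n ≤ d + 2 / γ * e * σ := by
    calc e * n ≤ e * (2 / γ * (d + σ)) := mul_le_mul_of_nonneg_left h3 he0
      _ = 2 / γ * e * d + 2 / γ * e * σ := by ring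
      _ ≤ d + 2 / γ * e * σ := by
          have : 2 / γ * e ≤ 1 := by rw [div_mul_eq_mul_div, div_le_one hγ]; linarith
          nlinarith
  have h7 : ∑ j, |y j - γ⁻¹ * S j| ≤ γ⁻¹ * (2 * d + 2 / γ * e * σ) := by
    rw [inv_mul_eq_div, le_div_iff₀ hγ, mul_comm]
    linarith
  refine h7.trans (le_of_eq ?_)
  field_simp

/-! ### Asymptotic normality of the sample autocovariances -/

/-- **Lévy–Cramér–Wold**: convergence in distribution of random vectors to a multiple of a standard
Gaussian vector, from the characteristic functions of the linear combinations. -/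
lemma tendstoInDistribution_smul_gaussian {Ω : Type*} [MeasurableSpace Ω] {P : Measure Ω}
    [IsProbabilityMeasure P] {Ω' : Type*} [MeasurableSpace Ω'] {P' : Measure Ω'}
    [IsProbabilityMeasure P'] {p : ℕ} {Z : Ω' → Fin p → ℝ}
    (hZ : HasLaw Z (Measure.pi fun _ : Fin p => gaussianReal 0 1) P')
    {S : ℕ → Ω → Fin p → ℝ} (hS : ∀ T, AEMeasurable (S T) P) {v : ℝ} (hv : 0 ≤ v)
    (h : ∀ u : Fin p → ℝ, Tendsto
      (fun T => ∫ ω, Complex.exp ((∑ j, u j * S T ω j : ℝ) * Complex.I) ∂P) atTop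
      (𝓝 ((Real.exp (-(v * ∑ j, u j ^ 2) / 2) : ℝ) : ℂ))) :
    TendstoInDistribution S atTop (fun ω' => √v • Z ω') (fun _ => P) P' := by
  have hm : Measurable (WithLp.toLp 2 : (Fin p → ℝ) → EuclideanSpace ℝ (Fin p)) := by fun_prop
  have hZm := hZ.aemeasurable
  have hZ' : AEMeasurable (fun ω' => (WithLp.toLp 2 (Z ω') : EuclideanSpace ℝ (Fin p))) P' :=
    hm.comp_aemeasurable hZm
  have hS' : ∀ T, AEMeasurable (fun ω => (WithLp.toLp 2 (S T ω) : EuclideanSpace ℝ (Fin p))) P :=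
    fun T => hm.comp_aemeasurable (hS T)
  have key : TendstoInDistribution (fun T ω => (WithLp.toLp 2 (S T ω) : EuclideanSpace ℝ (Fin p)))
      atTop (fun ω' => √v • (WithLp.toLp 2 (Z ω') : EuclideanSpace ℝ (Fin p)))
      (fun _ => P) P' := by
    have hζ : AEMeasurable
        (fun ω' => √v • (WithLp.toLp 2 (Z ω') : EuclideanSpace ℝ (Fin p))) P' :=
      (by fun_prop : Measurable fun x : Fin p → ℝ =>
        √v • (WithLp.toLp 2 x : EuclideanSpace ℝ (Fin p))).comp_aemeasurable hZm
    refine ⟨fun T => hm.comp_aemeasurable (hS T), hζ, ?_⟩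
    refine ProbabilityMeasure.tendsto_iff_tendsto_charFun.2 fun u => ?_
    have hlim : charFun (P'.map fun ω' => √v • (WithLp.toLp 2 (Z ω') : EuclideanSpace ℝ (Fin p))) u
        = ((Real.exp (-(v * ∑ j, u j ^ 2) / 2) : ℝ) : ℂ) := by
      rw [charFun_map_smul_comp hZ']
      have hmap : P'.map (fun ω' => (WithLp.toLp 2 (Z ω') : EuclideanSpace ℝ (Fin p)))
          = (Measure.pi fun _ : Fin p => gaussianReal 0 1).map (WithLp.toLp 2) := by
        rw [← hZ.map_eq, AEMeasurable.map_map_of_aemeasurable hm.aemeasurable hZm]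
        rfl
      rw [hmap, charFun_pi]
      simp_rw [charFun_gaussianReal]
      rw [← Complex.exp_sum, Complex.ofReal_exp]
      congr 1
      have hsv : ((√v : ℝ) : ℂ) ^ 2 = v := by
        rw [← Complex.ofReal_pow, Real.sq_sqrt hv]
      simp only [PiLp.smul_apply, smul_eq_mul, Complex.ofReal_mul, mul_pow, hsv]
      push_cast
      rw [neg_div, Finset.mul_sum, Finset.sum_div,
        ← Finset.sum_neg_distrib]
      exact Finset.sum_congr rfl fun j _ => by ring
    have hpre : ∀ T, charFun (P.map fun ω => (WithLp.toLp 2 (S T ω) : EuclideanSpace ℝ (Fin p))) u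
        = ∫ ω, Complex.exp ((∑ j, u j * S T ω j : ℝ) * Complex.I) ∂P := by
      intro T
      rw [charFun_apply, integral_map (hS' T)
        (by fun_prop)]
      simp [PiLp.inner_apply, mul_comm]
    have h2 := h u
    simp only [← hpre] at h2
    rw [← hlim] at h2
    exact h2
  exact key.continuous_comp (g := (WithLp.ofLp : EuclideanSpace ℝ (Fin p) → Fin p → ℝ))
    (by fun_prop)

section
variable {Ω : Type*} [mΩ : MeasurableSpace Ω] {P : Measure Ω} [IsProbabilityMeasure P]

/-- A criterion for convergence in probability: the deviation is controlled, as long as `e` is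
small, by `d` and by the product of `e` with a variable `s` which is bounded in mean. -/
lemma tendsto_measureReal_of_le_add_mul {D d e s : ℕ → Ω → ℝ} {c₁ c₂ c₃ C : ℝ} (hc₁ : 0 < c₁)
    (hc₂ : 0 < c₂) (hc₃ : 0 < c₃)
    (hd : ∀ T, Integrable (d T) P) (he : ∀ T, Integrable (e T) P) (hs : ∀ T, Integrable (s T) P)
    (hd0 : ∀ T ω, 0 ≤ d T ω) (he0 : ∀ T ω, 0 ≤ e T ω) (hs0 : ∀ T ω, 0 ≤ s T ω)
    (hdlim : Tendsto (fun T => ∫ ω, d T ω ∂P) atTop (𝓝 0))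
    (helim : Tendsto (fun T => ∫ ω, e T ω ∂P) atTop (𝓝 0))
    (hsC : ∀ T, ∫ ω, s T ω ∂P ≤ C)
    (hD : ∀ᶠ T in atTop, ∀ᵐ ω ∂P, e T ω ≤ c₁ → D T ω ≤ c₂ * d T ω + c₃ * e T ω * s T ω)
    {ε : ℝ} (hε : 0 < ε) :
    Tendsto (fun T => P.real {ω | ε ≤ D T ω}) atTop (𝓝 0) := by
  have markov : ∀ {Y : Ω → ℝ}, Integrable Y P → (∀ ω, 0 ≤ Y ω) → ∀ {a : ℝ}, 0 < a →
      P.real {ω | a ≤ Y ω} ≤ (∫ ω, Y ω ∂P) / a := by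
    intro Y hY hY0 a ha
    rw [le_div_iff₀ ha, mul_comm]
    exact mul_meas_ge_le_integral_of_nonneg (ae_of_all _ hY0) hY a
  have hbound : ∀ M : ℝ, 0 < M → ∀ᶠ T in atTop, P.real {ω | ε ≤ D T ω} ≤
      ((∫ ω, e T ω ∂P) / c₁ + (∫ ω, d T ω ∂P) / (ε / (2 * c₂))
        + (∫ ω, e T ω ∂P) / (ε / (2 * c₃ * M))) + C / M := by
    intro M hM
    filter_upwards [hD] with T hT
    have hsub : ∀ᵐ ω ∂P, ω ∈ {ω | ε ≤ D T ω} → ω ∈ (({ω | c₁ ≤ e T ω}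
        ∪ {ω | ε / (2 * c₂) ≤ d T ω}) ∪ {ω | ε / (2 * c₃ * M) ≤ e T ω}) ∪ {ω | M ≤ s T ω} := by
      filter_upwards [hT] with ω hω hmem
      change ε ≤ D T ω at hmem
      by_contra hcon
      have hcon' : ¬ (((c₁ ≤ e T ω ∨ ε / (2 * c₂) ≤ d T ω) ∨ ε / (2 * c₃ * M) ≤ e T ω)
        ∨ M ≤ s T ω) := hcon
      push Not at hcon'
      obtain ⟨⟨⟨h1, h2⟩, h3⟩, h4⟩ := hcon'
      have h5 := hω h1.le
      rw [lt_div_iff₀ (by positivity)] at h2 h3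
      have h6 : e T ω * s T ω ≤ e T ω * M := mul_le_mul_of_nonneg_left h4.le (he0 T ω)
      have h7 : c₃ * e T ω * s T ω ≤ c₃ * (e T ω * M) := by
        rw [mul_assoc]; exact mul_le_mul_of_nonneg_left h6 hc₃.le
      nlinarith
    have hm : P.real {ω | ε ≤ D T ω} ≤ P.real ((({ω | c₁ ≤ e T ω} ∪ {ω | ε / (2 * c₂) ≤ d T ω})
        ∪ {ω | ε / (2 * c₃ * M) ≤ e T ω}) ∪ {ω | M ≤ s T ω}) :=
      ENNReal.toReal_mono (measure_ne_top _ _) (measure_mono_ae hsub)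
    have m1 := markov (he T) (he0 T) hc₁
    have m2 := markov (hd T) (hd0 T) (show 0 < ε / (2 * c₂) by positivity)
    have m3 := markov (he T) (he0 T) (show 0 < ε / (2 * c₃ * M) by positivity)
    have m4 := (markov (hs T) (hs0 T) hM).trans (div_le_div_of_nonneg_right (hsC T) hM.le)
    refine hm.trans ((measureReal_union_le _ _).trans (add_le_add ?_ m4))
    refine (measureReal_union_le _ _).trans (add_le_add ?_ m3)
    exact (measureReal_union_le _ _).trans (add_le_add m1 m2)
  rw [Metric.tendsto_nhds]
  intro η hη
  obtain ⟨M, hM0, hM⟩ : ∃ M : ℝ, 0 < M ∧ C / M < η := by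
    refine ⟨(|C| + 1) / η, by positivity, ?_⟩
    rw [div_div_eq_mul_div, div_lt_iff₀ (by positivity), mul_comm]
    exact mul_lt_mul_of_pos_left (by linarith [le_abs_self C]) hη
  have hlim : Tendsto (fun T => ((∫ ω, e T ω ∂P) / c₁ + (∫ ω, d T ω ∂P) / (ε / (2 * c₂))
        + (∫ ω, e T ω ∂P) / (ε / (2 * c₃ * M))) + C / M) atTop (𝓝 (C / M)) := by
    have := (((helim.div_const c₁).add (hdlim.div_const (ε / (2 * c₂)))).add
      (helim.div_const (ε / (2 * c₃ * M)))).add_const (C / M)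
    simpa using this
  filter_upwards [hbound M hM0, hlim.eventually_lt_const hM] with T h1 h2
  rw [Real.dist_eq, sub_zero, abs_of_nonneg measureReal_nonneg]
  exact h1.trans_lt h2

end

/-- The normalized sample autocovariances `T^{-1/2} ∑_t η_t η_{t-j}`, `j = 1, …, p`, of
`η_t = α(t/T) f(ξ_t)`. -/
noncomputable def sampleAutocov {Ω : Type*} (p : ℕ) (α : ℝ → ℝ) (f : ℝ → ℝ) (ξ : ℤ → Ω → ℝ)
    (T : ℕ) (ω : Ω) (j : Fin p) : ℝ :=
  (√(T : ℝ))⁻¹ * ∑ t ∈ Finset.Icc ((p : ℤ) + 1) T, (α (t / T) * f (ξ t ω)) *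
    (α ((t - ((j : ℤ) + 1) : ℤ) / T) * f (ξ (t - ((j : ℤ) + 1)) ω))

lemma sum_mul_sampleAutocov {Ω : Type*} {p : ℕ} (α : ℝ → ℝ) (f : ℝ → ℝ) (ξ : ℤ → Ω → ℝ)
    (T : ℕ) (ω : Ω) (u : Fin p → ℝ) :
    ∑ j, u j * sampleAutocov p α f ξ T ω j = crossForm α u f f ξ T ω := by
  unfold sampleAutocov crossForm lagForm
  simp only [Finset.mul_sum]
  rw [Finset.sum_comm]
  exact Finset.sum_congr rfl fun t _ => Finset.sum_congr rfl fun j _ => by ring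

section
variable {Ω : Type*} [mΩ : MeasurableSpace Ω] {P : Measure Ω} [IsProbabilityMeasure P]
  {ξ : ℤ → Ω → ℝ} {p : ℕ} {α : ℝ → ℝ} {W L : ℝ} {f : ℝ → ℝ}

lemma sampleAutocov_eq_crossForm_single (T : ℕ) (ω : Ω) (j : Fin p) :
    sampleAutocov p α f ξ T ω j = crossForm α (Pi.single j 1) f f ξ T ω := by
  rw [← sum_mul_sampleAutocov]
  simp [Pi.single_apply]

lemma IsIID.memLp_sampleAutocov (hξ : IsIID P ξ) (hW : ∀ x, |α x| ≤ W) (hf : Measurable f)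
    (hf2 : MemLp (fun ω => f (ξ 0 ω)) 2 P) (hf0 : ∫ ω, f (ξ 0 ω) ∂P = 0) (T : ℕ) (j : Fin p) :
    MemLp (fun ω => sampleAutocov p α f ξ T ω j) 2 P := by
  simp_rw [sampleAutocov_eq_crossForm_single]
  exact (hξ.crossForm_second_moment hW _ hf hf2 hf0 hf hf2 hf0 T).1

lemma IsIID.integral_abs_sampleAutocov_le (hξ : IsIID P ξ) (hW : ∀ x, |α x| ≤ W)
    (hf : Measurable f)
    (hf2 : MemLp (fun ω => f (ξ 0 ω)) 2 P) (hf0 : ∫ ω, f (ξ 0 ω) ∂P = 0) (T : ℕ) (j : Fin p) :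
    ∫ ω, |sampleAutocov p α f ξ T ω j| ∂P ≤ √((∫ ω, f (ξ 0 ω) ^ 2 ∂P) ^ 2 * W ^ 4) := by
  simp_rw [sampleAutocov_eq_crossForm_single]
  obtain ⟨h1, h2⟩ :=
    hξ.crossForm_second_moment hW (Pi.single j 1 : Fin p → ℝ) hf hf2 hf0 hf hf2 hf0 T
  refine (integral_abs_le_sqrt h1).trans (Real.sqrt_le_sqrt (h2.trans (le_of_eq ?_)))
  have : ∑ i, (Pi.single j 1 : Fin p → ℝ) i ^ 2 = 1 := by
    simp [Pi.single_apply, ite_pow]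
  rw [this]; ring

/-- The central limit theorem for the sample autocovariances. -/
theorem IsIID.tendstoInDistribution_sampleAutocov (hξ : IsIID P ξ) {Ω' : Type*}
    [MeasurableSpace Ω'] {P' : Measure Ω'} [IsProbabilityMeasure P'] {Z : Ω' → Fin p → ℝ}
    (hZ : HasLaw Z (Measure.pi fun _ : Fin p => gaussianReal 0 1) P') (hW : ∀ x, |α x| ≤ W)
    (hL : ∀ x y, |α x - α y| ≤ L * |x - y|) (hf : Measurable f)
    (hf2 : MemLp (fun ω => f (ξ 0 ω)) 2 P) (hf0 : ∫ ω, f (ξ 0 ω) ∂P = 0) :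
    TendstoInDistribution (sampleAutocov p α f ξ) atTop
      (fun ω' => √((∫ ω, f (ξ 0 ω) ^ 2 ∂P) ^ 2 * ∫ x in (0 : ℝ)..1, α x ^ 4) • Z ω')
      (fun _ => P) P' := by
  refine tendstoInDistribution_smul_gaussian hZ (fun T => ?_) (mul_nonneg (sq_nonneg _)
    (intervalIntegral.integral_nonneg zero_le_one fun x _ => by positivity)) fun u => ?_
  · exact aemeasurable_pi_lambda _ fun j =>
      (hξ.memLp_sampleAutocov hW hf hf2 hf0 T j).aestronglyMeasurable.aemeasurable
  · simp_rw [sum_mul_sampleAutocov]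
    have h := hξ.tendsto_integral_cexp_crossForm hW hL u hf hf2 hf0
    convert h using 4
    ring

end

/-! ### The least-squares estimator -/

/-- The centred observations `η_t + r_t`, where `η_t = α(t/T) f(ξ_t)` and `r_t` is the smoothing
error of the weights `k`. -/
noncomputable def centredObs {Ω : Type*} (p : ℕ) (α : ℝ → ℝ) (f : ℝ → ℝ) (ξ : ℤ → Ω → ℝ)
    (k : ℕ → ℤ → ℤ → ℝ) (T : ℕ) (t : ℤ) (ω : Ω) : ℝ :=
  α (t / T) * f (ξ t ω)
    + smoothingError (fun t : ℤ => α (t / T)) f ξ (k T) (Finset.Icc ((p : ℤ) + 1) T) t ω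

section
variable {Ω : Type*} [mΩ : MeasurableSpace Ω] {P : Measure Ω} [IsProbabilityMeasure P]
  {ξ : ℤ → Ω → ℝ} {p : ℕ} {α : ℝ → ℝ} {W L : ℝ} {f : ℝ → ℝ} {k : ℕ → ℤ → ℤ → ℝ} {κ β : ℕ → ℝ}

lemma IsIID.memLp_centredObs (hξ : IsIID P ξ) (hf : Measurable f)
    (hf2 : MemLp (fun ω => f (ξ 0 ω)) 2 P) (T : ℕ) (t : ℤ) :
    MemLp (centredObs p α f ξ k T t) 2 P :=
  ((hξ.memLp_comp hf hf2 t).const_mul _).add (hξ.memLp_smoothingError hf hf2 t)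

lemma IsIID.integrable_sum_noise_mul_noise (hξ : IsIID P ξ) (hf : Measurable f)
    (hf2 : MemLp (fun ω => f (ξ 0 ω)) 2 P) (w : ℤ → ℝ) (I : Finset ℤ) (a b : ℤ) :
    Integrable (fun ω => ∑ t ∈ I, (w (t + a) * f (ξ (t + a) ω)) * (w (t + b) * f (ξ (t + b) ω)))
      P :=
  integrable_finsetSum _ fun t _ =>
    ((hξ.memLp_comp hf hf2 (t + a)).const_mul (w (t + a))).integrable_mul
      ((hξ.memLp_comp hf hf2 (t + b)).const_mul (w (t + b)))

lemma IsIID.integrable_sum_centredObs_mul (hξ : IsIID P ξ) (hf : Measurable f)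
    (hf2 : MemLp (fun ω => f (ξ 0 ω)) 2 P) (T : ℕ) (I : Finset ℤ) (a b : ℤ) :
    Integrable (fun ω => ∑ t ∈ I, centredObs p α f ξ k T (t + a) ω
      * centredObs p α f ξ k T (t + b) ω) P :=
  integrable_finsetSum _ fun t _ =>
    (hξ.memLp_centredObs hf hf2 T (t + a)).integrable_mul (hξ.memLp_centredObs hf hf2 T (t + b))

/-- The sample autocovariances at scale `T^{-1/2}` do not see the smoothing error, provided that
`T^{1/2} κ → 0` and `T^{1/2} β² → 0`. -/
lemma IsIID.tendsto_sum_centredObs_sub (hξ : IsIID P ξ) (hW : ∀ x, |α x| ≤ W)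
    (hf : Measurable f) (hf2 : MemLp (fun ω => f (ξ 0 ω)) 2 P) (hf0 : ∫ ω, f (ξ 0 ω) ∂P = 0)
    (hk : ∀ᶠ T : ℕ in atTop, IsSmoothing (fun t : ℤ => α (t / T)) (k T)
      (Finset.Icc 1 T) (Finset.Icc ((p : ℤ) + 1) T) (κ T) (β T))
    (hκ0 : ∀ᶠ T in atTop, 0 ≤ κ T) (hβ0 : ∀ᶠ T in atTop, 0 ≤ β T)
    (hκ : Tendsto (fun T : ℕ => √(T : ℝ) * κ T) atTop (𝓝 0))
    (hβ : Tendsto (fun T : ℕ => √(T : ℝ) * β T ^ 2) atTop (𝓝 0))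
    {a b : ℤ} (ha : -p ≤ a) (ha' : a ≤ 0) (hb : -p ≤ b) (hb' : b ≤ 0) :
    Tendsto (fun T : ℕ => ∫ ω, |(√(T : ℝ))⁻¹ * (∑ t ∈ Finset.Icc ((p : ℤ) + 1) T,
        centredObs p α f ξ k T (t + a) ω * centredObs p α f ξ k T (t + b) ω
      - ∑ t ∈ Finset.Icc ((p : ℤ) + 1) T, (α ((t + a : ℤ) / T) * f (ξ (t + a) ω))
          * (α ((t + b : ℤ) / T) * f (ξ (t + b) ω)))| ∂P) atTop (𝓝 0) := by
  set V := ∫ ω, f (ξ 0 ω) ^ 2 ∂P with hV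
  have hone : ∀ {T : ℕ}, 0 < T → 1 ≤ √(T : ℝ) := fun hT =>
    Real.one_le_sqrt.2 (by exact_mod_cast hT)
  have hκ1 : Tendsto κ atTop (𝓝 0) := by
    refine squeeze_zero' hκ0 ?_ hκ
    filter_upwards [hκ0, eventually_gt_atTop 0] with T h0 hT
    exact le_mul_of_one_le_left h0 (hone hT)
  have hβ1 : Tendsto β atTop (𝓝 0) := by
    have h2 : Tendsto (fun T => β T ^ 2) atTop (𝓝 0) := by
      refine squeeze_zero' (Eventually.of_forall fun T => sq_nonneg _) ?_ hβ
      filter_upwards [eventually_gt_atTop 0] with T hT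
      exact le_mul_of_one_le_left (sq_nonneg _) (hone hT)
    have h3 := (Real.continuous_sqrt.tendsto 0).comp h2
    rw [Real.sqrt_zero] at h3
    refine h3.congr' ?_
    filter_upwards [hβ0] with T h0
    exact Real.sqrt_sq h0
  have hsκ : Tendsto (fun T => √(κ T)) atTop (𝓝 0) := by
    have := (Real.continuous_sqrt.tendsto 0).comp hκ1
    rwa [Real.sqrt_zero] at this
  have hlim : Tendsto (fun T : ℕ => 2 * (√V * (W * β T)
      + V * (W ^ 2 * (√(T : ℝ) * κ T + 2 * √(κ T))))
      + (2 * (√(T : ℝ) * β T ^ 2) + 2 * (V * (W ^ 2 * (√(T : ℝ) * κ T))))) atTop (𝓝 0) := by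
    have := ((((hβ1.const_mul W).const_mul √V).add
      (((hκ.add (hsκ.const_mul 2)).const_mul (W ^ 2)).const_mul V)).const_mul 2).add
      ((hβ.const_mul 2).add (((hκ.const_mul (W ^ 2)).const_mul V).const_mul 2))
    simpa using this
  refine squeeze_zero' (Eventually.of_forall fun T => integral_nonneg fun _ => abs_nonneg _) ?_ hlim
  filter_upwards [hk, hκ0, hβ0, eventually_gt_atTop 0] with T hkT hκT hβT hT
  have hmem : ∀ c : ℤ, -p ≤ c → c ≤ 0 → ∀ t ∈ Finset.Icc ((p : ℤ) + 1) T,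
      t + c ∈ Finset.Icc (1 : ℤ) T := by
    intro c hc hc' t ht
    simp only [Finset.mem_Icc] at ht ⊢
    omega
  have h := hξ.integral_abs_sum_centred_sub_le hf hf2 hf0 (fun t => hW _) hκT hβT hkT
    (Finset.Icc ((p : ℤ) + 1) T) (card_Icc_succ_le p T) a b (hmem a ha ha') (hmem b hb hb')
  simp only [← Finset.sum_sub_distrib, abs_mul]
  rw [integral_const_mul, abs_of_nonneg (by positivity : 0 ≤ (√(T : ℝ))⁻¹)]
  refine (mul_le_mul_of_nonneg_left h (by positivity)).trans (le_of_eq ?_)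
  have hs : (0 : ℝ) < √(T : ℝ) := lt_of_lt_of_le one_pos (hone hT)
  have hTs : (T : ℝ) = √(T : ℝ) * √(T : ℝ) := (Real.mul_self_sqrt (Nat.cast_nonneg T)).symm
  rw [Real.sqrt_mul (Nat.cast_nonneg T), ← hV]
  set s := √(T : ℝ) with hsdef
  rw [hTs]
  field_simp

/-- The normalized Gram matrix of the lagged centred observations converges to a multiple of the
identity. -/
lemma IsIID.tendsto_gram (hξ : IsIID P ξ) (hW : ∀ x, |α x| ≤ W)
    (hL : ∀ x y, |α x - α y| ≤ L * |x - y|)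
    (hf : Measurable f) (hf2 : MemLp (fun ω => f (ξ 0 ω)) 2 P) (hf0 : ∫ ω, f (ξ 0 ω) ∂P = 0)
    (hk : ∀ᶠ T : ℕ in atTop, IsSmoothing (fun t : ℤ => α (t / T)) (k T)
      (Finset.Icc 1 T) (Finset.Icc ((p : ℤ) + 1) T) (κ T) (β T))
    (hκ0 : ∀ᶠ T in atTop, 0 ≤ κ T) (hβ0 : ∀ᶠ T in atTop, 0 ≤ β T)
    (hκ : Tendsto (fun T : ℕ => √(T : ℝ) * κ T) atTop (𝓝 0))
    (hβ : Tendsto (fun T : ℕ => √(T : ℝ) * β T ^ 2) atTop (𝓝 0))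
    {a b : ℤ} (ha : -p ≤ a) (ha' : a ≤ 0) (hb : -p ≤ b) (hb' : b ≤ 0) :
    Tendsto (fun T : ℕ => ∫ ω, |(T : ℝ)⁻¹ * (∑ t ∈ Finset.Icc ((p : ℤ) + 1) T,
        centredObs p α f ξ k T (t + a) ω * centredObs p α f ξ k T (t + b) ω)
      - if a = b then (∫ ω, f (ξ 0 ω) ^ 2 ∂P) * ∫ x in (0 : ℝ)..1, α x ^ 2 else 0| ∂P)
      atTop (𝓝 0) := by
  set V := ∫ ω, f (ξ 0 ω) ^ 2 ∂P with hV
  set δ : ℝ := if a = b then V * ∫ x in (0 : ℝ)..1, α x ^ 2 else 0 with hδ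
  have hW0 : 0 ≤ W := (abs_nonneg _).trans (hW 0)
  have h1 := hξ.tendsto_sum_centredObs_sub hW hf hf2 hf0 hk hκ0 hβ0 hκ hβ ha ha' hb hb'
  have hηi : ∀ T : ℕ, Integrable (fun ω => ∑ t ∈ Finset.Icc ((p : ℤ) + 1) T,
      (α ((t + a : ℤ) / T) * f (ξ (t + a) ω)) * (α ((t + b : ℤ) / T) * f (ξ (t + b) ω))) P :=
    fun T => hξ.integrable_sum_noise_mul_noise hf hf2 (fun t : ℤ => α (t / T)) _ a b
  -- the Gram matrix of the noise
  have h2 : Tendsto (fun T : ℕ => ∫ ω, |(T : ℝ)⁻¹ * ∑ t ∈ Finset.Icc ((p : ℤ) + 1) T,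
      (α ((t + a : ℤ) / T) * f (ξ (t + a) ω)) * (α ((t + b : ℤ) / T) * f (ξ (t + b) ω)) - δ| ∂P)
      atTop (𝓝 0) := by
    by_cases hab : a = b
    · subst hab
      have hlln := hξ.tendsto_integral_abs_weighted_mean (F := fun x => f x ^ 2)
        (hf.pow_const 2) hf2.integrable_sq
        (fun T => (Finset.Icc ((p : ℤ) + 1) T).map (addRightEmbedding a))
        (fun T => by rw [Finset.card_map]; exact card_Icc_succ_le p T)
        (fun T t => α (t / T) ^ 2) (B := W ^ 2) (fun T t => by
          rw [abs_pow]; exact pow_le_pow_left₀ (abs_nonneg _) (hW _) 2)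
      rw [← hV] at hlln
      have hL0 : 0 ≤ L := by simpa using (abs_nonneg _).trans (hL 0 1)
      have hsum := tendsto_riemann_sum (φ := fun x => α x ^ 2) (L := 2 * W * L) (B := W ^ 2)
        (C := 2 * W * (L * |(a : ℝ)|)) (fun x y => by
          rw [mul_assoc (2 * W)]
          exact (abs_sq_sub_sq_le (hW x) (hW y)).trans
            (mul_le_mul_of_nonneg_left (hL x y) (by positivity)))
        (fun x => by rw [abs_pow]; exact pow_le_pow_left₀ (abs_nonneg _) (hW _) 2) p
        (fun T t => α ((t + a : ℤ) / T) ^ 2) (fun T t => by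
          refine (abs_sq_sub_sq_le (hW _) (hW _)).trans ?_
          rw [mul_div_assoc, mul_div_assoc]
          refine mul_le_mul_of_nonneg_left ((hL _ _).trans
            (mul_le_mul_of_nonneg_left (le_of_eq ?_) hL0)) (by positivity)
          rw [← sub_div, abs_div, Nat.abs_cast]
          push_cast
          congr 2; ring)
      have hsum' : Tendsto (fun T : ℕ => |V * ((T : ℝ)⁻¹ * ∑ t ∈ Finset.Icc ((p : ℤ) + 1) T,
          α ((t + a : ℤ) / T) ^ 2 - ∫ x in (0 : ℝ)..1, α x ^ 2)|) atTop (𝓝 0) := by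
        have := ((hsum.sub_const (∫ x in (0 : ℝ)..1, α x ^ 2)).const_mul V).abs
        simpa using this
      have hlim := hlln.add hsum'
      rw [add_zero] at hlim
      refine squeeze_zero (fun T => integral_nonneg fun _ => abs_nonneg _) (fun T => ?_) hlim
      have hli : Integrable (fun ω => (T : ℝ)⁻¹ *
          ∑ t ∈ (Finset.Icc ((p : ℤ) + 1) T).map (addRightEmbedding a),
            α (t / T) ^ 2 * (f (ξ t ω) ^ 2 - V)) P :=
        (integrable_finsetSum _ fun t _ => ((hξ.memLp_comp hf hf2 t).integrable_sq.sub
          (integrable_const V)).const_mul _).const_mul _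
      have hdec : ∀ ω, (T : ℝ)⁻¹ * ∑ t ∈ Finset.Icc ((p : ℤ) + 1) T,
          (α ((t + a : ℤ) / T) * f (ξ (t + a) ω)) * (α ((t + a : ℤ) / T) * f (ξ (t + a) ω)) - δ
          = (T : ℝ)⁻¹ * ∑ t ∈ (Finset.Icc ((p : ℤ) + 1) T).map (addRightEmbedding a),
              α (t / T) ^ 2 * (f (ξ t ω) ^ 2 - V)
            + V * ((T : ℝ)⁻¹ * ∑ t ∈ Finset.Icc ((p : ℤ) + 1) T,
              α ((t + a : ℤ) / T) ^ 2 - ∫ x in (0 : ℝ)..1, α x ^ 2) := by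
        intro ω
        rw [Finset.sum_map, hδ, if_pos rfl]
        simp only [addRightEmbedding_apply, mul_sub, Finset.sum_sub_distrib, ← Finset.sum_mul]
        have : ∀ t : ℤ, (α ((t + a : ℤ) / T) * f (ξ (t + a) ω))
            * (α ((t + a : ℤ) / T) * f (ξ (t + a) ω))
            = α ((t + a : ℤ) / T) ^ 2 * f (ξ (t + a) ω) ^ 2 := fun t => by ring
        simp only [this]
        ring
      simp_rw [hdec]
      refine (integral_mono (hli.add (integrable_const _)).abs
        (hli.abs.add (integrable_const _)) fun ω => abs_add_le _ _).trans (le_of_eq ?_)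
      refine (integral_add hli.abs (integrable_const _)).trans ?_
      rw [integral_const]
      simp
    · have hδ0 : δ = 0 := by rw [hδ, if_neg hab]
      rw [hδ0]
      have hlim : Tendsto (fun T : ℕ => V * (2 * (W ^ 2 * (√(T : ℝ))⁻¹))) atTop (𝓝 0) := by
        have hs : Tendsto (fun T : ℕ => (√(T : ℝ))⁻¹) atTop (𝓝 0) :=
          tendsto_inv_atTop_zero.comp (Real.tendsto_sqrt_atTop.comp tendsto_natCast_atTop_atTop)
        simpa using ((hs.const_mul (W ^ 2)).const_mul 2).const_mul V
      refine squeeze_zero' (Eventually.of_forall fun T => integral_nonneg fun _ => abs_nonneg _)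
        ?_ hlim
      filter_upwards [eventually_gt_atTop 0] with T hT
      have h := hξ.integral_abs_sum_lagged_product_le hf hf2 hf0 (w := fun t : ℤ => α (t / T))
        (fun t => hW _) (Finset.Icc ((p : ℤ) + 1) T) (card_Icc_succ_le p T) hab
      simp only [sub_zero, abs_mul (T : ℝ)⁻¹]
      rw [integral_const_mul, abs_of_nonneg (by positivity : 0 ≤ (T : ℝ)⁻¹)]
      refine (mul_le_mul_of_nonneg_left h (by positivity)).trans (le_of_eq ?_)
      have hs : (0 : ℝ) < √(T : ℝ) := Real.sqrt_pos.2 (by exact_mod_cast hT)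
      have hTs : (T : ℝ) = √(T : ℝ) * √(T : ℝ) := (Real.mul_self_sqrt (Nat.cast_nonneg T)).symm
      rw [← hV]
      set s := √(T : ℝ) with hsdef
      rw [hTs]
      field_simp
  have hlim := h1.add h2
  rw [add_zero] at hlim
  refine squeeze_zero' (Eventually.of_forall fun T => integral_nonneg fun _ => abs_nonneg _) ?_ hlim
  filter_upwards [eventually_gt_atTop 0] with T hT
  set Y : Ω → ℝ := fun ω => (√(T : ℝ))⁻¹ * (∑ t ∈ Finset.Icc ((p : ℤ) + 1) T,
        centredObs p α f ξ k T (t + a) ω * centredObs p α f ξ k T (t + b) ω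
      - ∑ t ∈ Finset.Icc ((p : ℤ) + 1) T, (α ((t + a : ℤ) / T) * f (ξ (t + a) ω))
          * (α ((t + b : ℤ) / T) * f (ξ (t + b) ω))) with hY
  set N : Ω → ℝ := fun ω => (T : ℝ)⁻¹ * ∑ t ∈ Finset.Icc ((p : ℤ) + 1) T,
      (α ((t + a : ℤ) / T) * f (ξ (t + a) ω)) * (α ((t + b : ℤ) / T) * f (ξ (t + b) ω)) - δ with hN
  have hGi : Integrable (fun ω => (T : ℝ)⁻¹ * (∑ t ∈ Finset.Icc ((p : ℤ) + 1) T,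
      centredObs p α f ξ k T (t + a) ω * centredObs p α f ξ k T (t + b) ω) - δ) P :=
    ((hξ.integrable_sum_centredObs_mul hf hf2 T _ a b).const_mul _).sub (integrable_const _)
  have hYi : Integrable Y P :=
    ((hξ.integrable_sum_centredObs_mul hf hf2 T _ a b).sub (hηi T)).const_mul _
  have hNi : Integrable N P := ((hηi T).const_mul _).sub (integrable_const _)
  have hs1 : 1 ≤ √(T : ℝ) := Real.one_le_sqrt.2 (by exact_mod_cast hT)
  have hTinv : (T : ℝ)⁻¹ = (√(T : ℝ))⁻¹ * (√(T : ℝ))⁻¹ := by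
    rw [← mul_inv, Real.mul_self_sqrt (Nat.cast_nonneg T)]
  rw [← integral_add hYi.abs hNi.abs]
  refine integral_mono hGi.abs (hYi.abs.add hNi.abs) fun ω => ?_
  have hdec : (T : ℝ)⁻¹ * (∑ t ∈ Finset.Icc ((p : ℤ) + 1) T,
      centredObs p α f ξ k T (t + a) ω * centredObs p α f ξ k T (t + b) ω) - δ
      = (√(T : ℝ))⁻¹ * Y ω + N ω := by
    simp only [hY, hN, hTinv]; ring
  simp only [hdec]
  refine (abs_add_le _ _).trans (add_le_add_left ?_ _)
  rw [abs_mul, abs_of_nonneg (by positivity : 0 ≤ (√(T : ℝ))⁻¹)]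
  exact mul_le_of_le_one_left (abs_nonneg _) (inv_le_one_of_one_le₀ hs1)

/-- Asymptotic normality of the solutions of the normal equations. -/
theorem IsIID.tendstoInDistribution_leastSquares (hξ : IsIID P ξ) {Ω' : Type*}
    [MeasurableSpace Ω'] {P' : Measure Ω'} [IsProbabilityMeasure P'] {Z : Ω' → Fin p → ℝ}
    (hZ : HasLaw Z (Measure.pi fun _ : Fin p => gaussianReal 0 1) P') (hW : ∀ x, |α x| ≤ W)
    (hL : ∀ x y, |α x - α y| ≤ L * |x - y|)
    (hf : Measurable f) (hf2 : MemLp (fun ω => f (ξ 0 ω)) 2 P) (hf0 : ∫ ω, f (ξ 0 ω) ∂P = 0)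
    (hk : ∀ᶠ T : ℕ in atTop, IsSmoothing (fun t : ℤ => α (t / T)) (k T)
      (Finset.Icc 1 T) (Finset.Icc ((p : ℤ) + 1) T) (κ T) (β T))
    (hκ0 : ∀ᶠ T in atTop, 0 ≤ κ T) (hβ0 : ∀ᶠ T in atTop, 0 ≤ β T)
    (hκ : Tendsto (fun T : ℕ => √(T : ℝ) * κ T) atTop (𝓝 0))
    (hβ : Tendsto (fun T : ℕ => √(T : ℝ) * β T ^ 2) atTop (𝓝 0))
    {γ v : ℝ} (hγ : γ = (∫ ω, f (ξ 0 ω) ^ 2 ∂P) * ∫ x in (0 : ℝ)..1, α x ^ 2) (hγ0 : 0 < γ)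
    (hv : v = (∫ ω, f (ξ 0 ω) ^ 2 ∂P) ^ 2 * ∫ x in (0 : ℝ)..1, α x ^ 4)
    {aHat : ℕ → Ω → Fin p → ℝ} (haHat : ∀ T, AEMeasurable (aHat T) P)
    (hnormal : ∀ T : ℕ, ∀ᵐ ω ∂P, ∀ j : Fin p, ∑ l : Fin p, (∑ t ∈ Finset.Icc ((p : ℤ) + 1) T,
        centredObs p α f ξ k T (t - ((j : ℤ) + 1)) ω * centredObs p α f ξ k T (t - ((l : ℤ) + 1)) ω)
          * aHat T ω l
      = ∑ t ∈ Finset.Icc ((p : ℤ) + 1) T,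
        centredObs p α f ξ k T t ω * centredObs p α f ξ k T (t - ((j : ℤ) + 1)) ω) :
    TendstoInDistribution (fun (T : ℕ) ω => √(T : ℝ) • aHat T ω) atTop
      (fun ω' => γ⁻¹ • √v • Z ω') (fun _ => P) P' := by
  have hS := hξ.tendstoInDistribution_sampleAutocov hZ hW hL hf hf2 hf0
  rw [← hv] at hS
  have hS' := hS.continuous_comp (g := fun x : Fin p → ℝ => γ⁻¹ • x) (by fun_prop)
  refine tendstoInDistribution_of_tendstoInMeasure_sub _ _ hS' ?_
    fun T => (haHat T).const_smul (√(T : ℝ))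
  set S : ℕ → Ω → Fin p → ℝ := sampleAutocov p α f ξ with hSdef
  set A : ℕ → Ω → Fin p → ℝ := fun T ω j => (√(T : ℝ))⁻¹ * ∑ t ∈ Finset.Icc ((p : ℤ) + 1) T,
    centredObs p α f ξ k T t ω * centredObs p α f ξ k T (t - ((j : ℤ) + 1)) ω with hA
  set G : ℕ → Ω → Fin p → Fin p → ℝ := fun T ω j l => (T : ℝ)⁻¹ *
    ∑ t ∈ Finset.Icc ((p : ℤ) + 1) T, centredObs p α f ξ k T (t - ((j : ℤ) + 1)) ω
      * centredObs p α f ξ k T (t - ((l : ℤ) + 1)) ω with hG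
  have hSi : ∀ T j, Integrable (fun ω => S T ω j) P := fun T j =>
    (hξ.memLp_sampleAutocov hW hf hf2 hf0 T j).integrable (by norm_num)
  have hAi : ∀ T j, Integrable (fun ω => A T ω j) P := fun T j => by
    have := hξ.integrable_sum_centredObs_mul (p := p) (α := α) (k := k) hf hf2 T
      (Finset.Icc ((p : ℤ) + 1) T) 0 (-((j : ℤ) + 1))
    simp only [add_zero, ← sub_eq_add_neg] at this
    exact this.const_mul _
  have hGi : ∀ T j l, Integrable (fun ω => G T ω j l - if j = l then γ else 0) P :=
    fun T j l => by
    have := hξ.integrable_sum_centredObs_mul (p := p) (α := α) (k := k) hf hf2 T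
      (Finset.Icc ((p : ℤ) + 1) T) (-((j : ℤ) + 1)) (-((l : ℤ) + 1))
    simp only [← sub_eq_add_neg] at this
    exact (this.const_mul _).sub (integrable_const _)
  have hdi : ∀ T j, Integrable (fun ω => |A T ω j - S T ω j|) P := fun T j =>
    ((hAi T j).sub (hSi T j)).abs
  have hd : ∀ j, Tendsto (fun T => ∫ ω, |A T ω j - S T ω j| ∂P) atTop (𝓝 0) := by
    intro j
    have hj := j.2
    have h := hξ.tendsto_sum_centredObs_sub hW hf hf2 hf0 hk hκ0 hβ0 hκ hβ (a := 0)
      (b := -((j : ℤ) + 1)) (by omega) le_rfl (by omega) (by omega)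
    simp only [add_zero, ← sub_eq_add_neg, mul_sub] at h
    exact h
  have he : ∀ j l, Tendsto (fun T => ∫ ω, |G T ω j l - if j = l then γ else 0| ∂P) atTop
      (𝓝 0) := by
    intro j l
    have hj := j.2
    have hl := l.2
    have h := hξ.tendsto_gram hW hL hf hf2 hf0 hk hκ0 hβ0 hκ hβ (a := -((j : ℤ) + 1))
      (b := -((l : ℤ) + 1)) (by omega) (by omega) (by omega) (by omega)
    simp only [← sub_eq_add_neg, ← hγ, neg_inj, add_left_inj, Nat.cast_inj, Fin.val_inj] at h
    exact h
  rw [tendstoInMeasure_iff_measureReal_norm]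
  intro ε hε
  have key := tendsto_measureReal_of_le_add_mul (P := P)
    (D := fun T ω => ∑ j, |√(T : ℝ) * aHat T ω j - γ⁻¹ * S T ω j|)
    (d := fun T ω => ∑ j, |A T ω j - S T ω j|)
    (e := fun T ω => ∑ j, ∑ l, |G T ω j l - if j = l then γ else 0|)
    (s := fun T ω => ∑ j, |S T ω j|) (c₁ := γ / 2) (c₂ := 2 / γ) (c₃ := 2 / γ ^ 2)
    (C := ∑ j : Fin p, √((∫ ω, f (ξ 0 ω) ^ 2 ∂P) ^ 2 * W ^ 4))
    (by positivity) (by positivity) (by positivity)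
    (fun T => integrable_finsetSum _ fun j _ => hdi T j)
    (fun T => integrable_finsetSum _ fun j _ => integrable_finsetSum _ fun l _ => (hGi T j l).abs)
    (fun T => integrable_finsetSum _ fun j _ => (hSi T j).abs)
    (fun T ω => Finset.sum_nonneg fun _ _ => abs_nonneg _)
    (fun T ω => Finset.sum_nonneg fun _ _ => Finset.sum_nonneg fun _ _ => abs_nonneg _)
    (fun T ω => Finset.sum_nonneg fun _ _ => abs_nonneg _)
    (by
      have h := tendsto_finsetSum Finset.univ fun j (_ : j ∈ Finset.univ) => hd j
      simp only [Finset.sum_const_zero] at h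
      refine h.congr fun T => ?_
      exact (integral_finsetSum _ fun j _ => hdi T j).symm)
    (by
      have h := tendsto_finsetSum Finset.univ fun j (_ : j ∈ Finset.univ) =>
        tendsto_finsetSum Finset.univ fun l (_ : l ∈ Finset.univ) => he j l
      simp only [Finset.sum_const_zero] at h
      refine h.congr fun T => ?_
      rw [integral_finsetSum _ fun j _ => integrable_finsetSum _ fun l _ => (hGi T j l).abs]
      exact Finset.sum_congr rfl fun j _ =>
        (integral_finsetSum _ fun l _ => (hGi T j l).abs).symm)
    (fun T => by
      rw [integral_finsetSum _ fun j _ => (hSi T j).abs]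
      exact Finset.sum_le_sum fun j _ =>
        hξ.integral_abs_sampleAutocov_le hW hf hf2 hf0 T j)
    (by
      filter_upwards [eventually_gt_atTop 0] with T hT
      filter_upwards [hnormal T] with ω hω hsmall
      refine sum_abs_sub_le_of_perturbed_system hγ0 (G T ω) (fun j => √(T : ℝ) * aHat T ω j)
        (A T ω) (S T ω) (fun j => ?_) hsmall
      have hs : (0 : ℝ) < √(T : ℝ) := Real.sqrt_pos.2 (by exact_mod_cast hT)
      have hTinv : (T : ℝ)⁻¹ * √(T : ℝ) = (√(T : ℝ))⁻¹ := by
        have hTs : (T : ℝ) = √(T : ℝ) * √(T : ℝ) :=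
          (Real.mul_self_sqrt (Nat.cast_nonneg T)).symm
        set s := √(T : ℝ) with hsdef
        rw [hTs]; field_simp
      simp only [hA, hG]
      rw [← hω j, ← hTinv, Finset.mul_sum]
      exact Finset.sum_congr rfl fun l _ => by ring)
    hε
  refine squeeze_zero (fun _ => measureReal_nonneg) (fun T => ?_) key
  refine measureReal_mono (fun ω hω => ?_) (measure_ne_top _ _)
  rw [Set.mem_ofPred_eq] at hω ⊢
  refine hω.trans ?_
  rw [pi_norm_le_iff_of_nonneg (Finset.sum_nonneg fun _ _ => abs_nonneg _)]
  intro j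
  have := Finset.single_le_sum (f := fun j => |√(T : ℝ) * aHat T ω j - γ⁻¹ * S T ω j|)
    (fun _ _ => abs_nonneg _) (Finset.mem_univ j)
  simpa [Function.comp] using this

end

/-! ### The ARCH model without lags -/

section
variable {Ω : Type*} [MeasurableSpace Ω] {P : Measure Ω} [IsProbabilityMeasure P] {ξ : ℤ → Ω → ℝ}

lemma IsStrongWhiteNoise.isIID (hξ : IsStrongWhiteNoise P ξ) : IsIID P ξ :=
  ⟨hξ.measurable, hξ.indep, hξ.identDistrib⟩

lemma IsStrongWhiteNoise.integral_sq (hξ : IsStrongWhiteNoise P ξ) : ∫ ω, ξ 0 ω ^ 2 ∂P = 1 := by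
  rw [← hξ.variance_eq_one, variance_of_integral_eq_zero (hξ.measurable 0).aemeasurable
    hξ.mean_eq_zero]

lemma IsStrongWhiteNoise.memLp_sq {δ : ℝ} (hξ : IsStrongWhiteNoise P ξ)
    (hδ : MomentCondition P ξ 4 δ) : MemLp (fun ω => ξ 0 ω ^ 2) 2 P := by
  rw [memLp_two_iff_integrable_sq ((hξ.measurable 0).pow_const 2).aestronglyMeasurable]
  refine ((integrable_const (1 : ℝ)).add hδ.integrable).mono'
    (((hξ.measurable 0).pow_const 2).pow_const 2).aestronglyMeasurable
    (Eventually.of_forall fun ω => ?_)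
  have h4 : ‖(ξ 0 ω ^ 2) ^ 2‖ = |ξ 0 ω| ^ (4 : ℝ) := by
    rw [Real.norm_of_nonneg (by positivity), ← pow_mul]
    norm_cast
    exact ((even_two_mul 2).pow_abs (ξ 0 ω)).symm
  rw [h4, Pi.add_apply]
  have hpos := hδ.exponent_mem.1
  rcases le_total |ξ 0 ω| 1 with h1 | h1
  · exact (Real.rpow_le_one (abs_nonneg _) h1 (by norm_num)).trans
      (le_add_of_nonneg_right (Real.rpow_nonneg (abs_nonneg _) _))
  · refine (Real.rpow_le_rpow_of_exponent_le h1 ?_).trans (le_add_of_nonneg_left zero_le_one)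
    push_cast
    linarith

/-- In the absence of lags the squared ARCH process is the squared noise, rescaled. -/
lemma IsStationaryARCH.variance_sq {p : ℕ} {c : ℝ} {a : Fin p → ℝ} {Y : ℤ → Ω → ℝ}
    (hY : IsStationaryARCH P ξ c a Y) (ha : ∀ j, a j = 0) (hc : 0 ≤ c) :
    variance (fun ω => Y 0 ω ^ 2) P = c ^ 2 * variance (fun ω => ξ 0 ω ^ 2) P := by
  rw [← variance_const_mul]
  refine variance_congr ?_
  filter_upwards [hY.recursion 0] with ω hω
  rw [hω, mul_pow, archVolatility]
  simp only [ha, zero_mul, Finset.sum_const_zero, add_zero]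
  rw [Real.sq_sqrt hc, mul_comm]

end

/-- In the absence of lags the variance of the squared noise cancels in the correction factor. -/
lemma correctionFactor_eq {Ω : Type*} [MeasurableSpace Ω] {P : Measure Ω} [IsProbabilityMeasure P]
    {ξ : ℤ → Ω → ℝ} {p : ℕ} {a₀ : ℝ → ℝ} {a : Fin p → ℝ} {Xs : ℝ → ℤ → Ω → ℝ}
    (hXs : ∀ u ∈ Icc (0 : ℝ) 1, IsStationaryARCH P ξ (a₀ u) a (Xs u)) (ha : ∀ j, a j = 0)
    (hpos : ∀ u ∈ Icc (0 : ℝ) 1, 0 < a₀ u) (hvar : variance (fun ω => ξ 0 ω ^ 2) P ≠ 0) :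
    correctionFactor P Xs
      = (∫ u in (0 : ℝ)..1, a₀ u ^ 4) / (∫ u in (0 : ℝ)..1, a₀ u ^ 2) ^ 2 := by
  set V := variance (fun ω => ξ 0 ω ^ 2) P with hV
  have hval : ∀ u ∈ uIcc (0 : ℝ) 1, variance (fun ω => Xs u 0 ω ^ 2) P = V * a₀ u ^ 2 := by
    intro u hu
    rw [uIcc_of_le zero_le_one] at hu
    rw [(hXs u hu).variance_sq ha (hpos u hu).le, mul_comm]
  have h1 : ∫ u in (0 : ℝ)..1, variance (fun ω => Xs u 0 ω ^ 2) P
      = V * ∫ u in (0 : ℝ)..1, a₀ u ^ 2 := by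
    rw [intervalIntegral.integral_congr hval, intervalIntegral.integral_const_mul]
  have h2 : ∫ u in (0 : ℝ)..1, variance (fun ω => Xs u 0 ω ^ 2) P ^ 2
      = V ^ 2 * ∫ u in (0 : ℝ)..1, a₀ u ^ 4 := by
    rw [← intervalIntegral.integral_const_mul]
    refine intervalIntegral.integral_congr fun u hu => ?_
    simp only [hval u hu]
    ring
  rw [correctionFactor, h1, h2, mul_pow, mul_div_mul_left _ _ (pow_ne_zero 2 hvar)]

/-- A Lipschitz function on `[0,1]` agrees there with a function on the line which is Lipschitz and
bounded; positivity is preserved. -/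
lemma exists_extension_of_lipschitzOnWith {a₀ : ℝ → ℝ} {L : ℝ≥0}
    (hL : LipschitzOnWith L a₀ (Icc 0 1)) (hpos : ∀ u ∈ Icc (0 : ℝ) 1, 0 < a₀ u) :
    ∃ α : ℝ → ℝ, ∃ W : ℝ, (∀ u ∈ Icc (0 : ℝ) 1, α u = a₀ u) ∧ (∀ x, |α x| ≤ W) ∧
      (∀ x y, |α x - α y| ≤ L * |x - y|) ∧ ∀ x, 0 < α x := by
  have hmem : ∀ x, (projIcc (0 : ℝ) 1 zero_le_one x : ℝ) ∈ Icc (0 : ℝ) 1 := fun x =>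
    (projIcc (0 : ℝ) 1 zero_le_one x).2
  obtain ⟨W, hW⟩ := isCompact_Icc.exists_bound_of_continuousOn hL.continuousOn
  refine ⟨fun x => a₀ (projIcc 0 1 zero_le_one x), W, fun u hu => ?_, fun x => hW _ (hmem x),
    fun x y => ?_, fun x => hpos _ (hmem x)⟩
  · simp only [projIcc_of_mem zero_le_one hu]
  · have h := hL.dist_le_mul _ (hmem x) _ (hmem y)
    rw [Real.dist_eq, Real.dist_eq] at h
    refine h.trans (mul_le_mul_of_nonneg_left ?_ L.2)
    have h2 := (LipschitzWith.projIcc (zero_le_one (α := ℝ))).dist_le_mul x y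
    rw [NNReal.coe_one, one_mul, Real.dist_eq, Subtype.dist_eq, Real.dist_eq] at h2
    exact h2

section
variable {b : ℕ → ℝ} {c C h : ℝ}

lemma tendsto_bandwidth (hh : 0 < h) (hc : 0 < c)
    (hb : ∀ᶠ T : ℕ in atTop, b T ∈ Icc (c * (T : ℝ) ^ (-h)) (C * (T : ℝ) ^ (-h))) :
    Tendsto b atTop (𝓝 0) := by
  have hlim : Tendsto (fun T : ℕ => C * (T : ℝ) ^ (-h)) atTop (𝓝 0) := by
    simpa using ((tendsto_rpow_neg_atTop hh).comp tendsto_natCast_atTop_atTop).const_mul C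
  refine squeeze_zero' ?_ ?_ hlim
  · filter_upwards [hb] with T hT
    exact (mul_nonneg hc.le (Real.rpow_nonneg (Nat.cast_nonneg T) _)).trans hT.1
  · filter_upwards [hb] with T hT using hT.2

lemma tendsto_natCast_mul_bandwidth (hh : h < 1) (hc : 0 < c)
    (hb : ∀ᶠ T : ℕ in atTop, b T ∈ Icc (c * (T : ℝ) ^ (-h)) (C * (T : ℝ) ^ (-h))) :
    Tendsto (fun T : ℕ => T * b T) atTop atTop := by
  have hlim : Tendsto (fun T : ℕ => c * (T : ℝ) ^ (1 - h)) atTop atTop :=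
    ((tendsto_rpow_atTop (by linarith : 0 < 1 - h)).comp
      tendsto_natCast_atTop_atTop).const_mul_atTop hc
  refine tendsto_atTop_mono' _ ?_ hlim
  filter_upwards [hb, eventually_gt_atTop 0] with T hT h0
  have hT0 : (0 : ℝ) < T := by exact_mod_cast h0
  rw [sub_eq_add_neg, Real.rpow_add hT0, Real.rpow_one, mul_left_comm]
  exact mul_le_mul_of_nonneg_left hT.1 hT0.le

lemma tendsto_sqrt_mul_inv_bandwidth (hh : h < 1 / 2) (hc : 0 < c)
    (hb : ∀ᶠ T : ℕ in atTop, b T ∈ Icc (c * (T : ℝ) ^ (-h)) (C * (T : ℝ) ^ (-h))) {κ : ℝ}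
    (hκ : 0 < κ) : Tendsto (fun T : ℕ => √(T : ℝ) * (κ / (T * b T))) atTop (𝓝 0) := by
  have hlim : Tendsto (fun T : ℕ => κ / c * (T : ℝ) ^ (-(1 / 2 - h))) atTop (𝓝 0) := by
    simpa using ((tendsto_rpow_neg_atTop (by linarith : 0 < 1 / 2 - h)).comp
      tendsto_natCast_atTop_atTop).const_mul (κ / c)
  refine squeeze_zero' ?_ ?_ hlim
  · filter_upwards [hb] with T hT
    have hb0 : 0 ≤ b T := (mul_nonneg hc.le (Real.rpow_nonneg (Nat.cast_nonneg T) _)).trans hT.1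
    positivity
  · filter_upwards [hb, eventually_gt_atTop 0] with T hT h0
    have hT0 : (0 : ℝ) < T := by exact_mod_cast h0
    have hr : 0 < (T : ℝ) ^ (-h) := Real.rpow_pos_of_pos hT0 _
    calc √(T : ℝ) * (κ / (T * b T)) ≤ √(T : ℝ) * (κ / (T * (c * (T : ℝ) ^ (-h)))) := by
          gcongr
          exact hT.1
      _ = κ / c * ((T : ℝ) ^ (1 / 2 : ℝ) / ((T : ℝ) ^ (1 : ℝ) * (T : ℝ) ^ (-h))) := by
          rw [Real.sqrt_eq_rpow, Real.rpow_one]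
          field_simp
      _ = κ / c * (T : ℝ) ^ (-(1 / 2 - h)) := by
          rw [← Real.rpow_add hT0, ← Real.rpow_sub hT0]
          congr 2; ring

lemma tendsto_sqrt_mul_sq_bandwidth (hh : 1 / 4 < h) (hc : 0 < c)
    (hb : ∀ᶠ T : ℕ in atTop, b T ∈ Icc (c * (T : ℝ) ^ (-h)) (C * (T : ℝ) ^ (-h))) (L : ℝ) :
    Tendsto (fun T : ℕ => √(T : ℝ) * (L * b T) ^ 2) atTop (𝓝 0) := by
  have hlim : Tendsto (fun T : ℕ => (L * C) ^ 2 * (T : ℝ) ^ (-(2 * h - 1 / 2))) atTop (𝓝 0) := by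
    simpa using ((tendsto_rpow_neg_atTop (by linarith : 0 < 2 * h - 1 / 2)).comp
      tendsto_natCast_atTop_atTop).const_mul ((L * C) ^ 2)
  refine squeeze_zero' (Eventually.of_forall fun T => by positivity) ?_ hlim
  filter_upwards [hb, eventually_gt_atTop 0] with T hT h0
  have hT0 : (0 : ℝ) < T := by exact_mod_cast h0
  have hb0 : 0 ≤ b T := (mul_nonneg hc.le (Real.rpow_nonneg (Nat.cast_nonneg T) _)).trans hT.1
  calc √(T : ℝ) * (L * b T) ^ 2 = L ^ 2 * (√(T : ℝ) * b T ^ 2) := by ring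
    _ ≤ L ^ 2 * (√(T : ℝ) * (C * (T : ℝ) ^ (-h)) ^ 2) := by
        gcongr
        exact hT.2
    _ = (L * C) ^ 2 * ((T : ℝ) ^ (1 / 2 : ℝ) * ((T : ℝ) ^ (-h) * (T : ℝ) ^ (-h))) := by
        rw [Real.sqrt_eq_rpow]; ring
    _ = (L * C) ^ 2 * (T : ℝ) ^ (-(2 * h - 1 / 2)) := by
        rw [← Real.rpow_add hT0, ← Real.rpow_add hT0]
        congr 2; ring

end

/-- Without lags, the centred squares of the ARCH array are the centred observations of the noise
`f(ξ_t) = ξ_t² - 1`. -/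
lemma centredSq_eq_centredObs {Ω : Type*} {ξ : ℤ → Ω → ℝ} {p : ℕ} {α : ℝ → ℝ} {K : ℝ → ℝ}
    {b : ℕ → ℝ} {T : ℕ} {x : ℤ → ℝ} {ω : Ω}
    (hx : ∀ t ∈ Finset.Icc (1 : ℤ) T, x t ^ 2 = α (t / T) * ξ t ω ^ 2) {t : ℤ}
    (ht : t ∈ Finset.Icc (1 : ℤ) T) :
    centredSq K p T (b T) x t
      = centredObs p α (fun x => x ^ 2 - 1) ξ (fun T => kernelWeight K p T (b T)) T t ω := by
  have hsum : kernelMeanSq K p T (b T) x t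
      = ∑ i ∈ Finset.Icc ((p : ℤ) + 1) T, kernelWeight K p T (b T) t i
          * (α (i / T) * ξ i ω ^ 2) := by
    refine Finset.sum_congr rfl fun i hi => ?_
    rw [hx i ?_]
    simp only [Finset.mem_Icc] at hi ⊢
    omega
  rw [centredSq, hsum, hx t ht, centredObs, smoothingError, sub_sub _ (Finset.sum _ _),
    ← Finset.sum_add_distrib]
  have : ∀ i : ℤ, kernelWeight K p T (b T) t i * α (i / T)
      + kernelWeight K p T (b T) t i * α (i / T) * (ξ i ω ^ 2 - 1)
      = kernelWeight K p T (b T) t i * (α (i / T) * ξ i ω ^ 2) := fun i => by ring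
  simp only [this]
  ring

theorem proposition3
    {Ω : Type*} [MeasurableSpace Ω] (P : Measure Ω) [IsProbabilityMeasure P]
    {Ω' : Type*} [MeasurableSpace Ω'] (P' : Measure Ω') [IsProbabilityMeasure P']
    (p : ℕ)
    -- the noise, with the moment assumption of order 4, and non-degenerate squares
    (ξ : ℤ → Ω → ℝ) (hξ : IsStrongWhiteNoise P ξ)
    (δ : ℝ) (hδ : MomentCondition P ξ 4 δ)
    (hvar : 0 < variance (fun ω => ξ 0 ω ^ 2) P)
    -- the model, and its stationary approximations
    (a₀ : ℝ → ℝ) (a : Fin p → ℝ) (ha : ContractionCondition a₀ a)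
    (X : ℕ → ℤ → Ω → ℝ) (hX : IsTimeVaryingInterceptARCH P ξ a₀ a X)
    (Xs : ℝ → ℤ → Ω → ℝ) (hXs : ∀ u ∈ Icc (0 : ℝ) 1, IsStationaryARCH P ξ (a₀ u) a (Xs u))
    -- the kernel and the bandwidth
    (K : ℝ → ℝ) (hK : IsSmoothingKernel K)
    (h : ℝ) (hh_lower : 1 / 4 < h) (hh_upper : h < 3 / 4 - 1 / (2 * (1 + δ)))
    (c C : ℝ) (hc : 0 < c) (hC : 0 < C)
    (b : ℕ → ℝ) (hb : ∀ᶠ T : ℕ in atTop, b T ∈ Icc (c * (T : ℝ) ^ (-h)) (C * (T : ℝ) ^ (-h)))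
    -- the least-squares estimators of the lag coefficients
    (aHat : ℕ → Ω → Fin p → ℝ) (haHat_meas : ∀ T, AEMeasurable (aHat T) P)
    (haHat : ∀ T, ∀ᵐ ω ∂P,
      IsMinOn (leastSquaresCriterion K p T (b T) (fun t => X T t ω)) univ (aHat T ω))
    -- a standard Gaussian vector
    (Z : Ω' → Fin p → ℝ) (hZ : HasLaw Z (Measure.pi fun _ : Fin p => gaussianReal 0 1) P')
    -- the null hypothesis
    (H₀ : ∀ j, a j = 0) :
    correctionFactor P Xs
        = (∫ u in (0 : ℝ)..1, a₀ u ^ 4) / (∫ u in (0 : ℝ)..1, a₀ u ^ 2) ^ 2 ∧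
      TendstoInDistribution
        (fun (T : ℕ) (ω : Ω) => (T : ℝ) * ∑ j, max (aHat T ω j) 0 ^ 2) atTop
        (fun ω' : Ω' => correctionFactor P Xs * ∑ j, max (Z ω' j) 0 ^ 2)
        (fun _ => P) P' := by
  have hfactor := correctionFactor_eq hXs H₀ ha.pos hvar.ne'
  refine ⟨hfactor, ?_⟩
  obtain ⟨L, hL⟩ := ha.lipschitz
  obtain ⟨α, W, hα, hαW, hαL, hα0⟩ := exists_extension_of_lipschitzOnWith hL ha.pos
  -- the exponent `δ < 1` forces the bandwidth exponent below `1/2`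
  have hh_half : h < 1 / 2 := by
    have h1 : (1 : ℝ) / 4 < 1 / (2 * (1 + δ)) :=
      one_div_lt_one_div_of_lt (by linarith [hδ.exponent_mem.1]) (by linarith [hδ.exponent_mem.2])
    linarith
  have hb_pos : ∀ᶠ T in atTop, 0 ≤ b T := by
    filter_upwards [hb] with T hT
    exact (mul_nonneg hc.le (Real.rpow_nonneg (Nat.cast_nonneg T) _)).trans hT.1
  obtain ⟨κ, hκ, hk⟩ := hK.exists_isSmoothing p hαL (tendsto_bandwidth (by linarith) hc hb)
    (tendsto_natCast_mul_bandwidth (by linarith) hc hb)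
  have hsq := hξ.memLp_sq hδ
  have hf2 : MemLp (fun ω => ξ 0 ω ^ 2 - 1) 2 P := hsq.sub (memLp_const 1)
  have hf0 : ∫ ω, (ξ 0 ω ^ 2 - 1) ∂P = 0 := by
    rw [integral_sub (hsq.integrable (by norm_num)) (integrable_const _), hξ.integral_sq]
    simp
  set V := ∫ ω, (ξ 0 ω ^ 2 - 1) ^ 2 ∂P with hV
  have hV0 : 0 < V := by
    rw [variance_eq_integral hsq.aemeasurable, hξ.integral_sq] at hvar
    exact hvar
  have hα2 : ∫ x in (0 : ℝ)..1, α x ^ 2 = ∫ u in (0 : ℝ)..1, a₀ u ^ 2 :=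
    intervalIntegral.integral_congr fun u hu => by
      rw [uIcc_of_le zero_le_one] at hu
      simp only [hα u hu]
  have hα4 : ∫ x in (0 : ℝ)..1, α x ^ 4 = ∫ u in (0 : ℝ)..1, a₀ u ^ 4 :=
    intervalIntegral.integral_congr fun u hu => by
      rw [uIcc_of_le zero_le_one] at hu
      simp only [hα u hu]
  have hαc : Continuous α := (LipschitzWith.of_dist_le_mul fun x y => by
    rw [Real.dist_eq, Real.dist_eq]; exact hαL x y : LipschitzWith L α).continuous
  have hI2 : 0 < ∫ x in (0 : ℝ)..1, α x ^ 2 :=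
    intervalIntegral.intervalIntegral_pos_of_pos ((hαc.pow 2).intervalIntegrable 0 1)
      (fun x => pow_pos (hα0 x) 2) one_pos
  have hI4 : 0 ≤ ∫ x in (0 : ℝ)..1, α x ^ 4 :=
    intervalIntegral.integral_nonneg zero_le_one fun x _ => (pow_pos (hα0 x) 4).le
  -- the squared observations
  have hXsq : ∀ T : ℕ, ∀ᵐ ω ∂P, ∀ t ∈ Finset.Icc (1 : ℤ) T,
      X T t ω ^ 2 = α (t / T) * ξ t ω ^ 2 := by
    intro T
    refine ae_all_iff.2 fun t => ?_
    by_cases ht : t ∈ Finset.Icc (1 : ℤ) T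
    · rw [Finset.mem_Icc] at ht
      filter_upwards [hX.recursion T t ht.1 ht.2] with ω hω _
      have hT0 : (0 : ℝ) < T := by
        have : (1 : ℤ) ≤ T := ht.1.trans ht.2
        exact_mod_cast (by omega : 0 < T)
      have hmem : (t : ℝ) / T ∈ Icc (0 : ℝ) 1 :=
        ⟨div_nonneg (by exact_mod_cast (by omega : 0 ≤ t)) hT0.le,
          (div_le_one hT0).2 (by exact_mod_cast ht.2)⟩
      rw [hω, mul_pow, archVolatility]
      simp only [H₀, zero_mul, Finset.sum_const_zero, add_zero]
      rw [Real.sq_sqrt (ha.pos _ hmem).le, hα _ hmem, mul_comm]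
    · exact Eventually.of_forall fun ω h => absurd h ht
  have hnormal : ∀ T : ℕ, ∀ᵐ ω ∂P, ∀ j : Fin p, ∑ l : Fin p,
      (∑ t ∈ Finset.Icc ((p : ℤ) + 1) T,
        centredObs p α (fun x => x ^ 2 - 1) ξ (fun T => kernelWeight K p T (b T)) T
            (t - ((j : ℤ) + 1)) ω
          * centredObs p α (fun x => x ^ 2 - 1) ξ (fun T => kernelWeight K p T (b T)) T
            (t - ((l : ℤ) + 1)) ω) * aHat T ω l
      = ∑ t ∈ Finset.Icc ((p : ℤ) + 1) T,
        centredObs p α (fun x => x ^ 2 - 1) ξ (fun T => kernelWeight K p T (b T)) T t ω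
          * centredObs p α (fun x => x ^ 2 - 1) ξ (fun T => kernelWeight K p T (b T)) T
            (t - ((j : ℤ) + 1)) ω := by
    intro T
    filter_upwards [hXsq T, haHat T] with ω hω hmin j
    have hlag : ∀ t ∈ Finset.Icc ((p : ℤ) + 1) T, ∀ l : Fin p,
        t - ((l : ℤ) + 1) ∈ Finset.Icc (1 : ℤ) T := by
      intro t ht l
      have := l.2
      simp only [Finset.mem_Icc] at ht ⊢
      omega
    have hcur : ∀ t ∈ Finset.Icc ((p : ℤ) + 1) T, t ∈ Finset.Icc (1 : ℤ) T := by
      intro t ht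
      simp only [Finset.mem_Icc] at ht ⊢
      omega
    have key := normal_equations_of_isMinOn (Finset.Icc ((p : ℤ) + 1) T)
      (centredSq K p T (b T) fun t => X T t ω)
      (fun t (l : Fin p) => centredSq K p T (b T) (fun t => X T t ω) (t - ((l : ℤ) + 1))) hmin j
    have hc := fun {t : ℤ} (ht : t ∈ Finset.Icc (1 : ℤ) T) =>
      centredSq_eq_centredObs (ξ := ξ) (K := K) (b := b) (p := p) (α := α) (ω := ω) hω ht
    have hl : ∀ l : Fin p, _ = _ := fun l => Finset.sum_congr rfl fun t ht =>
      (congrArg₂ (· * ·) (hc (hlag t ht j)) (hc (hlag t ht l)))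
    have hr : _ = _ := Finset.sum_congr rfl fun t ht =>
      (congrArg₂ (· * ·) (hc (hcur t ht)) (hc (hlag t ht j)))
    exact (Finset.sum_congr rfl fun l _ => congrArg (· * aHat T ω l) (hl l)).symm.trans
      (key.trans hr)
  have hmain := hξ.isIID.tendstoInDistribution_leastSquares hZ hαW hαL
    (γ := V * ∫ x in (0 : ℝ)..1, α x ^ 2) (v := V ^ 2 * ∫ x in (0 : ℝ)..1, α x ^ 4)
    (f := fun x => x ^ 2 - 1) (by fun_prop) hf2 hf0 hk
    (by
      filter_upwards [hb_pos] with T hT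
      positivity)
    (by
      filter_upwards [hb_pos] with T hT
      positivity)
    (tendsto_sqrt_mul_inv_bandwidth hh_half hc hb hκ)
    (tendsto_sqrt_mul_sq_bandwidth hh_lower hc hb L) rfl (mul_pos hV0 hI2) rfl haHat_meas hnormal
  have hcomp := hmain.continuous_comp (g := fun y : Fin p → ℝ => ∑ j, max (y j) 0 ^ 2)
    (by fun_prop)
  have hmax : ∀ r x : ℝ, 0 ≤ r → max (r * x) 0 ^ 2 = r ^ 2 * max x 0 ^ 2 := fun r x hr => by
    rw [← mul_pow, mul_max_of_nonneg _ _ hr, mul_zero]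
  convert hcomp using 1
  · funext T ω
    simp only [Function.comp, Pi.smul_apply, smul_eq_mul, hmax _ _ (Real.sqrt_nonneg _),
      ← Finset.mul_sum, Real.sq_sqrt (Nat.cast_nonneg T)]
  · funext ω'
    simp only [Function.comp, Pi.smul_apply, smul_eq_mul,
      hmax _ _ (inv_nonneg.2 (mul_pos hV0 hI2).le), hmax _ _ (Real.sqrt_nonneg _),
      ← Finset.mul_sum]
    rw [Real.sq_sqrt (mul_nonneg (sq_nonneg _) hI4), hfactor, ← hα2, ← hα4, ← mul_assoc]
    congr 1
    field_simp
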